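/- **Setting.** Let $n\ge 2$, let $\mathcal D$ be a probability distribution on $[n]=\{1,\dots,n\}$, and let $\mathcal Q$ be a probability distribution on the unordered pairs of distinct elements of $[n]$. One draw from the oracle $\mathrm{Samp}(\mathcal Q;\mathcal D)$ returns $(i,j,w)$, where $\{i,j\}\sim\mathcal Q$ and the winner $w\in\{i,j\}$ is drawn from $\mathcal D$ conditioned on $\{i,j\}$; draws are independent. Let $\mathcal E$ be the support of $\mathcal Q$, and let $\lambda(\boldsymbol Q)$ be the Fiedler (second smallest) eigenvalue of the Laplacian $\boldsymbol Q$ with $\boldsymbol Q_{xy}=-\mathcal Q(\{x,y\})$ for $x\ne y$ and $\boldsymbol Q\mathbf 1=0$. Assume that the graph $([n],\mathcal E)$ is connected and that, for a constant $\varphi>1$, $\frac1\varphi\le \mathcal D(x)/\mathcal D(y)\le\varphi$ for all $\{x,y\}\in\mathcal E$. **Parameterized sampler.** For $p\in(0,1]^n$, $\textsc{ExactSampler}(p)$ does the following. Start with $F(x)=x$ for all $x\in[n]$. While $F$ is not constant, draw $(i,j,w)$ from the oracle and, for the loser $x\in\{i,j\}\setminus\{w\}$, replace $F(x)$ by $F(w)$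 with probability $\min\{p(x)/p(w),1\}$ (coupling from the past for the $p$-rescaled chain). When $F$ is constant, output $F(1)$ with probability $p(F(1))$, and $\perp$ otherwise. **Full algorithm.** Given $n,\delta,\lambda(\boldsymbol Q),\varphi$, the algorithm first calls a learning procedure once, with accuracy $1/\sqrt n$ and confidence $\delta$, which draws samples and returns an estimate $\widetilde{\mathcal D}$ of $\mathcal D$; it then repeats $\textsc{ExactSampler}(\widetilde{\mathcal D})$ with fresh randomness until the output is not $\perp$, and outputs it. Time is counted in steps of a randomized real RAM (unit-cost real arithmetic, $\sqrt{\cdot}$, $\exp$, $\log$, comparisons, oracle calls and biased coins). **Theorem.** For every $\varphi>1$ there are a learning procedure (one program, the same for all $n,\mathcal D,\mathcal Q,\delta$) and constants $C,k$ such that the following holds for all $n\ge2$ and all $\mathcal D,\mathcal Q$ as above. (1) For every $p\in(0,1]^n$, $\textsc{ExactSampler}(p)$ halts with probability $1$, after at most $C N^{k}$ steps, where $N$ is the number of draws it made; it outputs each $x\in[n]$ with probability $\mathcal D(x)\big/\sum_{y}\mathcal D(y)/p(y)$. If moreover $|1-\mathcal D(x)/p(x)|\le 1/\sqrt n$ and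 $|1-p(x)/\mathcal D(x)|\le 1/\sqrt n$ for all $x$, then for every $\delta\in(0,1)$ it makes at most $C\,\frac{n\log n}{\lambda(\boldsymbol Q)}\log\frac2\delta$ draws with probability at least $1-\delta$. (2) For every $\delta\in(0,1)$: the learning procedure halts almost surely and returns a probability distribution $\widetilde{\mathcal D}$ that is positive on $[n]$; with probability at least $1-\delta$, $\max_x\max\{|1-\mathcal D(x)/\widetilde{\mathcal D}(x)|,|1-\widetilde{\mathcal D}(x)/\mathcal D(x)|\}\le 1/\sqrt n$. The full algorithm halts almost surely, after at most $CN^{k}$ steps, where $N$ is the number of draws it made; its output is distributed exactly as $\mathcal D$; and with probability at least $1-\delta$, $$N\le C\,\frac{n^2\log^2 n}{\lambda(\boldsymbol Q)}\log\frac2\delta .$$ -/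

import Mathlib

namespace PairwiseSampling

/-! ## Local sampling schemes -/

section LSS

variable {n : ℕ}

/-- A pair distribution: every drawn pair consists of two distinct elements. -/
def IsPairDistribution (Q : PMF (Sym2 (Fin n))) : Prop :=
  ∀ e ∈ Q.support, ¬ e.IsDiag

/-- The graph on `[n]` whose edges are the pairs in the support of `Q`. -/
def pairGraph (Q : PMF (Sym2 (Fin n))) : SimpleGraph (Fin n) :=
  SimpleGraph.fromEdgeSet Q.support

/-- On every edge `{x, y}` of the support of `Q`, the ratio `D x / D y` is at most `φ`
(hence, `x` and `y` being interchangeable, it lies in `[1/φ, φ]`). -/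
def BoundedRatios (D : PMF (Fin n)) (Q : PMF (Sym2 (Fin n))) (φ : ℝ) : Prop :=
  ∀ x y : Fin n, s(x, y) ∈ Q.support → (D x).toReal ≤ φ * (D y).toReal

/-- The weighted Laplacian of the pair distribution: off-diagonal entries `-Q(x,y)`, rows that
sum to zero. -/
noncomputable def laplacian (Q : PMF (Sym2 (Fin n))) : Matrix (Fin n) (Fin n) ℝ :=
  Matrix.of fun x y =>
    if x = y then ∑ z ∈ Finset.univ.erase x, (Q s(x, z)).toReal else -(Q s(x, y)).toReal

theorem laplacian_isHermitian (Q : PMF (Sym2 (Fin n))) : (laplacian Q).IsHermitian := by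
  ext x y
  by_cases h : x = y
  · subst h; simp [laplacian]
  · have h' : ¬ y = x := fun e => h e.symm
    simp [laplacian, h, h', Sym2.eq_swap]

/-- The Fiedler eigenvalue: the second smallest eigenvalue, counted with multiplicity, of the
weighted Laplacian. (`eigenvalues₀` lists the eigenvalues in decreasing order.) -/
noncomputable def fiedler (hn : 2 ≤ n) (Q : PMF (Sym2 (Fin n))) : ℝ :=
  (laplacian_isHermitian Q).eigenvalues₀ ⟨n - 2, by rw [Fintype.card_fin]; omega⟩

open Classical in
/-- The conditional distribution of `D` on the pair `e`. (When `e` has `D`-mass zero it is not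
defined, and `D` itself is used.) -/
noncomputable def condPair (D : PMF (Fin n)) (e : Sym2 (Fin n)) : PMF (Fin n) :=
  if h : ∃ a ∈ {x : Fin n | x ∈ e}, a ∈ D.support then D.filter {x : Fin n | x ∈ e} h else D

/-- One draw `(i, j, w)` from the local sampling scheme `Samp(Q; D)`: the pair `{i, j}` is drawn
from `Q`, and the winner `w` from `D` conditioned on `{i, j}`. -/
noncomputable def samp (Q : PMF (Sym2 (Fin n))) (D : PMF (Fin n)) :
    PMF (Fin n × Fin n × Fin n) :=
  Q.bind fun e => (condPair D e).map fun w => (e.inf, e.sup, w)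

/-- The randomness available to an algorithm: an infinite sequence of draws from the oracle and
an infinite sequence of points of `[0,1]` that drive its internal coins. -/
abbrev Tape (n : ℕ) : Type :=
  (ℕ → Fin n × Fin n × Fin n) × (ℕ → unitInterval)

/-- The law of the tape: i.i.d. draws from `Samp(Q; D)` and, independently, i.i.d. uniform points
of `[0,1]`. -/
noncomputable def tapeLaw (Q : PMF (Sym2 (Fin n))) (D : PMF (Fin n)) :
    MeasureTheory.Measure (Tape n) :=
  (MeasureTheory.Measure.infinitePi fun _ : ℕ => (samp Q D).toMeasure).prod
    (MeasureTheory.Measure.infinitePi fun _ : ℕ =>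
      (MeasureTheory.volume : MeasureTheory.Measure unitInterval))

end LSS

/-! ## Randomized real-RAM programs with a step count

The memory consists of arrays of natural numbers and arrays of real numbers (a scalar is cell `0`
of an array). A program is a finite piece of syntax without real constants. -/

/-- Expressions for natural numbers: literals, array cells, addition, truncated subtraction. -/
inductive NExp : Type
  | lit (k : ℕ)
  | get (a : ℕ) (i : NExp)
  | add (e f : NExp)
  | sub (e f : NExp)

/-- Expressions for real numbers. -/
inductive RExp : Type
  | ofNat (e : NExp)
  | get (a : ℕ) (i : NExp)
  | add (e f : RExp)
  | sub (e f : RExp)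
  | mul (e f : RExp)
  | div (e f : RExp)
  | sqrt (e : RExp)
  | exp (e : RExp)
  | log (e : RExp)

/-- Tests. -/
inductive BExp : Type
  | eqN (e f : NExp)
  | ltN (e f : NExp)
  | ltR (e f : RExp)
  | and (b c : BExp)
  | or (b c : BExp)
  | not (b : BExp)

/-- Statements. `sample a b c` calls the oracle once and stores the two compared elements and the
winner in the scalars `a`, `b`, `c`; `coin a p` stores in the scalar `a` the outcome (`1` or `0`)
of a fresh Bernoulli coin of bias `p`. -/
inductive Stmt : Type
  | setN (a : ℕ) (i : NExp) (e : NExp)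
  | setR (a : ℕ) (i : NExp) (e : RExp)
  | sample (a b c : ℕ)
  | coin (a : ℕ) (p : RExp)
  | skip
  | seq (s t : Stmt)
  | ite (b : BExp) (s t : Stmt)
  | while (b : BExp) (s : Stmt)

/-- The memory, together with the number of oracle calls, of coin tosses and of steps so far. -/
structure State : Type where
  nat : ℕ → ℕ → ℕ
  real : ℕ → ℕ → ℝ
  draws : ℕ
  coins : ℕ
  steps : ℕ

namespace State

/-- Count one step. -/
def tick (σ : State) : State := { σ with steps := σ.steps + 1 }

/-- Write to a cell of an array of natural numbers. -/
def writeN (σ : State) (a i v : ℕ) : State :=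
  { σ with nat := Function.update σ.nat a (Function.update (σ.nat a) i v) }

/-- Write to a cell of an array of reals. -/
noncomputable def writeR (σ : State) (a i : ℕ) (v : ℝ) : State :=
  { σ with real := Function.update σ.real a (Function.update (σ.real a) i v) }

end State

def NExp.val (σ : State) : NExp → ℕ
  | .lit k => k
  | .get a i => σ.nat a (i.val σ)
  | .add e f => e.val σ + f.val σ
  | .sub e f => e.val σ - f.val σ

noncomputable def RExp.val (σ : State) : RExp → ℝ
  | .ofNat e => (e.val σ : ℝ)
  | .get a i => σ.real a (i.val σ)
  | .add e f => e.val σ + f.val σ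
  | .sub e f => e.val σ - f.val σ
  | .mul e f => e.val σ * f.val σ
  | .div e f => e.val σ / f.val σ
  | .sqrt e => Real.sqrt (e.val σ)
  | .exp e => Real.exp (e.val σ)
  | .log e => Real.log (e.val σ)

def BExp.holds (σ : State) : BExp → Prop
  | .eqN e f => e.val σ = f.val σ
  | .ltN e f => e.val σ < f.val σ
  | .ltR e f => e.val σ < f.val σ
  | .and b c => b.holds σ ∧ c.holds σ
  | .or b c => b.holds σ ∨ c.holds σ
  | .not b => ¬ b.holds σ

/-- The result of one oracle call. -/
def State.doSample {n : ℕ} (ω : Tape n) (σ : State) (a b c : ℕ) : State :=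
  let t := ω.1 σ.draws
  let σ' := ((σ.writeN a 0 t.1).writeN b 0 t.2.1).writeN c 0 t.2.2
  { σ' with draws := σ.draws + 1 }

open Classical in
/-- The result of one toss of a coin of bias `p`. -/
noncomputable def State.doCoin {n : ℕ} (ω : Tape n) (σ : State) (a : ℕ) (p : ℝ) : State :=
  let σ' := σ.writeN a 0 (if (ω.2 σ.coins : ℝ) < p then 1 else 0)
  { σ' with coins := σ.coins + 1 }

/-- `Exec ω s σ τ`: with randomness `ω`, the statement `s` started in `σ` halts in `τ`. Every
elementary statement that is executed and every test that is evaluated costs one step (the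
expressions in a program have bounded size, so this is its number of machine operations up to a
constant factor). A program that does not halt has no final state. -/
inductive Exec {n : ℕ} (ω : Tape n) : Stmt → State → State → Prop
  | setN (a : ℕ) (i e : NExp) (σ : State) :
      Exec ω (.setN a i e) σ (σ.writeN a (i.val σ) (e.val σ)).tick
  | setR (a : ℕ) (i : NExp) (e : RExp) (σ : State) :
      Exec ω (.setR a i e) σ (σ.writeR a (i.val σ) (e.val σ)).tick
  | sample (a b c : ℕ) (σ : State) :
      Exec ω (.sample a b c) σ (σ.doSample ω a b c).tick
  | coin (a : ℕ) (p : RExp) (σ : State) :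
      Exec ω (.coin a p) σ (σ.doCoin ω a (p.val σ)).tick
  | skip (σ : State) : Exec ω .skip σ σ.tick
  | seq {s t : Stmt} {σ τ ρ : State} :
      Exec ω s σ τ → Exec ω t τ ρ → Exec ω (.seq s t) σ ρ
  | iteTrue {b : BExp} {s t : Stmt} {σ τ : State} :
      b.holds σ → Exec ω s σ.tick τ → Exec ω (.ite b s t) σ τ
  | iteFalse {b : BExp} {s t : Stmt} {σ τ : State} :
      ¬ b.holds σ → Exec ω t σ.tick τ → Exec ω (.ite b s t) σ τ
  | whileTrue {b : BExp} {s : Stmt} {σ τ ρ : State} :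
      b.holds σ → Exec ω s σ.tick τ → Exec ω (.while b s) τ ρ → Exec ω (.while b s) σ ρ
  | whileFalse {b : BExp} {s : Stmt} {σ : State} :
      ¬ b.holds σ → Exec ω (.while b s) σ σ.tick

/-! ## The algorithms

States `1, …, n` of the chain are represented by `0, …, n - 1`. -/

/-- Arrays of natural numbers: the input `n`, a loop variable, the last draw `(i, j, w)`, the
current map `F`, the flag for "`F` has coalesced", the last coin, and the output (`0` for `⊥`, and
`x + 1` for the state represented by `x`). -/
abbrev vN : ℕ := 0
abbrev vX : ℕ := 1
abbrev vI : ℕ := 2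
abbrev vJ : ℕ := 3
abbrev vW : ℕ := 4
abbrev vF : ℕ := 5
abbrev vCo : ℕ := 6
abbrev vC : ℕ := 7
abbrev vOut : ℕ := 8

/-- Arrays of reals: the inputs `δ`, `λ(Q)` and `φ`, the accuracy `ε`, and the vector `p`. -/
abbrev rDelta : ℕ := 0
abbrev rLam : ℕ := 1
abbrev rPhi : ℕ := 2
abbrev rEps : ℕ := 3
abbrev rP : ℕ := 4

/-- The value of a scalar variable. -/
abbrev nv (a : ℕ) : NExp := .get a (.lit 0)

/-- `for x = 0, …, n - 1 do s`. -/
def forX (s : Stmt) : Stmt :=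
  .seq (.setN vX (.lit 0) (.lit 0))
    (.while (.ltN (nv vX) (nv vN)) (.seq s (.setN vX (.lit 0) (.add (nv vX) (.lit 1)))))

/-- Set the flag to `1` if `F` is constant, and to `0` otherwise. -/
def testCoalescence : Stmt :=
  .seq (.setN vCo (.lit 0) (.lit 1))
    (forX (.ite (.eqN (.get vF (nv vX)) (.get vF (.lit 0))) .skip (.setN vCo (.lit 0) (.lit 0))))

/-- One step into the past: draw `(i, j, w)`; the loser `x` of the comparison takes over the value
`F(w)` with probability `min {p(x)/p(w), 1}` (a coin of bias `p(x)/p(w)` shows `1` with exactly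
this probability), and every other value of `F` stays as it is. -/
def stepBack : Stmt :=
  .seq (.sample vI vJ vW)
    (forX
      (.ite
        (.or (.and (.not (.eqN (nv vX) (nv vI))) (.not (.eqN (nv vX) (nv vJ))))
          (.eqN (nv vX) (nv vW)))
        .skip
        (.seq (.coin vC (.div (.get rP (nv vX)) (.get rP (nv vW))))
          (.ite (.eqN (nv vC) (.lit 1))
            (.setN vF (nv vX) (.get vF (nv vW)))
            .skip))))

/-- Coupling from the past for the chain rescaled by the vector `p`, followed by rejection: the
common value `F(1)` is returned with probability `p(F(1))`, and `⊥` otherwise. -/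
def exactSampler : Stmt :=
  .seq (forX (.setN vF (nv vX) (nv vX)))
  (.seq testCoalescence
  (.seq (.while (.eqN (nv vCo) (.lit 0)) (.seq stepBack testCoalescence))
  (.seq (.coin vC (.get rP (.get vF (.lit 0))))
    (.ite (.eqN (nv vC) (.lit 1))
      (.setN vOut (.lit 0) (.add (.get vF (.lit 0)) (.lit 1)))
      (.setN vOut (.lit 0) (.lit 0))))))

/-- The learning phase: the procedure `learn` is called with accuracy `ε = 1/√n`. -/
def learningPhase (learn : Stmt) : Stmt :=
  .seq (.setR rEps (.lit 0) (.div (.ofNat (.lit 1)) (.sqrt (.ofNat (nv vN))))) learn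

/-- The exact sampler with learning: learn an estimate of the target (left in the array `rP`),
then call `exactSampler` on this estimate until its output is not `⊥`. -/
def exactSamplerWithLearning (learn : Stmt) : Stmt :=
  .seq (learningPhase learn)
  (.seq (.setN vOut (.lit 0) (.lit 0))
    (.while (.eqN (nv vOut) (.lit 0)) exactSampler))

/-- An initial state with the input `n` and the real input `r`; all counters are zero. -/
noncomputable def initState (n : ℕ) (r : ℕ → ℕ → ℝ) : State where
  nat := fun a i => if a = vN ∧ i = 0 then n else 0
  real := r
  draws := 0
  coins := 0
  steps := 0

/-- The real input of the whole algorithm: the confidence `δ`, the Fiedler eigenvalue (which sets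
the number of samples of the learning phase) and the constant `φ`. -/
noncomputable def algorithmInput (δ lam φ : ℝ) : ℕ → ℕ → ℝ := fun a i =>
  if i = 0 then
    if a = rDelta then δ else if a = rLam then lam else if a = rPhi then φ else 0
  else 0

/-- The real input of a single execution of `exactSampler`: the vector `p`. -/
noncomputable def samplerInput {n : ℕ} (p : Fin n → ℝ) : ℕ → ℕ → ℝ := fun a i =>
  if h : i < n then (if a = rP then p ⟨i, h⟩ else 0) else 0

/-- The vector stored in the array `rP`. -/
def State.estimate (n : ℕ) (σ : State) : Fin n → ℝ := fun x => σ.real rP x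

/-- The relative error, in both directions, between `D` and the vector `p` is at most `ε`. -/
def RelErrorLE {n : ℕ} (D : PMF (Fin n)) (p : Fin n → ℝ) (ε : ℝ) : Prop :=
  ∀ x, |1 - (D x).toReal / p x| ≤ ε ∧ |1 - p x / (D x).toReal| ≤ ε

end PairwiseSampling

/-! Put g(x) = D(x)/p(x) and G = ∑ g. One draw moves x to w at rate `moveRate`, the probability that
w beats x times min{p(x)/p(w), 1}; these rates satisfy detailed balance with respect to g. Since F
is updated from the inside, by F(x) := F(w), this has two consequences.

Exactness. For every f, the g-average of f ∘ F is a martingale (`sum_moveRate_statMean`), and it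
equals f(F(1)) once F is constant. Hence the coalesced value has law g/G, and accepting it with
probability p(F(1)) cancels the denominator of g. `measure_output` carries this out both for the
machine that stops after a rejection and for the one that restarts.

Speed. Consider the potential ∑ g(y) g(z) over the pairs with F(y) ≠ F(z). The linear part of its
drift vanishes by detailed balance; what remains is minus twice a sum over draws that separate two
level sets of F. The Poincaré inequality for the indicators of the level sets (`poincare_partition`)
bounds this sum below by a multiple of λ/n times the potential. The potential is bounded below until
coalescence, so coalescence has an exponential tail (`sampler_tail`). A round is accepted with
probability 1/G. The restarted machine is controlled in `loop_tail` by a Lyapunov function that adds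
the logarithm of the potential and the mean cost of a restart; for an accurate p it is of order n
log n and drops by order λ/n per draw.

Learning. The draws follow a Bradley–Terry model in the log-weights of D. The learner does gradient
ascent on the log-likelihood, with the logistic function replaced outside [-log φ, log φ] by a line
of slope 1, which makes the problem strongly monotone and Lipschitz (`link_strong_mono`). In a frame
normalized for the Dirichlet form, Bernstein's inequality makes all empirical covariances accurate
to 1/(2n) and all coordinates of the noise of order √λ/n (`measure_not_concentrated`). Then the
ascent contracts to squared distance O(1/n) from the true log-weights, which is relative error 1/√n.

Assembly. The estimate is a function of the first m draws, and the rest of the tape is fresh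
(`measure_adv_draws`). Every positive p with values at most 1 gives the output law D, so exactness
does not depend on the quality of the estimate; only the bound on the number of draws does. The
programs are matched with the abstract machine `next` by explicit executions. Coalescence needs at
least n - 1 moved states, so n is at most the number of draws plus one, and all step counts are
polynomial in the number of draws. -/

namespace PairwiseSampling

/-! ### Spectral theory of the Laplacian and the Poincaré inequality -/

section Spectral

variable {n : ℕ}

/-- The Dirichlet form `½ ∑ Q(x,y) (v x - v y) (w x - w y)` of the pair distribution. -/
noncomputable def edgeForm (Q : PMF (Sym2 (Fin n))) (v w : Fin n → ℝ) : ℝ :=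
  (1 / 2) * ∑ x, ∑ y, (Q s(x, y)).toReal * ((v x - v y) * (w x - w y))

theorem edgeForm_eq_dotProduct (Q : PMF (Sym2 (Fin n))) (v w : Fin n → ℝ) :
    edgeForm Q v w = v ⬝ᵥ ((laplacian Q).mulVec w) := by
  have hmul : ∀ x, (laplacian Q).mulVec w x = ∑ y, (Q s(x, y)).toReal * (w x - w y) := by
    intro x
    simp only [Matrix.mulVec, dotProduct, laplacian, Matrix.of_apply]
    rw [← Finset.add_sum_erase _ _ (Finset.mem_univ x),
      ← Finset.add_sum_erase (f := fun y => (Q s(x, y)).toReal * (w x - w y)) _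
        (Finset.mem_univ x)]
    simp only [if_true, sub_self, mul_zero, zero_add, Finset.sum_mul]
    rw [← Finset.sum_add_distrib]
    refine Finset.sum_congr rfl fun y hy => ?_
    rw [if_neg (Finset.ne_of_mem_erase hy).symm]
    ring
  have hswap : ∑ x, ∑ y, (Q s(x, y)).toReal * (v y * (w x - w y)) =
      -∑ x, ∑ y, (Q s(x, y)).toReal * (v x * (w x - w y)) := by
    rw [Finset.sum_comm, ← Finset.sum_neg_distrib]
    refine Finset.sum_congr rfl fun x _ => ?_
    rw [← Finset.sum_neg_distrib]
    refine Finset.sum_congr rfl fun y _ => ?_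
    rw [Sym2.eq_swap]; ring
  have hsplit : ∑ x, ∑ y, (Q s(x, y)).toReal * ((v x - v y) * (w x - w y)) =
      ∑ x, ∑ y, (Q s(x, y)).toReal * (v x * (w x - w y)) -
      ∑ x, ∑ y, (Q s(x, y)).toReal * (v y * (w x - w y)) := by
    rw [← Finset.sum_sub_distrib]
    refine Finset.sum_congr rfl fun x _ => ?_
    rw [← Finset.sum_sub_distrib]
    refine Finset.sum_congr rfl fun y _ => by ring
  rw [edgeForm, hsplit, hswap, dotProduct]
  simp only [hmul, Finset.mul_sum]
  rw [sub_neg_eq_add, ← two_mul, ← mul_assoc]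
  norm_num
  refine Finset.sum_congr rfl fun x _ => Finset.sum_congr rfl fun y _ => by ring

theorem edgeForm_self_nonneg (Q : PMF (Sym2 (Fin n))) (v : Fin n → ℝ) : 0 ≤ edgeForm Q v v := by
  refine mul_nonneg (by norm_num) (Finset.sum_nonneg fun x _ => Finset.sum_nonneg fun y _ => ?_)
  exact mul_nonneg ENNReal.toReal_nonneg (mul_self_nonneg _)

/-- The form is a sum of nonnegative terms, so each increment along an edge of the support vanishes,
and a walk joins any two vertices. -/
theorem eq_of_edgeForm_self_eq_zero {Q : PMF (Sym2 (Fin n))} (hG : (pairGraph Q).Connected)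
    {v : Fin n → ℝ} (h : edgeForm Q v v = 0) (x y : Fin n) : v x = v y := by
  have hz : ∀ x y, (Q s(x, y)).toReal * ((v x - v y) * (v x - v y)) = 0 := by
    have h0 : ∑ x, ∑ y, (Q s(x, y)).toReal * ((v x - v y) * (v x - v y)) = 0 := by
      unfold edgeForm at h; linarith
    intro x y
    have hnn : ∀ x y, 0 ≤ (Q s(x, y)).toReal * ((v x - v y) * (v x - v y)) := fun x y =>
      mul_nonneg ENNReal.toReal_nonneg (mul_self_nonneg _)
    have h1 := (Finset.sum_eq_zero_iff_of_nonneg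
      fun x _ => Finset.sum_nonneg fun y _ => hnn x y).1 h0 x (Finset.mem_univ _)
    exact (Finset.sum_eq_zero_iff_of_nonneg fun y _ => hnn x y).1 h1 y (Finset.mem_univ _)
  obtain ⟨p⟩ := hG.preconnected x y
  induction p with
  | nil => rfl
  | cons hadj _ ih =>
    rw [← ih]
    have hs := ((SimpleGraph.fromEdgeSet_adj _).1 hadj).1
    have hne : (Q s(_, _)).toReal ≠ 0 := (ENNReal.toReal_pos ((PMF.mem_support_iff _ _).1 hs)
      (PMF.apply_ne_top _ _)).ne'
    have := (mul_eq_zero.1 (hz _ _)).resolve_left hne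
    linarith [mul_self_eq_zero.1 this]

/-- An orthonormal eigenbasis of the Laplacian: the eigenvector `u k₀` is constant, and all other
eigenvalues are at least the Fiedler eigenvalue, which is positive. -/
theorem exists_eigenbasis (hn : 2 ≤ n) {Q : PMF (Sym2 (Fin n))} (hG : (pairGraph Q).Connected) :
    0 < fiedler hn Q ∧ ∃ (k₀ : Fin n) (u : Fin n → Fin n → ℝ) (μ : Fin n → ℝ),
      (∀ k, k ≠ k₀ → fiedler hn Q ≤ μ k) ∧ μ k₀ = 0 ∧ (∀ x y, u k₀ x = u k₀ y) ∧
      (∀ k l, ∑ x, u k x * u l x = if k = l then 1 else 0) ∧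
      (∀ (v : Fin n → ℝ) x, v x = ∑ k, (∑ y, v y * u k y) * u k x) ∧
      (∀ (v : Fin n → ℝ) l, edgeForm Q v (u l) = μ l * ∑ y, v y * u l y) := by
  set hA := laplacian_isHermitian Q with hAdef
  set b := hA.eigenvectorBasis with hb
  set μ := hA.eigenvalues with hμ
  set u : Fin n → Fin n → ℝ := fun k x => b k x with hu
  have hinner : ∀ v w : EuclideanSpace ℝ (Fin n), inner ℝ v w = ∑ x, w x * v x := by
    intro v w; simp [PiLp.inner_apply]
  have hort : ∀ k l, ∑ x, u k x * u l x = if k = l then 1 else 0 := by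
    intro k l
    have := orthonormal_iff_ite.1 b.orthonormal k l
    rw [hinner] at this
    rw [← this]
    exact Finset.sum_congr rfl fun x _ => mul_comm _ _
  have hexp : ∀ v : Fin n → ℝ, ∀ x, v x = ∑ k, (∑ y, v y * u k y) * u k x := by
    intro v x
    have := b.sum_repr' (WithLp.toLp 2 v)
    have := congrArg (fun z : EuclideanSpace ℝ (Fin n) => z x) this
    simp only [hinner] at this
    simpa using this.symm
  have hform : ∀ (v : Fin n → ℝ) l, edgeForm Q v (u l) = μ l * ∑ y, v y * u l y := by
    intro v l
    rw [edgeForm_eq_dotProduct]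
    have : (laplacian Q).mulVec (u l) = μ l • u l := by
      simpa [hu, hb, hμ] using hA.mulVec_eigenvectorBasis l
    rw [this, dotProduct_smul, smul_eq_mul]
    rfl
  have hself : ∀ l, edgeForm Q (u l) (u l) = μ l := by
    intro l; rw [hform, hort]; simp
  have hμ0 : ∀ l, 0 ≤ μ l := fun l => by rw [← hself]; exact edgeForm_self_nonneg _ _
  let e : Fin (Fintype.card (Fin n)) ≃ Fin n := Fintype.equivOfCardEq (Fintype.card_fin _)
  have hμe : ∀ i, μ (e i) = hA.eigenvalues₀ i := by
    intro i; simp [hμ, Matrix.IsHermitian.eigenvalues, e]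
  have hcard : Fintype.card (Fin n) = n := Fintype.card_fin n
  -- The list `eigenvalues₀` is decreasing: its last index n - 1 carries the smallest eigenvalue and
  -- n - 2 the Fiedler eigenvalue.
  let i₀ : Fin (Fintype.card (Fin n)) := ⟨n - 1, by omega⟩
  let i₁ : Fin (Fintype.card (Fin n)) := ⟨n - 2, by omega⟩
  have hi : i₁ ≠ i₀ := by simp only [i₀, i₁, ne_eq, Fin.mk.injEq]; omega
  have hf : fiedler hn Q = μ (e i₁) := by rw [hμe]; rfl
  have hle : μ (e i₀) ≤ μ (e i₁) := by
    rw [hμe, hμe]; apply hA.eigenvalues₀_antitone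
    simp only [i₀, i₁, Fin.mk_le_mk]; omega
  -- If the second smallest eigenvalue were zero, two orthonormal eigenvectors would both be
  -- constant, which is impossible.
  have hpos : 0 < fiedler hn Q := by
    rw [hf]
    refine lt_of_le_of_ne (hμ0 _) fun h0 => ?_
    have h1 : μ (e i₀) = 0 := le_antisymm (h0 ▸ hle) (hμ0 _)
    have c1 := eq_of_edgeForm_self_eq_zero hG ((hself (e i₁)).trans h0.symm)
    have c0 := eq_of_edgeForm_self_eq_zero hG ((hself (e i₀)).trans h1)
    let x₀ : Fin n := ⟨0, by omega⟩
    have o1 := hort (e i₁) (e i₁)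
    have o0 := hort (e i₀) (e i₀)
    have o2 := hort (e i₁) (e i₀)
    rw [if_pos rfl] at o1 o0
    rw [if_neg (fun h => hi (e.injective h))] at o2
    simp only [c1 _ x₀, c0 _ x₀, Finset.sum_const, Finset.card_univ, hcard, nsmul_eq_mul]
      at o1 o0 o2
    have hn0 : (n : ℝ) ≠ 0 := by positivity
    rcases mul_eq_zero.1 o2 with h | h
    · exact hn0 h
    · rcases mul_eq_zero.1 h with h | h
      · rw [h] at o1; simp at o1
      · rw [h] at o0; simp at o0
  have hge : ∀ k, k ≠ e i₀ → fiedler hn Q ≤ μ k := by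
    intro k hk
    obtain ⟨i, rfl⟩ := e.surjective k
    have hne : i ≠ i₀ := fun h => hk (h ▸ rfl)
    rw [hf, hμe, hμe]; apply hA.eigenvalues₀_antitone
    have : (i : ℕ) ≠ n - 1 := fun h => hne (Fin.ext h)
    have := i.2
    simp only [i₁, Fin.le_def]; omega
  -- The all-ones vector has zero form with everything, so it is orthogonal to every eigenvector
  -- with nonzero eigenvalue; its expansion then has a single term, which makes `u (e i₀)` constant.
  have hone : ∀ k, k ≠ e i₀ → ∑ y, u k y = 0 := by
    intro k hk
    have h := hform (fun _ => 1) k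
    have h0 : edgeForm Q (fun _ => (1 : ℝ)) (u k) = 0 := by simp [edgeForm]
    rw [h0] at h
    have := (mul_eq_zero.1 h.symm).resolve_left (hpos.trans_le (hge k hk)).ne'
    simpa using this
  have hconst : ∀ x y, u (e i₀) x = u (e i₀) y := by
    have h1 : ∀ x, (1 : ℝ) = (∑ y, u (e i₀) y) * u (e i₀) x := by
      intro x
      have := hexp (fun _ => 1) x
      rw [this, Finset.sum_eq_single (e i₀)]
      · simp
      · intro k _ hk; simp [hone k hk]
      · simp
    intro x y
    have hx := h1 x
    have hy := h1 y
    have hne : (∑ y, u (e i₀) y) ≠ 0 := fun h => by rw [h] at hx; simp at hx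
    exact mul_left_cancel₀ hne (hx.symm.trans hy)
  refine ⟨hpos, e i₀, u, μ, hge, ?_, hconst, hort, hexp, hform⟩
  rw [← hself, edgeForm]
  simp [hconst _ (⟨0, by omega⟩ : Fin n)]

theorem fiedler_pos (hn : 2 ≤ n) {Q : PMF (Sym2 (Fin n))} (hG : (pairGraph Q).Connected) :
    0 < fiedler hn Q := (exists_eigenbasis hn hG).1

/-- The Dirichlet form of a vector expanded in a family `u`. -/
theorem edgeForm_self_expand {Q : PMF (Sym2 (Fin n))} {u : Fin n → Fin n → ℝ}
    (hexp : ∀ (v : Fin n → ℝ) x, v x = ∑ k, (∑ y, v y * u k y) * u k x) (v : Fin n → ℝ) :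
    edgeForm Q v v = ∑ k, edgeForm Q v (u k) * ∑ y, v y * u k y := by
  have hv : v = ∑ k, (∑ y, v y * u k y) • u k := by
    ext x; rw [hexp v x]; simp [Finset.sum_apply]
  simp only [edgeForm_eq_dotProduct]
  conv_lhs => rw [hv]
  conv_lhs => enter [2]; rw [Matrix.mulVec_sum]
  rw [← hv, dotProduct_sum]
  refine Finset.sum_congr rfl fun k _ => ?_
  rw [Matrix.mulVec_smul, dotProduct_smul, smul_eq_mul, mul_comm]

/-- Vectors `b k`, normalized for the Dirichlet form, in which all increments can be expanded. -/
theorem exists_edgeForm_frame (hn : 2 ≤ n) {Q : PMF (Sym2 (Fin n))}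
    (hG : (pairGraph Q).Connected) :
    ∃ b : Fin n → Fin n → ℝ,
      (∀ k, edgeForm Q (b k) (b k) ≤ 1) ∧
      (∀ k x y, (b k x - b k y) ^ 2 ≤ 2 / fiedler hn Q) ∧
      (∀ v : Fin n → ℝ, ∃ c : Fin n → ℝ, ∑ k, c k ^ 2 = edgeForm Q v v ∧
        ∀ x y, v x - v y = ∑ k, c k * (b k x - b k y)) := by
  obtain ⟨hpos, k₀, u, μ, hge, hμ0, hconst, hort, hexp, hform⟩ := exists_eigenbasis hn hG
  have hμpos : ∀ k, k ≠ k₀ → 0 < μ k := fun k hk => hpos.trans_le (hge k hk)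
  have hself : ∀ l, edgeForm Q (u l) (u l) = μ l := by
    intro l; rw [hform, hort]; simp
  have hmu : ∀ k, 0 ≤ μ k := fun k => by rw [← hself]; exact edgeForm_self_nonneg _ _
  -- For `k₀` the eigenvalue is 0 and division by zero yields the zero vector. This is harmless
  -- because only increments are expanded, and it is why the normalization is an inequality.
  refine ⟨fun k x => u k x / √(μ k), fun k => ?_, fun k x y => ?_, fun v => ?_⟩
  · have : edgeForm Q (fun x => u k x / √(μ k)) (fun x => u k x / √(μ k)) = μ k / μ k := by
      have h1 : ∀ (w : Fin n → ℝ) (a : ℝ), edgeForm Q (fun x => w x / a) (fun x => w x / a) =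
          edgeForm Q w w / (a * a) := by
        intro w a
        simp only [edgeForm, mul_div_assoc, Finset.sum_div]
        congr 1
        refine Finset.sum_congr rfl fun x _ => Finset.sum_congr rfl fun y _ => ?_
        rw [← sub_div, div_mul_div_comm]
        ring
      rw [h1, hself, Real.mul_self_sqrt (hmu k)]
    rw [this]; exact div_self_le_one _
  · by_cases hk : k = k₀
    · subst hk
      simp only [hconst x y, sub_self, zero_pow two_ne_zero]
      exact div_nonneg (by norm_num) hpos.le
    · simp only []; rw [← sub_div, div_pow, Real.sq_sqrt (hmu k)]
      have h1 : (u k x - u k y) ^ 2 ≤ 2 := by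
        by_cases hxy : x = y
        · rw [hxy]; simp
        have h2 := hort k k
        rw [if_pos rfl] at h2
        have h3 : u k x * u k x + u k y * u k y ≤ ∑ x, u k x * u k x := by
          rw [← Finset.sum_pair (f := fun x => u k x * u k x) hxy]
          exact Finset.sum_le_sum_of_subset_of_nonneg (Finset.subset_univ _)
            fun _ _ _ => mul_self_nonneg _
        nlinarith [sq_nonneg (u k x + u k y)]
      exact div_le_div₀ (by norm_num) h1 hpos (hge k hk)
  · refine ⟨fun k => √(μ k) * ∑ y, v y * u k y, ?_, fun x y => ?_⟩
    · have h1 := edgeForm_self_expand hexp v (Q := Q)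
      rw [h1]
      refine Finset.sum_congr rfl fun k _ => ?_
      rw [hform, mul_pow, Real.sq_sqrt (hmu k)]; ring
    · rw [hexp v x, hexp v y, ← Finset.sum_sub_distrib]
      refine Finset.sum_congr rfl fun k _ => ?_
      by_cases hk : k = k₀
      · subst hk; rw [hconst x y]; simp [hμ0]
      · have := (Real.sqrt_pos.2 (hμpos k hk)).ne'
        field_simp

/-- The Poincaré inequality of the pair distribution. -/
theorem poincare (hn : 2 ≤ n) {Q : PMF (Sym2 (Fin n))} (hG : (pairGraph Q).Connected)
    (v : Fin n → ℝ) :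
    fiedler hn Q * (∑ x, v x ^ 2 - (∑ x, v x) ^ 2 / n) ≤ edgeForm Q v v := by
  obtain ⟨hpos, k₀, u, μ, hge, hμ0, hconst, hort, hexp, hform⟩ := exists_eigenbasis hn hG
  set c : Fin n → ℝ := fun k => ∑ y, v y * u k y with hc
  have hn0 : (n : ℝ) ≠ 0 := by positivity
  have h1 : edgeForm Q v v = ∑ k, μ k * c k ^ 2 := by
    rw [edgeForm_self_expand hexp]
    exact Finset.sum_congr rfl fun k _ => by rw [hform]; ring
  have h2 : ∑ x, v x ^ 2 = ∑ k, c k ^ 2 := by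
    calc ∑ x, v x ^ 2 = ∑ x, ∑ k, c k * (v x * u k x) := by
          refine Finset.sum_congr rfl fun x _ => ?_
          rw [pow_two]
          conv_lhs => enter [2]; rw [hexp v x]
          rw [Finset.mul_sum]
          exact Finset.sum_congr rfl fun k _ => by simp only [hc]; ring
      _ = ∑ k, c k ^ 2 := by
          rw [Finset.sum_comm]
          refine Finset.sum_congr rfl fun k _ => ?_
          rw [← Finset.mul_sum, pow_two]
  -- The component along the constant unit vector is the mean, which is what the variance on the
  -- left subtracts.
  have h3 : c k₀ ^ 2 = (∑ x, v x) ^ 2 / n := by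
    let x₀ : Fin n := ⟨0, by omega⟩
    have o := hort k₀ k₀
    simp only [hc]
    simp only [hconst _ x₀, if_true, Finset.sum_const, Finset.card_univ, Fintype.card_fin,
      nsmul_eq_mul] at o ⊢
    rw [← Finset.sum_mul, mul_pow, eq_div_iff hn0]
    linear_combination (∑ x, v x) ^ 2 * o
  rw [h1, h2, ← h3, ← Finset.add_sum_erase _ _ (Finset.mem_univ k₀),
    ← Finset.add_sum_erase (f := fun k => μ k * c k ^ 2) _ (Finset.mem_univ k₀), hμ0,
    add_sub_cancel_left, zero_mul, zero_add, Finset.mul_sum]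
  exact Finset.sum_le_sum fun k hk =>
    mul_le_mul_of_nonneg_right (hge k (Finset.ne_of_mem_erase hk)) (sq_nonneg _)

end Spectral

/-! ### Law of the loser and the winner in one draw -/

section DrawLaw

open MeasureTheory

variable {n : ℕ}

/-- A zero of D would spread: a neighbour y of x satisfies D(y) ≤ φ D(x), so by connectedness D
would vanish everywhere. -/
theorem pos_of_boundedRatios {D : PMF (Fin n)} {Q : PMF (Sym2 (Fin n))} {φ : ℝ}
    (hG : (pairGraph Q).Connected) (hB : BoundedRatios D Q φ) (x : Fin n) :
    0 < (D x).toReal := by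
  refine lt_of_le_of_ne ENNReal.toReal_nonneg fun h0 => ?_
  have hall : ∀ y, (D y).toReal = 0 := by
    intro y
    obtain ⟨p⟩ := hG.preconnected y x
    induction p with
    | nil => exact h0.symm
    | cons hadj _ ih =>
      have hs := ((SimpleGraph.fromEdgeSet_adj _).1 hadj).1
      refine le_antisymm ?_ ENNReal.toReal_nonneg
      simpa [ih h0] using hB _ _ hs
  obtain ⟨y, hy⟩ := D.support_nonempty
  have := (ENNReal.toReal_eq_zero_iff _).1 (hall y)
  exact this.elim ((PMF.mem_support_iff _ _).1 hy) (PMF.apply_ne_top _ _)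

/-- The loser of a comparison `(i, j, w)`. -/
def loser (t : Fin n × Fin n × Fin n) : Fin n := if t.2.2 = t.1 then t.2.1 else t.1

/-- A triple that the oracle can return: two distinct elements, one of which is the winner. -/
def ValidDraw (t : Fin n × Fin n × Fin n) : Prop := t.1 ≠ t.2.1 ∧ (t.2.2 = t.1 ∨ t.2.2 = t.2.1)

/-- The probability that `w` beats `x` in one draw. -/
noncomputable def drawWeight (Q : PMF (Sym2 (Fin n))) (D : PMF (Fin n)) (x w : Fin n) : ℝ :=
  (Q s(x, w)).toReal * ((D w).toReal / ((D x).toReal + (D w).toReal))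

theorem drawWeight_nonneg (Q : PMF (Sym2 (Fin n))) (D : PMF (Fin n)) (x w : Fin n) :
    0 ≤ drawWeight Q D x w := by unfold drawWeight; positivity

theorem condPair_mk {D : PMF (Fin n)} (hD : ∀ x, 0 < (D x).toReal) {x y : Fin n} (hxy : x ≠ y)
    (w : Fin n) :
    condPair D s(x, y) w = if w = x ∨ w = y then
      ENNReal.ofReal ((D w).toReal / ((D x).toReal + (D y).toReal)) else 0 := by
  have hex : ∃ a ∈ {z : Fin n | z ∈ s(x, y)}, a ∈ D.support :=
    ⟨x, by simp, (PMF.mem_support_iff _ _).2 fun h => by simpa [h] using hD x⟩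
  rw [condPair, dif_pos hex, PMF.filter_apply]
  have hsum : ∑' a, Set.indicator {z : Fin n | z ∈ s(x, y)} D a = D x + D y := by
    rw [tsum_fintype, ← Finset.sum_pair hxy]
    rw [← Finset.sum_subset (Finset.subset_univ ({x, y} : Finset (Fin n)))]
    · refine Finset.sum_congr rfl fun a ha => ?_
      rw [Set.indicator_of_mem]; simpa using ha
    · intro a _ ha
      rw [Set.indicator_of_notMem]; simpa using ha
  rw [hsum]
  by_cases hw : w = x ∨ w = y
  · rw [if_pos hw, Set.indicator_of_mem (by simpa using hw),
      ENNReal.ofReal_div_of_pos (add_pos (hD x) (hD y)),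
      ENNReal.ofReal_add (hD x).le (hD y).le]
    simp only [ENNReal.ofReal_toReal (PMF.apply_ne_top _ _)]
    rfl
  · rw [if_neg hw, Set.indicator_of_notMem (by simpa using hw), zero_mul]

theorem lintegral_samp (Q : PMF (Sym2 (Fin n))) (D : PMF (Fin n))
    (f : Fin n × Fin n × Fin n → ENNReal) :
    ∫⁻ t, f t ∂(samp Q D).toMeasure =
      ∑ e, Q e * ∑ w, condPair D e w * f (e.inf, e.sup, w) := by
  rw [lintegral_fintype]
  simp only [PMF.toMeasure_apply_singleton _ _ (measurableSet_singleton _)]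
  simp only [samp, PMF.bind_apply, PMF.map_apply, tsum_fintype]
  simp only [Finset.mul_sum]
  rw [Finset.sum_comm]
  refine Finset.sum_congr rfl fun e _ => ?_
  rw [Finset.sum_comm]
  refine Finset.sum_congr rfl fun w _ => ?_
  rw [Finset.sum_eq_single (e.inf, e.sup, w)]
  · rw [if_pos rfl]; ring
  · intro b _ hb; rw [if_neg hb]; simp
  · simp

/-- Each off-diagonal unordered pair has exactly two ordered preimages. This passes from edges with
a random winner to ordered (loser, winner) pairs. -/
theorem sum_sym2 {f : Sym2 (Fin n) → ENNReal} {g : Fin n → Fin n → ENNReal}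
    (hg : ∀ x, g x x = 0) (hf : ∀ x, f s(x, x) = 0)
    (h : ∀ x y, x ≠ y → f s(x, y) = g x y + g y x) :
    ∑ e, f e = ∑ x, ∑ y, g x y := by
  rw [← Finset.sum_product', ← Finset.sum_fiberwise (s := Finset.univ ×ˢ Finset.univ)
    (g := fun p : Fin n × Fin n => s(p.1, p.2))]
  refine Finset.sum_congr rfl fun e _ => ?_
  induction e using Sym2.inductionOn with
  | hf x y =>
    by_cases hxy : x = y
    · subst hxy
      rw [hf]
      symm
      refine Finset.sum_eq_zero fun p hp => ?_
      simp only [Finset.mem_filter, Sym2.eq_iff] at hp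
      obtain ⟨_, ⟨h1, h2⟩ | ⟨h1, h2⟩⟩ := hp <;> rw [h1, h2, hg]
    · have : Finset.filter (fun p : Fin n × Fin n => s(p.1, p.2) = s(x, y))
          (Finset.univ ×ˢ Finset.univ) = {(x, y), (y, x)} := by
        ext ⟨a, b⟩
        simp
      rw [h x y hxy, this, Finset.sum_pair]
      intro h'
      exact hxy (Prod.ext_iff.1 h').1

/-- The law of (loser, winner) under one draw, for sums of functions of the draw. -/
theorem lintegral_samp_eq {Q : PMF (Sym2 (Fin n))} {D : PMF (Fin n)}
    (hQ : IsPairDistribution Q) (hD : ∀ x, 0 < (D x).toReal)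
    (f : Fin n → Fin n → ENNReal) :
    ∫⁻ t, f (loser t) t.2.2 ∂(samp Q D).toMeasure =
      ∑ x, ∑ w, ENNReal.ofReal (drawWeight Q D x w) * f x w := by
  have hdiag : ∀ x, Q s(x, x) = 0 := by
    intro x
    by_contra h
    exact hQ _ ((PMF.mem_support_iff _ _).2 h) (by simp)
  rw [lintegral_samp]
  refine sum_sym2 (fun x => by simp [drawWeight, hdiag]) (fun x => by simp [hdiag])
    fun x y hxy => ?_
  have hval : ∀ x y : Fin n, x < y → Q s(x, y) * ∑ w, condPair D s(x, y) w *
      f (loser (s(x, y).inf, s(x, y).sup, w)) w =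
      ENNReal.ofReal (drawWeight Q D x y) * f x y + ENNReal.ofReal (drawWeight Q D y x) * f y x := by
    intro x y hlt
    have hne := hlt.ne
    simp only [condPair_mk hD hne]
    rw [Finset.sum_eq_add x y hne]
    · simp only [true_or, or_true, if_true]
      have h1 : s(x, y).inf = x := by simp [hlt.le]
      have h2 : s(x, y).sup = y := by simp [hlt.le]
      simp only [h1, h2, loser, if_true, if_neg hne.symm]
      simp only [drawWeight]
      rw [ENNReal.ofReal_mul ENNReal.toReal_nonneg, ENNReal.ofReal_mul ENNReal.toReal_nonneg,
        ENNReal.ofReal_toReal (PMF.apply_ne_top _ _), ENNReal.ofReal_toReal (PMF.apply_ne_top _ _),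
        Sym2.eq_swap (a := y), add_comm (D y).toReal]
      ring
    · intro c _ hc; rw [if_neg (by tauto), zero_mul]
    · simp
    · simp
  rcases lt_or_gt_of_ne hxy with h | h
  · exact hval x y h
  · rw [Sym2.eq_swap, hval y x h, add_comm]

theorem ae_validDraw {Q : PMF (Sym2 (Fin n))} {D : PMF (Fin n)}
    (hQ : IsPairDistribution Q) (hD : ∀ x, 0 < (D x).toReal) :
    ∀ᵐ t ∂(samp Q D).toMeasure, ValidDraw t := by
  classical
  have hdiag : ∀ x, Q s(x, x) = 0 := by
    intro x
    by_contra h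
    exact hQ _ ((PMF.mem_support_iff _ _).2 h) (by simp)
  rw [ae_iff, ← lintegral_indicator_one (Set.toFinite _).measurableSet, lintegral_samp]
  refine Finset.sum_eq_zero fun e _ => ?_
  induction e using Sym2.inductionOn with
  | hf x y =>
    by_cases hxy : x = y
    · rw [hxy, hdiag, zero_mul]
    · rw [Finset.sum_eq_zero, mul_zero]
      intro w _
      rw [condPair_mk hD hxy]
      by_cases hw : w = x ∨ w = y
      · rw [Set.indicator_of_notMem, mul_zero]
        simp only [ValidDraw, Set.mem_ofPred_eq, not_not, Sym2.inf_mk, Sym2.sup_mk]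
        rcases lt_or_gt_of_ne hxy with h | h
        · rw [inf_eq_left.2 h.le, sup_eq_right.2 h.le]; exact ⟨hxy, hw⟩
        · rw [inf_eq_right.2 h.le, sup_eq_left.2 h.le]; exact ⟨fun h => hxy h.symm, hw.symm⟩
      · rw [if_neg hw, zero_mul]

theorem sum_drawWeight {Q : PMF (Sym2 (Fin n))} {D : PMF (Fin n)}
    (hQ : IsPairDistribution Q) (hD : ∀ x, 0 < (D x).toReal) :
    ∑ x, ∑ w, drawWeight Q D x w = 1 := by
  have h := lintegral_samp_eq hQ hD (fun _ _ => 1)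
  simp only [mul_one, lintegral_const, measure_univ] at h
  rw [← ENNReal.toReal_one, h, ENNReal.toReal_sum (by simp)]
  refine Finset.sum_congr rfl fun x _ => ?_
  rw [ENNReal.toReal_sum (by simp)]
  refine Finset.sum_congr rfl fun y _ => ?_
  rw [ENNReal.toReal_ofReal (drawWeight_nonneg _ _ _ _)]

/-- Once the pair is drawn, exactly one of its elements wins. The winner's bias therefore disappears
from every expectation that is symmetric in the two elements. -/
theorem drawWeight_add_swap {Q : PMF (Sym2 (Fin n))} {D : PMF (Fin n)}
    (hD : ∀ x, 0 < (D x).toReal) (x y : Fin n) :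
    drawWeight Q D x y + drawWeight Q D y x = (Q s(x, y)).toReal := by
  have := (add_pos (hD x) (hD y)).ne'
  unfold drawWeight
  rw [Sym2.eq_swap (a := y), add_comm (D y).toReal]
  field_simp
  ring

/-- The Dirichlet form is the expectation of the product of the increments along a draw. -/
theorem sum_drawWeight_mul {Q : PMF (Sym2 (Fin n))} {D : PMF (Fin n)}
    (hD : ∀ x, 0 < (D x).toReal) (v w : Fin n → ℝ) :
    ∑ x, ∑ y, drawWeight Q D x y * ((v x - v y) * (w x - w y)) = edgeForm Q v w := by
  have h : ∑ x, ∑ y, drawWeight Q D x y * ((v x - v y) * (w x - w y)) =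
      ∑ x, ∑ y, drawWeight Q D y x * ((v x - v y) * (w x - w y)) := by
    rw [Finset.sum_comm]
    exact Finset.sum_congr rfl fun x _ => Finset.sum_congr rfl fun y _ => by ring
  rw [edgeForm]
  simp only [← drawWeight_add_swap hD, add_mul, Finset.sum_add_distrib]
  rw [← h]; ring

end DrawLaw

/-! ### Independence structure of the random tape -/

section TapeLaw

open MeasureTheory

/-- The sequence that starts with the first `m` terms of `p.1` and goes on with `p.2`. -/
def glue {α : Type*} (m : ℕ) (p : (ℕ → α) × (ℕ → α)) : ℕ → α :=
  fun i => if i < m then p.1 i else p.2 (i - m)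

theorem glue_add {α : Type*} (m : ℕ) (p : (ℕ → α) × (ℕ → α)) (i : ℕ) :
    glue m p (m + i) = p.2 i := by simp [glue]

theorem glue_of_lt {α : Type*} {m : ℕ} (p : (ℕ → α) × (ℕ → α)) {i : ℕ} (h : i < m) :
    glue m p i = p.1 i := by simp [glue, h]

/-- An i.i.d. sequence restarted at time `m` is again i.i.d. with the same law. -/
theorem measurePreserving_glue {α : Type*} [MeasurableSpace α] (ν : Measure α)
    [IsProbabilityMeasure ν] (m : ℕ) :
    MeasurePreserving (glue (α := α) m)
      ((Measure.infinitePi fun _ : ℕ => ν).prod (Measure.infinitePi fun _ : ℕ => ν))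
      (Measure.infinitePi fun _ : ℕ => ν) := by
  have hmeas : Measurable (glue (α := α) m) := by
    refine measurable_pi_lambda _ fun i => ?_
    unfold glue
    by_cases h : i < m
    · simp only [h, if_true]; fun_prop
    · simp only [h, if_false]; fun_prop
  refine ⟨hmeas, ?_⟩
  refine Measure.eq_infinitePi _ fun s t ht => ?_
  rw [Measure.map_apply hmeas (MeasurableSet.pi s.countable_toSet fun i _ => ht i)]
  have hpre : glue m ⁻¹' (Set.pi (↑s) t) =
      (Set.pi ↑(s.filter (· < m)) t) ×ˢ
        (Set.pi ↑((s.filter (m ≤ ·)).image (· - m)) fun i => t (m + i)) := by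
    ext ⟨a, b⟩
    simp only [Set.mem_preimage, Set.mem_pi, Set.mem_prod, Finset.mem_coe, Finset.mem_filter,
      Finset.mem_image]
    constructor
    · intro h
      refine ⟨fun i hi => ?_, ?_⟩
      · simpa [glue, hi.2] using h i hi.1
      · rintro _ ⟨i, ⟨hi, hm⟩, rfl⟩
        have := h i hi
        rw [Nat.add_sub_cancel' hm]
        simpa [glue, not_lt.2 hm] using this
    · rintro ⟨h1, h2⟩ i hi
      by_cases him : i < m
      · simpa [glue, him] using h1 i ⟨hi, him⟩
      · have := h2 _ ⟨i, ⟨hi, not_lt.1 him⟩, rfl⟩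
        rw [Nat.add_sub_cancel' (not_lt.1 him)] at this
        simpa [glue, him] using this
  rw [hpre, Measure.prod_prod, Measure.infinitePi_pi _ fun i _ => ht i,
    Measure.infinitePi_pi _ fun i _ => ht _, Finset.prod_image]
  · rw [← Finset.prod_filter_mul_prod_filter_not s (· < m)]
    congr 1
    refine Finset.prod_congr (by ext; simp) fun i hi => ?_
    rw [Nat.add_sub_cancel' (by simpa using (Finset.mem_filter.1 hi).2)]
  · intro i hi j hj h
    simp only [Finset.coe_filter, Set.mem_ofPred_eq] at hi hj h
    omega

/-- The case m = 1 of `measurePreserving_glue`, in the form of an iterated integral. -/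
theorem lintegral_head {α : Type*} [MeasurableSpace α] (ν : Measure α)
    [IsProbabilityMeasure ν] {f : α → (ℕ → α) → ENNReal} (hf : Measurable (Function.uncurry f)) :
    ∫⁻ a, f (a 0) (fun i => a (1 + i)) ∂(Measure.infinitePi fun _ : ℕ => ν) =
      ∫⁻ t, ∫⁻ b, f t b ∂(Measure.infinitePi fun _ : ℕ => ν) ∂ν := by
  have hm : Measurable fun a : ℕ → α => f (a 0) (fun i => a (1 + i)) :=
    hf.comp (f := fun a : ℕ → α => (a 0, fun i => a (1 + i))) (by fun_prop)
  rw [← (measurePreserving_glue ν 1).lintegral_comp hm, lintegral_prod]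
  · simp only [glue_add, glue_of_lt _ Nat.zero_lt_one]
    exact (measurePreserving_eval_infinitePi (fun _ : ℕ => ν) 0).lintegral_comp
      (f := fun t => ∫⁻ b, f t b ∂(Measure.infinitePi fun _ : ℕ => ν)) hf.lintegral_prod_right'
  · exact (hm.comp (measurePreserving_glue ν 1).measurable).aemeasurable

variable {n : ℕ}

instance (Q : PMF (Sym2 (Fin n))) (D : PMF (Fin n)) : IsProbabilityMeasure (tapeLaw Q D) := by
  unfold tapeLaw; infer_instance

/-- The tape that remains after `d` draws and `c` coins. -/
def Tape.adv (d c : ℕ) (ω : Tape n) : Tape n := (fun i => ω.1 (d + i), fun i => ω.2 (c + i))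

theorem Tape.adv_adv (d c d' c' : ℕ) (ω : Tape n) :
    (ω.adv d c).adv d' c' = ω.adv (d + d') (c + c') := by
  simp [Tape.adv, add_assoc]

theorem Tape.adv_zero (ω : Tape n) : ω.adv 0 0 = ω := by simp [Tape.adv]

theorem Tape.measurable_adv (d c : ℕ) : Measurable (Tape.adv (n := n) d c) := by
  unfold Tape.adv; fun_prop

/-- After `m` draws, the remaining tape is a fresh one, independent of these draws. -/
theorem lintegral_adv_draws (Q : PMF (Sym2 (Fin n))) (D : PMF (Fin n)) (m : ℕ)
    {f : (ℕ → Fin n × Fin n × Fin n) → Tape n → ENNReal}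
    (hf : Measurable (Function.uncurry f))
    (hdep : ∀ a b, (∀ i < m, a i = b i) → f a = f b) :
    ∫⁻ ω, f ω.1 (ω.adv m 0) ∂(tapeLaw Q D) =
      ∫⁻ a, ∫⁻ ω, f a ω ∂(tapeLaw Q D)
        ∂(Measure.infinitePi fun _ : ℕ => (samp Q D).toMeasure) := by
  have hm1 : Measurable fun ω : Tape n => f ω.1 (ω.adv m 0) :=
    hf.comp (measurable_fst.prodMk (Tape.measurable_adv m 0))
  -- The draws are replaced by two independent copies glued at time m: by `hdep` the choice of f
  -- sees only the first copy, and the advanced tape sees only the second.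
  rw [tapeLaw, lintegral_prod _ hm1.aemeasurable, ← (measurePreserving_glue _ m).lintegral_comp
    hm1.lintegral_prod_right', lintegral_prod]
  · refine lintegral_congr fun a => ?_
    rw [lintegral_prod]
    · refine lintegral_congr fun b => lintegral_congr fun u => ?_
      have h1 : f (glue m (a, b)) = f a := hdep _ _ fun i hi => glue_of_lt _ hi
      have h2 : Tape.adv m 0 (glue m (a, b), u) = (b, u) := by
        simp [Tape.adv, glue_add]
      rw [h1, h2]
    · exact (hf.comp (measurable_const.prodMk measurable_id)).aemeasurable
  · exact (hm1.lintegral_prod_right'.comp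
      (measurePreserving_glue (samp Q D).toMeasure m).measurable).aemeasurable

/-- The first draw and the first coin are independent of the rest of the tape. -/
theorem lintegral_draw_coin (Q : PMF (Sym2 (Fin n))) (D : PMF (Fin n))
    {f : (Fin n × Fin n × Fin n) → unitInterval → Tape n → ENNReal}
    (hf : Measurable fun p : (Fin n × Fin n × Fin n) × unitInterval × Tape n =>
      f p.1 p.2.1 p.2.2) :
    ∫⁻ ω, f (ω.1 0) (ω.2 0) (ω.adv 1 1) ∂(tapeLaw Q D) =
      ∫⁻ t, ∫⁻ u, ∫⁻ ω, f t u ω ∂(tapeLaw Q D) ∂volume ∂(samp Q D).toMeasure := by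
  have hm1 : Measurable fun ω : Tape n => f (ω.1 0) (ω.2 0) (ω.adv 1 1) :=
    hf.comp (f := fun ω : Tape n => (ω.1 0, ω.2 0, ω.adv 1 1))
      (by unfold Tape.adv; fun_prop)
  rw [tapeLaw, lintegral_prod _ hm1.aemeasurable]
  have hm2 : Measurable (Function.uncurry fun (t : Fin n × Fin n × Fin n)
      (a : ℕ → Fin n × Fin n × Fin n) => ∫⁻ b : ℕ → unitInterval,
        f t (b 0) (a, fun i => b (1 + i))
          ∂(Measure.infinitePi fun _ : ℕ => (volume : Measure unitInterval))) := by
    refine Measurable.lintegral_prod_right' (f := fun p : ((Fin n × Fin n × Fin n) ×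
      (ℕ → Fin n × Fin n × Fin n)) × (ℕ → unitInterval) =>
        f p.1.1 (p.2 0) (p.1.2, fun i => p.2 (1 + i))) ?_
    exact hf.comp (f := fun p : ((Fin n × Fin n × Fin n) ×
      (ℕ → Fin n × Fin n × Fin n)) × (ℕ → unitInterval) =>
        (p.1.1, p.2 0, (p.1.2, fun i => p.2 (1 + i)))) (by fun_prop)
  refine (lintegral_head (samp Q D).toMeasure hm2).trans (lintegral_congr fun t => ?_)
  have hm3 : ∀ a : ℕ → Fin n × Fin n × Fin n, Measurable (Function.uncurry
      fun (u : unitInterval) (b : ℕ → unitInterval) => f t u (a, b)) := fun a =>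
    hf.comp (f := fun p : unitInterval × (ℕ → unitInterval) => (t, p.1, (a, p.2))) (by fun_prop)
  simp only [lintegral_head volume (hm3 _)]
  have hm4 : Measurable fun p : (ℕ → Fin n × Fin n × Fin n) × unitInterval × (ℕ → unitInterval) =>
      f t p.2.1 (p.1, p.2.2) :=
    hf.comp (f := fun p : (ℕ → Fin n × Fin n × Fin n) × unitInterval × (ℕ → unitInterval) =>
      (t, p.2.1, (p.1, p.2.2))) (by fun_prop)
  rw [lintegral_lintegral_swap]
  · refine lintegral_congr fun u => ?_
    rw [lintegral_prod]
    exact (hf.comp (f := fun ω : Tape n => (t, u, ω)) (by fun_prop)).aemeasurable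
  · refine Measurable.aemeasurable (Measurable.lintegral_prod_right'
      (f := fun p : ((ℕ → Fin n × Fin n × Fin n) × unitInterval) × (ℕ → unitInterval) =>
        f t p.1.2 (p.1.1, p.2)) ?_)
    exact hf.comp (f := fun p : ((ℕ → Fin n × Fin n × Fin n) × unitInterval) ×
      (ℕ → unitInterval) => (t, p.1.2, (p.1.1, p.2))) (by fun_prop)

/-- The first coin is independent of the rest of the tape. -/
theorem lintegral_coin (Q : PMF (Sym2 (Fin n))) (D : PMF (Fin n))
    {f : unitInterval → Tape n → ENNReal} (hf : Measurable (Function.uncurry f)) :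
    ∫⁻ ω, f (ω.2 0) (ω.adv 0 1) ∂(tapeLaw Q D) =
      ∫⁻ u, ∫⁻ ω, f u ω ∂(tapeLaw Q D) := by
  have hm1 : Measurable fun ω : Tape n => f (ω.2 0) (ω.adv 0 1) :=
    hf.comp (f := fun ω : Tape n => (ω.2 0, ω.adv 0 1)) (by unfold Tape.adv; fun_prop)
  rw [tapeLaw, lintegral_prod _ hm1.aemeasurable]
  have hm3 : ∀ a : ℕ → Fin n × Fin n × Fin n, Measurable (Function.uncurry
      fun (u : unitInterval) (b : ℕ → unitInterval) => f u (a, b)) := fun a =>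
    hf.comp (f := fun p : unitInterval × (ℕ → unitInterval) => (p.1, (a, p.2))) (by fun_prop)
  have h1 : ∀ (a : ℕ → Fin n × Fin n × Fin n) (b : ℕ → unitInterval),
      Tape.adv 0 1 (a, b) = (a, fun i => b (1 + i)) := fun a b => by simp [Tape.adv]
  simp only [h1, lintegral_head volume (hm3 _)]
  rw [lintegral_lintegral_swap]
  · refine lintegral_congr fun u => ?_
    rw [lintegral_prod]
    exact (hf.comp (f := fun ω : Tape n => (u, ω)) (by fun_prop)).aemeasurable
  · refine Measurable.aemeasurable (Measurable.lintegral_prod_right'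
      (f := fun p : ((ℕ → Fin n × Fin n × Fin n) × unitInterval) × (ℕ → unitInterval) =>
        f p.1.2 (p.1.1, p.2)) ?_)
    exact hf.comp (f := fun p : ((ℕ → Fin n × Fin n × Fin n) × unitInterval) ×
      (ℕ → unitInterval) => (p.1.2, (p.1.1, p.2))) (by fun_prop)

end TapeLaw

/-! ### The abstract sampler as a Markov chain -/

section Machine

open MeasureTheory

variable {n : ℕ}

/-- Configurations of the sampler between two draws: a map that has not coalesced, or an output. -/
inductive Cfg (n : ℕ) : Type
  | run (F : Fin n → Fin n)
  | done (o : Option (Fin n))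

instance : MeasurableSpace (Cfg n) := ⊤

instance : DiscreteMeasurableSpace (Cfg n) := ⟨fun _ => trivial⟩

instance : Finite (Cfg n) := by
  have : Function.Surjective (fun s : (Fin n → Fin n) ⊕ Option (Fin n) =>
      Sum.elim Cfg.run Cfg.done s) := by
    rintro (F | o)
    · exact ⟨Sum.inl F, rfl⟩
    · exact ⟨Sum.inr o, rfl⟩
  exact Finite.of_surjective _ this

/-- The map has coalesced. -/
def Coal (F : Fin n → Fin n) : Prop := ∀ x y, F x = F y

theorem not_coal_id (hn : 2 ≤ n) : ¬ Coal (id : Fin n → Fin n) := fun h => by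
  have := h ⟨0, by omega⟩ ⟨1, by omega⟩
  simp at this

/-- A configuration from which the machine draws again has a map that has not coalesced. -/
def Cfg.Proper (s : Cfg n) : Prop := ∀ F, s = .run F → ¬ Coal F

theorem Cfg.proper_done (o : Option (Fin n)) : (Cfg.done o).Proper := fun _ h => nomatch h

theorem Cfg.proper_run {F : Fin n → Fin n} (h : ¬ Coal F) : (Cfg.run F).Proper := by
  rintro _ ⟨⟩; exact h

open Classical in
/-- The update of the map by one draw and one coin. -/
noncomputable def drawStep (p : Fin n → ℝ) (F : Fin n → Fin n) (t : Fin n × Fin n × Fin n)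
    (u : unitInterval) : Fin n → Fin n :=
  if (u : ℝ) < p (loser t) / p t.2.2 then Function.update F (loser t) (F t.2.2) else F

open Classical in
theorem measurable_drawStep (p : Fin n → ℝ) (F : Fin n → Fin n) :
    Measurable fun q : (Fin n × Fin n × Fin n) × unitInterval => drawStep p F q.1 q.2 := by
  refine measurable_from_prod_countable_right fun t => ?_
  change Measurable fun u : unitInterval => if (u : ℝ) < p (loser t) / p t.2.2 then
    Function.update F (loser t) (F t.2.2) else F
  exact Measurable.ite (measurableSet_lt measurable_subtype_coe measurable_const)
    measurable_const measurable_const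

variable [NeZero n]

open Classical in
/-- One draw of the sampler, together with the final coin when the map coalesces. After a
rejection the machine goes to the configuration `rej`. -/
noncomputable def next (p : Fin n → ℝ) (rej : Cfg n) : Cfg n × Tape n → Cfg n × Tape n
  | (.done o, ω) => (.done o, ω)
  | (.run F, ω) =>
    let F' := drawStep p F (ω.1 0) (ω.2 0)
    if Coal F' then
      -- A coalescing draw consumes a second coin, the one of the acceptance test.
      (if (ω.2 1 : ℝ) < p (F' 0) then .done (some (F' 0)) else rej, ω.adv 1 2)
    else (.run F', ω.adv 1 1)

open Classical in
theorem measurable_next (p : Fin n → ℝ) (rej : Cfg n) : Measurable (next p rej) := by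
  refine measurable_from_prod_countable_right fun s => ?_
  cases s with
  | done o => exact measurable_const.prodMk measurable_id
  | run F =>
    have hF : Measurable fun ω : Tape n => drawStep p F (ω.1 0) (ω.2 0) := by
      exact (measurable_drawStep p F).comp (f := fun ω : Tape n => (ω.1 0, ω.2 0)) (by fun_prop)
    have h2 : Measurable fun q : (Fin n → Fin n) × Tape n =>
        if Coal q.1 then
          ((if (q.2.2 1 : ℝ) < p (q.1 0) then Cfg.done (some (q.1 0)) else rej : Cfg n),
            q.2.adv 1 2)
        else (.run q.1, q.2.adv 1 1) := by
      refine measurable_from_prod_countable_right fun F' => ?_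
      by_cases hc : Coal F'
      · simp only [hc, if_true]
        refine Measurable.prodMk (Measurable.ite ?_ measurable_const measurable_const)
          (Tape.measurable_adv 1 2)
        exact measurableSet_lt (by fun_prop) measurable_const
      · simp only [hc, if_false]
        exact measurable_const.prodMk (Tape.measurable_adv 1 1)
    exact h2.comp (hF.prodMk measurable_id)

open Classical in
/-- The mean of `v` after the final coin, if the map has coalesced. -/
noncomputable def settled (p : Fin n → ℝ) (rej : Cfg n) (v : Cfg n → ℝ) (F : Fin n → Fin n) : ℝ :=
  if Coal F then p (F 0) * v (.done (some (F 0))) + (1 - p (F 0)) * v rej else v (.run F)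

/-- The mean of `v` after one draw. -/
noncomputable def drawMean (Q : PMF (Sym2 (Fin n))) (D : PMF (Fin n)) (p : Fin n → ℝ)
    (rej : Cfg n) (v : Cfg n → ℝ) (F : Fin n → Fin n) : ℝ :=
  ∑ x, ∑ w, drawWeight Q D x w *
    (min (p x / p w) 1 * settled p rej v (Function.update F x (F w)) +
      (1 - min (p x / p w) 1) * settled p rej v F)

theorem settled_nonneg {p : Fin n → ℝ} (hp : ∀ x, 0 < p x ∧ p x ≤ 1) {rej : Cfg n}
    {v : Cfg n → ℝ} (hv : ∀ s, 0 ≤ v s) (F : Fin n → Fin n) : 0 ≤ settled p rej v F := by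
  unfold settled
  split_ifs
  · exact add_nonneg (mul_nonneg (hp _).1.le (hv _))
      (mul_nonneg (sub_nonneg.2 (hp _).2) (hv _))
  · exact hv _

/-- The bias p(x)/p(w) may exceed 1; the test then always succeeds, so the program needs no explicit
minimum. -/
theorem lintegral_coin_ite {q : ℝ} (hq : 0 ≤ q) (a b : ENNReal) :
    ∫⁻ u : unitInterval, (if (u : ℝ) < q then a else b) =
      ENNReal.ofReal (min q 1) * a + ENNReal.ofReal (1 - min q 1) * b := by
  have hmeas : MeasurableSet {u : unitInterval | (u : ℝ) < q} :=
    measurableSet_lt measurable_subtype_coe measurable_const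
  have hvol : volume {u : unitInterval | (u : ℝ) < q} = ENNReal.ofReal (min q 1) := by
    rcases le_total q 1 with h | h
    · have : {u : unitInterval | (u : ℝ) < q} = Set.Iio ⟨q, hq, h⟩ := rfl
      rw [this, unitInterval.volume_Iio, min_eq_left h]
    · rw [min_eq_right h]
      by_cases h1 : q = 1
      · have : {u : unitInterval | (u : ℝ) < q} = Set.Iio 1 := by rw [h1]; rfl
        rw [this, unitInterval.volume_Iio]; rfl
      · have : {u : unitInterval | (u : ℝ) < q} = Set.univ := by
          ext u; simp only [Set.mem_ofPred_eq, Set.mem_univ, iff_true]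
          exact u.2.2.trans_lt (lt_of_le_of_ne h (Ne.symm h1))
        rw [this]; simp
  have hc : volume {u : unitInterval | (u : ℝ) < q}ᶜ = ENNReal.ofReal (1 - min q 1) := by
    rw [prob_compl_eq_one_sub hmeas, hvol, ENNReal.ofReal_sub _ (le_min hq zero_le_one),
      ENNReal.ofReal_one]
  have : (fun u : unitInterval => if (u : ℝ) < q then a else b) =
      fun u => Set.indicator {u : unitInterval | (u : ℝ) < q} (fun _ => a) u +
        Set.indicator {u : unitInterval | (u : ℝ) < q}ᶜ (fun _ => b) u := by
    ext u
    by_cases h : (u : ℝ) < q <;> simp [Set.indicator, h]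
  rw [this, lintegral_add_left (measurable_const.indicator hmeas), lintegral_indicator hmeas,
    lintegral_indicator hmeas.compl, setLIntegral_const, setLIntegral_const, hvol, hc]
  ring

open Classical in
/-- The Markov property of the sampler. -/
theorem lintegral_next {Q : PMF (Sym2 (Fin n))} {D : PMF (Fin n)}
    (hQ : IsPairDistribution Q) (hD : ∀ x, 0 < (D x).toReal) {p : Fin n → ℝ}
    (hp : ∀ x, 0 < p x ∧ p x ≤ 1) (rej : Cfg n) {f : Cfg n × Tape n → ENNReal}
    (hf : Measurable f) (F : Fin n → Fin n) {hat : (Fin n → Fin n) → ENNReal}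
    (hhat : ∀ F, hat F = if Coal F then
      ENNReal.ofReal (p (F 0)) * (∫⁻ ω, f (.done (some (F 0)), ω) ∂(tapeLaw Q D)) +
        ENNReal.ofReal (1 - p (F 0)) * (∫⁻ ω, f (rej, ω) ∂(tapeLaw Q D))
      else ∫⁻ ω, f (.run F, ω) ∂(tapeLaw Q D)) :
    ∫⁻ ω, f (next p rej (.run F, ω)) ∂(tapeLaw Q D) =
      ∑ x, ∑ w, ENNReal.ofReal (drawWeight Q D x w) *
        (ENNReal.ofReal (min (p x / p w) 1) * hat (Function.update F x (F w)) +
          ENNReal.ofReal (1 - min (p x / p w) 1) * hat F) := by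
  -- The value after the draw and its own coin, as a function of the new map and the remaining tape.
  -- The acceptance coin is integrated out inside g, separately from the draw.
  set g : (Fin n → Fin n) → Tape n → ENNReal := fun F' ω =>
    if Coal F' then
      f (if (ω.2 0 : ℝ) < p (F' 0) then .done (some (F' 0)) else rej, ω.adv 0 1)
    else f (.run F', ω) with hg
  have hfs : ∀ s, Measurable fun ω => f (s, ω) := fun s =>
    hf.comp (measurable_const.prodMk measurable_id)
  have hgm : ∀ F', Measurable (g F') := by
    intro F'
    by_cases hc : Coal F'
    · simp only [hg, hc, if_true]
      refine hf.comp (Measurable.prodMk (Measurable.ite ?_ measurable_const measurable_const)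
        (Tape.measurable_adv 0 1))
      exact measurableSet_lt (by fun_prop) measurable_const
    · simp only [hg, hc, if_false]
      exact hfs _
  have hgi : ∀ F', ∫⁻ ω, g F' ω ∂(tapeLaw Q D) = hat F' := by
    intro F'
    rw [hhat]
    by_cases hc : Coal F'
    · simp only [hg, hc, if_true]
      rw [lintegral_coin Q D (f := fun u ω =>
        f (if (u : ℝ) < p (F' 0) then .done (some (F' 0)) else rej, ω))]
      · have : ∀ u : unitInterval, ∫⁻ ω, f ((if (u : ℝ) < p (F' 0) then
            Cfg.done (some (F' 0)) else rej : Cfg n), ω) ∂(tapeLaw Q D) =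
            if (u : ℝ) < p (F' 0) then ∫⁻ ω, f (.done (some (F' 0)), ω) ∂(tapeLaw Q D)
            else ∫⁻ ω, f (rej, ω) ∂(tapeLaw Q D) := by
          intro u; split_ifs <;> rfl
        simp only [this]
        rw [lintegral_coin_ite (hp _).1.le, min_eq_left (hp _).2]
      · refine hf.comp (Measurable.prodMk (Measurable.ite ?_ measurable_const measurable_const)
          measurable_snd)
        exact measurableSet_lt (by fun_prop) measurable_const
    · simp only [hg, hc, if_false]
  have hnext : ∀ ω, f (next p rej (.run F, ω)) =
      g (drawStep p F (ω.1 0) (ω.2 0)) (ω.adv 1 1) := by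
    intro ω
    simp only [next, hg]
    by_cases hc : Coal (drawStep p F (ω.1 0) (ω.2 0))
    · simp only [hc, if_true, Tape.adv_adv]
      rfl
    · simp only [hc, if_false]
  simp only [hnext]
  rw [lintegral_draw_coin Q D (f := fun t u ω => g (drawStep p F t u) ω)]
  · simp only [hgi]
    have hcoin : ∀ t : Fin n × Fin n × Fin n, ∫⁻ u : unitInterval, hat (drawStep p F t u) =
        (fun x w => ENNReal.ofReal (min (p x / p w) 1) * hat (Function.update F x (F w)) +
          ENNReal.ofReal (1 - min (p x / p w) 1) * hat F) (loser t) t.2.2 := by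
      intro t
      have : ∀ u : unitInterval, hat (drawStep p F t u) = if (u : ℝ) < p (loser t) / p t.2.2 then
          hat (Function.update F (loser t) (F t.2.2)) else hat F := by
        intro u; unfold drawStep; split_ifs <;> rfl
      simp only [this]
      rw [lintegral_coin_ite (div_pos (hp _).1 (hp _).1).le]
    simp only [hcoin]
    exact lintegral_samp_eq hQ hD (fun x w => ENNReal.ofReal (min (p x / p w) 1) *
      hat (Function.update F x (F w)) + ENNReal.ofReal (1 - min (p x / p w) 1) * hat F)
  · have hF : Measurable fun q : (Fin n × Fin n × Fin n) × unitInterval × Tape n =>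
        drawStep p F q.1 q.2.1 :=
      (measurable_drawStep p F).comp (f := fun q : (Fin n × Fin n × Fin n) × unitInterval × Tape n
        => (q.1, q.2.1)) (by fun_prop)
    have hG : Measurable fun q : (Fin n → Fin n) × Tape n => g q.1 q.2 :=
      measurable_from_prod_countable_right hgm
    exact hG.comp (hF.prodMk (measurable_snd.comp measurable_snd))

theorem ofReal_drawMean {Q : PMF (Sym2 (Fin n))} {D : PMF (Fin n)} {p : Fin n → ℝ}
    (hp : ∀ x, 0 < p x ∧ p x ≤ 1) {rej : Cfg n} {v : Cfg n → ℝ} (hv : ∀ s, 0 ≤ v s)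
    (F : Fin n → Fin n) :
    ENNReal.ofReal (drawMean Q D p rej v F) =
      ∑ x, ∑ w, ENNReal.ofReal (drawWeight Q D x w) *
        (ENNReal.ofReal (min (p x / p w) 1) *
          ENNReal.ofReal (settled p rej v (Function.update F x (F w))) +
          ENNReal.ofReal (1 - min (p x / p w) 1) * ENNReal.ofReal (settled p rej v F)) := by
  have hq0 : ∀ x w, 0 ≤ min (p x / p w) 1 := fun x w =>
    le_min (div_pos (hp _).1 (hp _).1).le zero_le_one
  have hq1 : ∀ x w, 0 ≤ 1 - min (p x / p w) 1 := fun x w => sub_nonneg.2 (min_le_right _ _)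
  have hs := settled_nonneg hp (rej := rej) hv
  have hin : ∀ x w, 0 ≤ min (p x / p w) 1 * settled p rej v (Function.update F x (F w)) +
      (1 - min (p x / p w) 1) * settled p rej v F := fun x w =>
    add_nonneg (mul_nonneg (hq0 _ _) (hs _)) (mul_nonneg (hq1 _ _) (hs _))
  have hall : ∀ x w, 0 ≤ drawWeight Q D x w *
      (min (p x / p w) 1 * settled p rej v (Function.update F x (F w)) +
      (1 - min (p x / p w) 1) * settled p rej v F) := fun x w =>
    mul_nonneg (drawWeight_nonneg _ _ _ _) (hin x w)
  rw [drawMean, ENNReal.ofReal_sum_of_nonneg fun x _ => Finset.sum_nonneg fun w _ => hall x w]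
  refine Finset.sum_congr rfl fun x _ => ?_
  rw [ENNReal.ofReal_sum_of_nonneg fun w _ => hall x w]
  refine Finset.sum_congr rfl fun w _ => ?_
  rw [ENNReal.ofReal_mul (drawWeight_nonneg _ _ _ _),
    ENNReal.ofReal_add (mul_nonneg (hq0 _ _) (hs _)) (mul_nonneg (hq1 _ _) (hs _)),
    ENNReal.ofReal_mul (hq0 _ _), ENNReal.ofReal_mul (hq1 _ _)]

theorem ofReal_settled {p : Fin n → ℝ}
    (hp : ∀ x, 0 < p x ∧ p x ≤ 1) {rej : Cfg n} {v : Cfg n → ℝ} (hv : ∀ s, 0 ≤ v s)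
    (F : Fin n → Fin n) [Decidable (Coal F)] :
    ENNReal.ofReal (settled p rej v F) = if Coal F then
      ENNReal.ofReal (p (F 0)) * ENNReal.ofReal (v (.done (some (F 0)))) +
        ENNReal.ofReal (1 - p (F 0)) * ENNReal.ofReal (v rej)
      else ENNReal.ofReal (v (.run F)) := by
  have h1 : 0 ≤ 1 - p (F 0) := sub_nonneg.2 (hp _).2
  unfold settled
  split_ifs
  · rw [ENNReal.ofReal_add (mul_nonneg (hp _).1.le (hv _)) (mul_nonneg h1 (hv _)),
      ENNReal.ofReal_mul (hp _).1.le, ENNReal.ofReal_mul h1]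
  · rfl

/-- The configuration after `k` draws. -/
noncomputable def cfgAt (p : Fin n → ℝ) (rej : Cfg n) (k : ℕ) (q : Cfg n × Tape n) : Cfg n :=
  ((next p rej)^[k] q).1

theorem measurable_cfgAt (p : Fin n → ℝ) (rej : Cfg n) (k : ℕ) :
    Measurable (cfgAt p rej k) :=
  measurable_fst.comp ((measurable_next p rej).iterate k)

theorem measurable_cfgAt_right (p : Fin n → ℝ) (rej : Cfg n) (k : ℕ) (s : Cfg n) :
    Measurable fun ω => cfgAt p rej k (s, ω) :=
  (measurable_cfgAt p rej k).comp (measurable_const.prodMk measurable_id)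

theorem cfgAt_done (p : Fin n → ℝ) (rej : Cfg n) (k : ℕ) (o : Option (Fin n)) (ω : Tape n) :
    cfgAt p rej k (.done o, ω) = .done o := by
  induction k with
  | zero => rfl
  | succ k ih => rw [cfgAt, Function.iterate_succ_apply]; exact ih

theorem cfgAt_succ (p : Fin n → ℝ) (rej : Cfg n) (k : ℕ) (q : Cfg n × Tape n) :
    cfgAt p rej (k + 1) q = cfgAt p rej k (next p rej q) := by
  rw [cfgAt, Function.iterate_succ_apply]; rfl

theorem cfgAt_mono {p : Fin n → ℝ} {rej : Cfg n} {k l : ℕ} (h : k ≤ l) {q : Cfg n × Tape n}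
    {o : Option (Fin n)} (hk : cfgAt p rej k q = .done o) : cfgAt p rej l q = .done o := by
  obtain ⟨j, rfl⟩ := Nat.exists_eq_add_of_le' h
  rw [cfgAt, Function.iterate_add_apply]
  change cfgAt p rej j _ = _
  rw [← Prod.mk.eta (p := (next p rej)^[k] q)]
  change cfgAt p rej j (cfgAt p rej k q, _) = _
  rw [hk, cfgAt_done]

section Iterate

variable {Q : PMF (Sym2 (Fin n))} {D : PMF (Fin n)}
  (hQ : IsPairDistribution Q) (hD : ∀ x, 0 < (D x).toReal) {p : Fin n → ℝ}
  (hp : ∀ x, 0 < p x ∧ p x ≤ 1) {rej : Cfg n} (hrej : rej.Proper)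
  {v : Cfg n → ℝ} (hv : ∀ s, 0 ≤ v s)

include hQ hD hp hrej hv

/-- A function that vanishes at outputs and contracts by ρ in mean per draw decays geometrically.
The induction conditions on the first draw, so the start must be arbitrary; properness of `rej`
allows the hypothesis to be used again after a restart. -/
theorem lintegral_cfgAt_le {ρ : ℝ} (hρ : 0 ≤ ρ) (hdone : ∀ o, v (.done o) = 0)
    (hstep : ∀ F, ¬ Coal F → drawMean Q D p rej v F ≤ ρ * v (.run F)) (k : ℕ) (s : Cfg n)
    (hs : s.Proper) :
    ∫⁻ ω, ENNReal.ofReal (v (cfgAt p rej k (s, ω))) ∂(tapeLaw Q D) ≤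
      ENNReal.ofReal (ρ ^ k) * ENNReal.ofReal (v s) := by
  classical
  induction k generalizing s with
  | zero => simp [cfgAt]
  | succ k ih =>
    cases s with
    | done o => simp [cfgAt_done, hdone]
    | run F =>
      have hF := hs F rfl
      simp only [cfgAt_succ]
      have hm : Measurable fun q => ENNReal.ofReal (v (cfgAt p rej k q)) :=
        (measurable_from_top (f := fun s => ENNReal.ofReal (v s))).comp (measurable_cfgAt p rej k)
      rw [lintegral_next hQ hD hp rej hm F (fun _ => rfl)]
      have hhat : ∀ F' : Fin n → Fin n, (if Coal F' then
          ENNReal.ofReal (p (F' 0)) * (∫⁻ ω, ENNReal.ofReal (v (cfgAt p rej k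
            (.done (some (F' 0)), ω))) ∂(tapeLaw Q D)) +
          ENNReal.ofReal (1 - p (F' 0)) * (∫⁻ ω, ENNReal.ofReal (v (cfgAt p rej k (rej, ω)))
            ∂(tapeLaw Q D))
          else ∫⁻ ω, ENNReal.ofReal (v (cfgAt p rej k (.run F', ω))) ∂(tapeLaw Q D)) ≤
          ENNReal.ofReal (ρ ^ k) * ENNReal.ofReal (settled p rej v F') := by
        intro F'
        rw [ofReal_settled hp hv]
        by_cases hc : Coal F'
        · simp only [hc, if_true]
          refine (add_le_add (mul_le_mul_right (ih _ (Cfg.proper_done _)) _)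
            (mul_le_mul_right (ih _ hrej) _)).trans_eq ?_
          ring
        · simp only [hc, if_false]
          exact ih _ (Cfg.proper_run hc)
      calc _ ≤ ENNReal.ofReal (ρ ^ k) * ENNReal.ofReal (drawMean Q D p rej v F) := by
            rw [ofReal_drawMean hp hv, Finset.mul_sum]
            refine Finset.sum_le_sum fun x _ => ?_
            rw [Finset.mul_sum]
            refine Finset.sum_le_sum fun w _ => ?_
            refine (mul_le_mul_right (add_le_add (mul_le_mul_right (hhat _) _)
              (mul_le_mul_right (hhat _) _)) _).trans_eq ?_
            ring
        _ ≤ ENNReal.ofReal (ρ ^ k) * ENNReal.ofReal (ρ * v (.run F)) := by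
            gcongr; exact hstep F hF
        _ = _ := by
            rw [ENNReal.ofReal_mul hρ, pow_succ, ENNReal.ofReal_mul (by positivity)]; ring

/-- The martingale counterpart: here v may be nonzero at outputs, which absorb the chain. -/
theorem lintegral_cfgAt_eq
    (hstep : ∀ F, ¬ Coal F → drawMean Q D p rej v F = v (.run F)) (k : ℕ) (s : Cfg n)
    (hs : s.Proper) :
    ∫⁻ ω, ENNReal.ofReal (v (cfgAt p rej k (s, ω))) ∂(tapeLaw Q D) = ENNReal.ofReal (v s) := by
  classical
  induction k generalizing s with
  | zero => simp [cfgAt]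
  | succ k ih =>
    cases s with
    | done o => simp [cfgAt_done]
    | run F =>
      have hF := hs F rfl
      simp only [cfgAt_succ]
      have hm : Measurable fun q => ENNReal.ofReal (v (cfgAt p rej k q)) :=
        (measurable_from_top (f := fun s => ENNReal.ofReal (v s))).comp (measurable_cfgAt p rej k)
      rw [lintegral_next hQ hD hp rej hm F (hat := fun F' => ENNReal.ofReal (settled p rej v F'))]
      · rw [← ofReal_drawMean hp hv, hstep F hF]
      · intro F'
        rw [ofReal_settled hp hv]
        by_cases hc : Coal F'
        · simp only [hc, if_true]
          rw [ih _ (Cfg.proper_done _), ih _ hrej]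
        · simp only [hc, if_false]
          rw [ih _ (Cfg.proper_run hc)]

end Iterate

end Machine

/-! ### Detailed balance, the disagreement potential, and tails of the running time -/

section Potential

open MeasureTheory

variable {n : ℕ}

/-- The probability that one draw moves the state `x` to `w`. -/
noncomputable def moveRate (Q : PMF (Sym2 (Fin n))) (D : PMF (Fin n)) (p : Fin n → ℝ)
    (x w : Fin n) : ℝ := drawWeight Q D x w * min (p x / p w) 1

/-- The unnormalized stationary weight `D x / p x` of the rescaled chain. -/
noncomputable def statWeight (D : PMF (Fin n)) (p : Fin n → ℝ) (x : Fin n) : ℝ :=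
  (D x).toReal / p x

/-- Detailed balance. Both sides equal Q(x,w) · D(x)D(w)/(D(x)+D(w)) · min{1/p(x), 1/p(w)}, which is
symmetric. -/
theorem statWeight_mul_moveRate {Q : PMF (Sym2 (Fin n))} {D : PMF (Fin n)}
    {p : Fin n → ℝ} (hp : ∀ x, 0 < p x) (x w : Fin n) :
    statWeight D p x * moveRate Q D p x w = statWeight D p w * moveRate Q D p w x := by
  have h1 : ∀ x w, (p x)⁻¹ * min (p x / p w) 1 = min (p w)⁻¹ (p x)⁻¹ := by
    intro x w
    rw [mul_min_of_nonneg _ _ (inv_nonneg.2 (hp x).le), mul_one]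
    congr 1
    have := (hp x).ne'
    field_simp
  have h2 : ∀ x w, statWeight D p x * moveRate Q D p x w =
      (Q s(x, w)).toReal * ((D x).toReal * (D w).toReal / ((D x).toReal + (D w).toReal)) *
        min (p w)⁻¹ (p x)⁻¹ := by
    intro x w
    rw [← h1]; unfold statWeight moveRate drawWeight; ring
  rw [h2, h2, Sym2.eq_swap, min_comm, add_comm, mul_comm (D w).toReal]

theorem moveRate_nonneg {Q : PMF (Sym2 (Fin n))} {D : PMF (Fin n)} {p : Fin n → ℝ}
    (hp : ∀ x, 0 < p x) (x w : Fin n) : 0 ≤ moveRate Q D p x w :=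
  mul_nonneg (drawWeight_nonneg _ _ _ _) (le_min (div_pos (hp _) (hp _)).le zero_le_one)

theorem sum_moveRate_antisymm {Q : PMF (Sym2 (Fin n))} {D : PMF (Fin n)}
    {p : Fin n → ℝ} (hp : ∀ x, 0 < p x) (K : Fin n → ℝ) :
    ∑ x, ∑ w, moveRate Q D p x w * (statWeight D p x * (K w - K x)) = 0 := by
  have h : ∑ x, ∑ w, moveRate Q D p x w * (statWeight D p x * (K w - K x)) =
      -∑ x, ∑ w, moveRate Q D p x w * (statWeight D p x * (K w - K x)) := by
    conv_lhs => rw [Finset.sum_comm]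
    rw [← Finset.sum_neg_distrib]
    refine Finset.sum_congr rfl fun x _ => ?_
    rw [← Finset.sum_neg_distrib]
    refine Finset.sum_congr rfl fun w _ => ?_
    have := statWeight_mul_moveRate (Q := Q) (D := D) hp x w
    linear_combination (K w - K x) * this
  linarith

/-- The mean of `f ∘ F` under the stationary distribution. -/
noncomputable def statMean (D : PMF (Fin n)) (p : Fin n → ℝ) (f : Fin n → ℝ)
    (F : Fin n → Fin n) : ℝ :=
  (∑ y, statWeight D p y * f (F y)) / ∑ y, statWeight D p y

/-- An update changes only the term of x, by g(x)(f(F w) - f(F x)) up to normalization, and such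
sums cancel under the exchange of x and w by detailed balance. This is stationarity in the form used
by coupling from the past. -/
theorem sum_moveRate_statMean {Q : PMF (Sym2 (Fin n))} {D : PMF (Fin n)}
    {p : Fin n → ℝ} (hp : ∀ x, 0 < p x) (f : Fin n → ℝ) (F : Fin n → Fin n) :
    ∑ x, ∑ w, moveRate Q D p x w *
      (statMean D p f (Function.update F x (F w)) - statMean D p f F) = 0 := by
  have h1 : ∀ x w, statMean D p f (Function.update F x (F w)) - statMean D p f F =
      statWeight D p x * (f (F w) - f (F x)) / ∑ y, statWeight D p y := by
    intro x w
    rw [statMean, statMean, ← sub_div, ← Finset.sum_sub_distrib, Finset.sum_eq_single x]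
    · rw [Function.update_self]; ring
    · intro y _ hy; rw [Function.update_of_ne hy, sub_self]
    · simp
  simp only [h1, mul_div_assoc', ← Finset.sum_div]
  rw [sum_moveRate_antisymm hp fun x => f (F x), zero_div]

/-- The indicator of `a ≠ b`. -/
def neInd (a b : Fin n) : ℝ := if a = b then 0 else 1

theorem neInd_comm (a b : Fin n) : neInd a b = neInd b a := by simp [neInd, eq_comm]

theorem neInd_self (a : Fin n) : neInd a a = 0 := by simp [neInd]

theorem neInd_nonneg (a b : Fin n) : 0 ≤ neInd a b := by unfold neInd; split_ifs <;> norm_num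

theorem neInd_le_one (a b : Fin n) : neInd a b ≤ 1 := by unfold neInd; split_ifs <;> norm_num

/-- The weight of the pairs on which `F` takes different values. -/
noncomputable def disagreement (g : Fin n → ℝ) (F : Fin n → Fin n) : ℝ :=
  ∑ y, ∑ z, g y * g z * neInd (F y) (F z)

/-- The row and the column of x change by equal amounts. Each of the two counts contains the
diagonal pair (x, x), which in truth remains in agreement; removing it twice gives the negative
quadratic term, the only source of decay. -/
theorem disagreement_update (g : Fin n → ℝ) (F : Fin n → Fin n) (x w : Fin n) :
    disagreement g (Function.update F x (F w)) - disagreement g F =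
      2 * (g x * (∑ z, g z * neInd (F w) (F z) - ∑ z, g z * neInd (F x) (F z))) -
        2 * (g x ^ 2 * neInd (F x) (F w)) := by
  have h : ∀ y z, g y * g z * neInd (Function.update F x (F w) y) (Function.update F x (F w) z) =
      g y * g z * neInd (F y) (F z) +
      (if y = x then g x * (g z * neInd (F w) (F z) - g z * neInd (F x) (F z)) else 0) +
      (if z = x then g x * (g y * neInd (F w) (F y) - g y * neInd (F x) (F y)) else 0) -
      (if y = x then if z = x then 2 * (g x ^ 2 * neInd (F x) (F w)) else 0 else 0) := by
    intro y z
    by_cases hy : y = x <;> by_cases hz : z = x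
    · subst hy; subst hz
      simp [neInd_self, neInd_comm (F w) (F _)]; ring
    · subst hy; simp [hz]; ring
    · subst hz
      simp [hy, neInd_comm (F _) (F y)]; ring
    · simp [hy, hz]
  unfold disagreement
  simp only [h, Finset.sum_add_distrib, Finset.sum_sub_distrib, Finset.sum_ite_eq',
    Finset.sum_ite_irrel, Finset.sum_const_zero, Finset.mem_univ, if_true]
  simp only [← Finset.mul_sum, Finset.sum_sub_distrib]
  ring

theorem disagreement_eq_zero {g : Fin n → ℝ} {F : Fin n → Fin n} (h : Coal F) :
    disagreement g F = 0 := by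
  refine Finset.sum_eq_zero fun y _ => Finset.sum_eq_zero fun z _ => ?_
  rw [h y z, neInd_self, mul_zero]

theorem disagreement_nonneg {g : Fin n → ℝ} (hg : ∀ x, 0 ≤ g x) (F : Fin n → Fin n) :
    0 ≤ disagreement g F :=
  Finset.sum_nonneg fun _ _ => Finset.sum_nonneg fun _ _ =>
    mul_nonneg (mul_nonneg (hg _) (hg _)) (neInd_nonneg _ _)

/-- The gap that makes Markov's inequality effective: before coalescence at least one pair
disagrees. -/
theorem le_disagreement {g : Fin n → ℝ} {a : ℝ} (ha : 0 < a) (hg : ∀ x, a ≤ g x)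
    {F : Fin n → Fin n} (h : ¬ Coal F) : a ^ 2 ≤ disagreement g F := by
  unfold Coal at h
  push Not at h
  obtain ⟨x, y, hxy⟩ := h
  have hg0 : ∀ x, 0 ≤ g x := fun x => ha.le.trans (hg x)
  have hnn : ∀ y z, 0 ≤ g y * g z * neInd (F y) (F z) := fun y z =>
    mul_nonneg (mul_nonneg (hg0 _) (hg0 _)) (neInd_nonneg _ _)
  calc a ^ 2 ≤ g x * g y * neInd (F x) (F y) := by
        rw [neInd, if_neg hxy, mul_one, pow_two]
        exact mul_le_mul (hg x) (hg y) ha.le (hg0 x)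
    _ ≤ ∑ z, g x * g z * neInd (F x) (F z) :=
        Finset.single_le_sum (f := fun z => g x * g z * neInd (F x) (F z))
          (fun z _ => hnn x z) (Finset.mem_univ y)
    _ ≤ disagreement g F :=
        Finset.single_le_sum (f := fun x => ∑ z, g x * g z * neInd (F x) (F z))
          (fun x _ => Finset.sum_nonneg fun z _ => hnn x z) (Finset.mem_univ x)

theorem disagreement_le {g : Fin n → ℝ} {b : ℝ} (hg0 : ∀ x, 0 ≤ g x) (hg : ∀ x, g x ≤ b)
    (F : Fin n → Fin n) : disagreement g F ≤ b ^ 2 * ∑ x, ∑ y, neInd (F x) (F y) := by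
  rw [disagreement, Finset.mul_sum]
  refine Finset.sum_le_sum fun x _ => ?_
  rw [Finset.mul_sum]
  refine Finset.sum_le_sum fun y _ => mul_le_mul_of_nonneg_right ?_ (neInd_nonneg _ _)
  rw [pow_two]
  exact mul_le_mul (hg x) (hg y) (hg0 y) ((hg0 x).trans (hg x))

theorem sum_neInd_le (F : Fin n → Fin n) : ∑ x, ∑ y, neInd (F x) (F y) ≤ (n : ℝ) ^ 2 := by
  calc ∑ x, ∑ y, neInd (F x) (F y) ≤ ∑ _x : Fin n, ∑ _y : Fin n, (1 : ℝ) :=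
        Finset.sum_le_sum fun x _ => Finset.sum_le_sum fun y _ => neInd_le_one _ _
    _ = (n : ℝ) ^ 2 := by simp [pow_two]

/-- The Poincaré inequality, summed over the indicators of the level sets of F. Summing over all
values loses nothing, because both sides are exact counts of separated pairs. -/
theorem poincare_partition (hn : 2 ≤ n) {Q : PMF (Sym2 (Fin n))} (hG : (pairGraph Q).Connected)
    (F : Fin n → Fin n) :
    fiedler hn Q / n * ∑ x, ∑ y, neInd (F x) (F y) ≤
      ∑ x, ∑ y, (Q s(x, y)).toReal * neInd (F x) (F y) := by
  have hn0 : (n : ℝ) ≠ 0 := by positivity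
  let I : Fin n → Fin n → ℝ := fun v x => if F x = v then 1 else 0
  -- A separated pair is split by exactly two indicators, those of its own two values.
  have h1 : ∀ x y, ∑ v, (I v x - I v y) * (I v x - I v y) = 2 * neInd (F x) (F y) := by
    intro x y
    by_cases h : F x = F y
    · simp [I, h, neInd]
    · simp only [I, neInd, h, if_false, mul_sub, sub_mul]
      simp [Finset.sum_sub_distrib, h, Ne.symm h]
      norm_num
  have h2 : ∑ v, edgeForm Q (I v) (I v) =
      ∑ x, ∑ y, (Q s(x, y)).toReal * neInd (F x) (F y) := by
    simp only [edgeForm]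
    rw [← Finset.mul_sum, Finset.sum_comm, Finset.mul_sum]
    refine Finset.sum_congr rfl fun x _ => ?_
    rw [Finset.sum_comm, Finset.mul_sum]
    refine Finset.sum_congr rfl fun y _ => ?_
    rw [← Finset.mul_sum, h1]; ring
  have h3 : ∑ v, (∑ x, I v x ^ 2 - (∑ x, I v x) ^ 2 / n) =
      (1 / n) * ∑ x, ∑ y, neInd (F x) (F y) := by
    have e1 : ∑ v, ∑ x, I v x ^ 2 = n := by
      rw [Finset.sum_comm]
      simp [I]
    have e2 : ∑ v, (∑ x, I v x) ^ 2 = ∑ x, ∑ y, (1 - neInd (F x) (F y)) := by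
      simp only [pow_two, Finset.sum_mul_sum]
      rw [Finset.sum_comm]
      refine Finset.sum_congr rfl fun x _ => ?_
      rw [Finset.sum_comm]
      refine Finset.sum_congr rfl fun y _ => ?_
      by_cases h : F x = F y
      · simp [I, h, neInd]
      · simp [I, neInd, h]
    rw [Finset.sum_sub_distrib, ← Finset.sum_div, e1, e2]
    simp only [Finset.sum_sub_distrib]
    simp
    field_simp
    ring
  rw [← h2]
  calc _ = ∑ v, fiedler hn Q * (∑ x, I v x ^ 2 - (∑ x, I v x) ^ 2 / n) := by
        rw [← Finset.mul_sum, h3]; ring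
    _ ≤ _ := Finset.sum_le_sum fun v _ => poincare hn hG _

/-- The mean decrease of the disagreement in one draw. -/
theorem sum_moveRate_disagreement (hn : 2 ≤ n) {Q : PMF (Sym2 (Fin n))}
    (hG : (pairGraph Q).Connected) {D : PMF (Fin n)} {p : Fin n → ℝ} (hp : ∀ x, 0 < p x)
    {a b ρ : ℝ} (ha : 0 < a) (hρ : 0 < ρ)
    (hga : ∀ x, a ≤ statWeight D p x) (hgb : ∀ x, statWeight D p x ≤ b)
    (hr : ∀ x w, ρ * (Q s(x, w)).toReal ≤ moveRate Q D p x w) (F : Fin n → Fin n) :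
    ∑ x, ∑ w, moveRate Q D p x w * (disagreement (statWeight D p) (Function.update F x (F w)) -
      disagreement (statWeight D p) F) ≤
      -(2 * ρ * a ^ 2 * fiedler hn Q / (n * b ^ 2)) * disagreement (statWeight D p) F := by
  set g := statWeight D p with hg
  have hg0 : ∀ x, 0 ≤ g x := fun x => ha.le.trans (hga x)
  have hb : 0 < b := ha.trans_le ((hga ⟨0, by omega⟩).trans (hgb _))
  have hn0 : (0 : ℝ) < n := by positivity
  -- The part of `disagreement_update` that is linear in the increment of x ↦ ∑ g(z) [F x ≠ F z] has
  -- mean zero by detailed balance.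
  have h0 := sum_moveRate_antisymm (Q := Q) (D := D) hp fun x => ∑ z, g z * neInd (F x) (F z)
  have h1 : ∑ x, ∑ w, moveRate Q D p x w * (disagreement g (Function.update F x (F w)) -
      disagreement g F) = -(2 * ∑ x, ∑ w, moveRate Q D p x w * (g x ^ 2 * neInd (F x) (F w))) := by
    rw [← sub_eq_zero, ← mul_zero (2 : ℝ), ← h0]
    simp only [Finset.mul_sum]
    rw [sub_neg_eq_add, ← Finset.sum_add_distrib]
    refine Finset.sum_congr rfl fun x _ => ?_
    rw [← Finset.sum_add_distrib]
    refine Finset.sum_congr rfl fun w _ => ?_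
    rw [disagreement_update]; ring
  have h2 : ρ * a ^ 2 * ∑ x, ∑ w, (Q s(x, w)).toReal * neInd (F x) (F w) ≤
      ∑ x, ∑ w, moveRate Q D p x w * (g x ^ 2 * neInd (F x) (F w)) := by
    rw [Finset.mul_sum]
    refine Finset.sum_le_sum fun x _ => ?_
    rw [Finset.mul_sum]
    refine Finset.sum_le_sum fun w _ => ?_
    calc ρ * a ^ 2 * ((Q s(x, w)).toReal * neInd (F x) (F w)) =
        (ρ * (Q s(x, w)).toReal) * (a ^ 2 * neInd (F x) (F w)) := by ring
      _ ≤ _ := by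
        refine mul_le_mul (hr x w) ?_ (mul_nonneg (sq_nonneg _) (neInd_nonneg _ _))
          (moveRate_nonneg hp x w)
        exact mul_le_mul_of_nonneg_right (pow_le_pow_left₀ ha.le (hga x) 2) (neInd_nonneg _ _)
  have h3 := poincare_partition hn hG F
  have h4 := disagreement_le hg0 hgb F
  have hf := fiedler_pos hn hG
  rw [h1, neg_mul, neg_le_neg_iff]
  calc 2 * ρ * a ^ 2 * fiedler hn Q / (n * b ^ 2) * disagreement g F
      ≤ 2 * ρ * a ^ 2 * fiedler hn Q / (n * b ^ 2) *
        (b ^ 2 * ∑ x, ∑ y, neInd (F x) (F y)) := by gcongr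
    _ = 2 * (ρ * a ^ 2 * (fiedler hn Q / n * ∑ x, ∑ y, neInd (F x) (F y))) := by
        field_simp
    _ ≤ 2 * (ρ * a ^ 2 * ∑ x, ∑ w, (Q s(x, w)).toReal * neInd (F x) (F w)) := by gcongr
    _ ≤ _ := by gcongr

variable [NeZero n]

/-- The hypothesis asks for a u that already has the settled value on coalesced maps; then the final
coin needs no separate treatment and only the drift of u has to be computed. -/
theorem drawMean_eq {Q : PMF (Sym2 (Fin n))} {D : PMF (Fin n)} (hQ : IsPairDistribution Q)
    (hD : ∀ x, 0 < (D x).toReal) {p : Fin n → ℝ} {rej : Cfg n} {v : Cfg n → ℝ}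
    {u : (Fin n → Fin n) → ℝ} (hu : ∀ F, settled p rej v F = u F) (F : Fin n → Fin n) :
    drawMean Q D p rej v F =
      u F + ∑ x, ∑ w, moveRate Q D p x w * (u (Function.update F x (F w)) - u F) := by
  have h := sum_drawWeight hQ hD
  rw [drawMean]
  simp only [hu]
  have h1 : u F = ∑ x, ∑ w, drawWeight Q D x w * u F := by
    simp only [← Finset.sum_mul]; rw [h, one_mul]
  conv_rhs => rw [h1]
  rw [← Finset.sum_add_distrib]
  refine Finset.sum_congr rfl fun x _ => ?_
  rw [← Finset.sum_add_distrib]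
  refine Finset.sum_congr rfl fun w _ => ?_
  rw [← h1, moveRate]; ring

theorem statMean_of_coal {D : PMF (Fin n)} {p : Fin n → ℝ} (hG : ∑ y, statWeight D p y ≠ 0)
    (f : Fin n → ℝ) {F : Fin n → Fin n} (h : Coal F) : statMean D p f F = f (F 0) := by
  rw [statMean]
  simp only [fun y => h y 0]
  rw [← Finset.sum_mul, mul_div_assoc, mul_comm, div_mul_cancel₀ _ hG]

theorem proper_cfgAt {p : Fin n → ℝ} {rej : Cfg n} (hrej : rej.Proper) (k : ℕ) (s : Cfg n)
    (hs : s.Proper) (ω : Tape n) : (cfgAt p rej k (s, ω)).Proper := by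
  induction k generalizing s ω with
  | zero => exact hs
  | succ k ih =>
    rw [cfgAt_succ]
    rw [← Prod.mk.eta (p := next p rej (s, ω))]
    apply ih
    cases s with
    | done o => exact Cfg.proper_done o
    | run F =>
      simp only [next]
      split_ifs with h1 h2
      · exact Cfg.proper_done _
      · exact hrej
      · exact Cfg.proper_run h1

/-- The machine has not stopped after `k` draws. -/
def Running (p : Fin n → ℝ) (rej : Cfg n) (k : ℕ) (ω : Tape n) : Prop :=
  ∃ F, cfgAt p rej k (.run id, ω) = .run F

theorem measurableSet_cfgAt (p : Fin n → ℝ) (rej : Cfg n) (k : ℕ) (S : Set (Cfg n)) :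
    MeasurableSet {ω | cfgAt p rej k (.run id, ω) ∈ S} :=
  measurable_cfgAt_right p rej k (.run id) (MeasurableSet.of_discrete (s := S))

/-- The event of never stopping is contained in being active after k draws for every k, and the tail
bounds tend to zero. -/
theorem ae_stops {Q : PMF (Sym2 (Fin n))} {D : PMF (Fin n)} {p : Fin n → ℝ} {rej : Cfg n}
    {K κ : ℝ} (hκ : 0 < κ)
    (htail : ∀ k, tapeLaw Q D {ω | Running p rej k ω} ≤
      ENNReal.ofReal (K * Real.exp (-(κ * k)))) :
    ∀ᵐ ω ∂(tapeLaw Q D), ∃ k o, cfgAt p rej k (.run id, ω) = .done o := by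
  rw [ae_iff]
  have hlim : Filter.Tendsto (fun k : ℕ => ENNReal.ofReal (K * Real.exp (-(κ * k)))) Filter.atTop
      (nhds 0) := by
    rw [← ENNReal.ofReal_zero]
    refine ENNReal.tendsto_ofReal ?_
    rw [← mul_zero K]
    refine Filter.Tendsto.const_mul _ (Real.tendsto_exp_atBot.comp ?_)
    exact Filter.tendsto_neg_atTop_atBot.comp
      (Filter.Tendsto.const_mul_atTop hκ tendsto_natCast_atTop_atTop)
  refine le_antisymm (ge_of_tendsto' hlim fun k => (measure_mono ?_).trans (htail k)) zero_le
  intro ω hω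
  simp only [Set.mem_ofPred_eq, not_exists] at hω
  rcases h : cfgAt p rej k (.run id, ω) with F | o
  · exact ⟨F, h⟩
  · exact absurd h (hω k o)

section Laws

variable {Q : PMF (Sym2 (Fin n))} {D : PMF (Fin n)}
  (hQ : IsPairDistribution Q) (hD : ∀ x, 0 < (D x).toReal) {p : Fin n → ℝ}
  (hp : ∀ x, 0 < p x ∧ p x ≤ 1) {rej : Cfg n} (hrej : rej.Proper) (hn : 2 ≤ n)

include hQ hD hp hrej hn

theorem measure_running_le {v : Cfg n → ℝ} (hv : ∀ s, 0 ≤ v s) {κ c : ℝ} (hc : 0 < c)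
    (hdone : ∀ o, v (.done o) = 0) (hrun : ∀ F, ¬ Coal F → c ≤ v (.run F))
    (hstep : ∀ F, ¬ Coal F → drawMean Q D p rej v F ≤ (1 - κ) * v (.run F)) (k : ℕ) :
    tapeLaw Q D {ω | Running p rej k ω} ≤
      ENNReal.ofReal (v (.run id) / c * Real.exp (-(κ * k))) := by
  -- The factor 1 - κ is replaced by exp(-κ), which dominates it and is nonnegative for every κ.
  have hle := lintegral_cfgAt_le hQ hD hp hrej hv (Real.exp_pos (-κ)).le hdone
    (fun F hF => (hstep F hF).trans (mul_le_mul_of_nonneg_right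
      (by linarith [Real.add_one_le_exp (-κ)]) (hv _))) k (.run id)
      (Cfg.proper_run (not_coal_id hn))
  have hset : {ω : Tape n | Running p rej k ω} ⊆
      {ω | ENNReal.ofReal c ≤ ENNReal.ofReal (v (cfgAt p rej k (.run id, ω)))} := by
    rintro ω ⟨F, hF⟩
    have hpr := proper_cfgAt (p := p) hrej k (.run id) (Cfg.proper_run (not_coal_id hn)) ω
    simp only [Set.mem_ofPred_eq, hF]
    exact ENNReal.ofReal_le_ofReal (hrun F (hpr F hF))
  refine (measure_mono hset).trans ?_
  have hc' : ENNReal.ofReal c ≠ 0 := by simpa using hc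
  refine (meas_ge_le_lintegral_div ?_ hc' ENNReal.ofReal_ne_top).trans ?_
  · exact ((measurable_from_top (f := fun s => ENNReal.ofReal (v s))).comp
      (measurable_cfgAt_right p rej k (.run id))).aemeasurable
  · refine (ENNReal.div_le_div_right hle _).trans ?_
    rw [← ENNReal.ofReal_mul (by positivity), ← ENNReal.ofReal_div_of_pos hc, ← Real.exp_nat_mul]
    refine ENNReal.ofReal_le_ofReal (le_of_eq ?_)
    rw [show (k : ℝ) * -κ = -(κ * k) by ring]; ring

/-- Here f(y) is the probability of the eventual output x when the common value is y, and c is this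
probability after a rejection. With a restart, c must be the value of the whole process at the
identity, which is the self-consistency in `hrejc`. -/
theorem measure_output {f : Fin n → ℝ} {c K κ : ℝ} (hκ : 0 < κ) (x : Fin n)
    (hf : ∀ y, f y = p y * (if y = x then 1 else 0) + (1 - p y) * c) (hc0 : 0 ≤ c) (hc1 : c ≤ 1)
    (hrejc : rej = .done none ∧ c = 0 ∨ rej = .run id ∧ c = statMean D p f id)
    (htail : ∀ k, tapeLaw Q D {ω | Running p rej k ω} ≤
      ENNReal.ofReal (K * Real.exp (-(κ * k)))) :
    tapeLaw Q D {ω | ∃ k, cfgAt p rej k (.run id, ω) = .done (some x)} =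
      ENNReal.ofReal (statMean D p f id) := by
  have hg0 : ∀ y, 0 < statWeight D p y := fun y => div_pos (hD y) (hp y).1
  have hGpos : 0 < ∑ y, statWeight D p y :=
    Finset.sum_pos (fun y _ => hg0 y) ⟨0, Finset.mem_univ _⟩
  have hf0 : ∀ y, 0 ≤ f y := fun y => by
    rw [hf]
    have h1 := (hp y).1; have h2 := (hp y).2
    split_ifs <;> nlinarith
  have hf1 : ∀ y, f y ≤ 1 := fun y => by
    rw [hf]
    have h1 := (hp y).1; have h2 := (hp y).2
    split_ifs <;> nlinarith
  have hm0 : ∀ F, 0 ≤ statMean D p f F := fun F =>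
    div_nonneg (Finset.sum_nonneg fun y _ => mul_nonneg (hg0 y).le (hf0 _)) hGpos.le
  have hm1 : ∀ F, statMean D p f F ≤ 1 := fun F => by
    rw [statMean, div_le_one hGpos]
    exact Finset.sum_le_sum fun y _ => mul_le_of_le_one_right (hg0 y).le (hf1 _)
  -- The conditional probability of output x given the configuration: a martingale with values in
  -- [0, 1].
  set q : Cfg n → ℝ := fun s => match s with
    | .run F => statMean D p f F
    | .done o => if o = some x then 1 else 0 with hq
  have hq0 : ∀ s, 0 ≤ q s := by
    rintro (F | o)
    · exact hm0 F
    · simp only [hq]; split_ifs <;> norm_num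
  have hqr : q rej = c := by
    rcases hrejc with ⟨h1, h2⟩ | ⟨h1, h2⟩
    · rw [h1, h2]; simp [hq]
    · rw [h1, h2]
  have hset : ∀ F, settled p rej q F = statMean D p f F := by
    intro F
    by_cases h : Coal F
    · rw [settled, if_pos h, statMean_of_coal hGpos.ne' f h, hf, hqr]
      simp [hq]
    · rw [settled, if_neg h]
  have hint := lintegral_cfgAt_eq hQ hD hp hrej hq0 (fun F _ => by
    rw [drawMean_eq hQ hD hset, sum_moveRate_statMean fun x => (hp x).1, add_zero])
  have hid := fun k => hint k (.run id) (Cfg.proper_run (not_coal_id hn))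
  change ∀ k, _ = ENNReal.ofReal (statMean D p f id) at hid
  set A : ℕ → Set (Tape n) := fun k => {ω | cfgAt p rej k (.run id, ω) = .done (some x)} with hA
  have hAm : ∀ k, MeasurableSet (A k) := fun k =>
    measurableSet_cfgAt p rej k {s | s = .done (some x)}
  have hRm : ∀ k, MeasurableSet {ω : Tape n | Running p rej k ω} := fun k =>
    measurableSet_cfgAt p rej k {s | ∃ F, s = .run F}
  have hAU : {ω | ∃ k, cfgAt p rej k (.run id, ω) = .done (some x)} = ⋃ k, A k := by
    ext; simp [hA]
  have hmono : Monotone A := fun k l hkl ω hω => cfgAt_mono hkl hω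
  have hup : ∀ k, tapeLaw Q D (A k) ≤ ENNReal.ofReal (statMean D p f id) := by
    intro k
    rw [← hid k, ← lintegral_indicator_one (hAm k)]
    refine lintegral_mono fun ω => ?_
    by_cases h : ω ∈ A k
    · rw [Set.indicator_of_mem h]
      have h' : cfgAt p rej k (.run id, ω) = .done (some x) := h
      simp only [h', hq]; simp
    · rw [Set.indicator_of_notMem h]; exact zero_le
  -- The martingale is at most the indicator of having output x plus the indicator of still being
  -- active; the mass of the latter vanishes in the limit.
  have hlow : ∀ k, ENNReal.ofReal (statMean D p f id) ≤
      tapeLaw Q D (A k) + ENNReal.ofReal (K * Real.exp (-(κ * k))) := by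
    intro k
    refine le_trans ?_ (add_le_add le_rfl (htail k))
    rw [← hid k, ← lintegral_indicator_one (hAm k), ← lintegral_indicator_one (hRm k),
      ← lintegral_add_left (measurable_one.indicator (hAm k))]
    refine lintegral_mono fun ω => ?_
    rcases h : cfgAt p rej k (.run id, ω) with F | o
    · have hr : ω ∈ {ω : Tape n | Running p rej k ω} := ⟨F, h⟩
      rw [Set.indicator_of_mem hr]
      refine le_add_left ?_
      simp only [hq, Pi.one_apply]
      simpa using hm1 F
    · by_cases ho : o = some x
      · have : ω ∈ A k := by rw [hA]; simp only [Set.mem_ofPred_eq]; rw [h, ho]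
        rw [Set.indicator_of_mem this]
        refine le_add_right ?_
        simp [hq, ho]
      · simp [hq, ho]
  rw [hAU, hmono.measure_iUnion]
  refine le_antisymm (iSup_le hup) ?_
  have hlim : Filter.Tendsto (fun k : ℕ => (⨆ k, tapeLaw Q D (A k)) +
      ENNReal.ofReal (K * Real.exp (-(κ * k)))) Filter.atTop
      (nhds ((⨆ k, tapeLaw Q D (A k)) + 0)) := by
    refine tendsto_const_nhds.add ?_
    rw [← ENNReal.ofReal_zero]
    refine ENNReal.tendsto_ofReal ?_
    rw [← mul_zero K]
    refine Filter.Tendsto.const_mul _ (Real.tendsto_exp_atBot.comp ?_)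
    exact Filter.tendsto_neg_atTop_atBot.comp
      (Filter.Tendsto.const_mul_atTop hκ tendsto_natCast_atTop_atTop)
  rw [add_zero] at hlim
  exact ge_of_tendsto' hlim fun k => (hlow k).trans
    (add_le_add (le_iSup (fun k => tapeLaw Q D (A k)) k) le_rfl)

end Laws

section Tails

variable {Q : PMF (Sym2 (Fin n))} {D : PMF (Fin n)}
  (hQ : IsPairDistribution Q) (hD : ∀ x, 0 < (D x).toReal) {p : Fin n → ℝ}
  (hp : ∀ x, 0 < p x ∧ p x ≤ 1)

omit [NeZero n] in
theorem sum_statWeight_mul {D : PMF (Fin n)} {p : Fin n → ℝ} (hp : ∀ x, 0 < p x) :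
    ∑ x, statWeight D p x * p x = 1 := by
  have h := D.tsum_coe
  rw [tsum_fintype] at h
  rw [← ENNReal.toReal_one, ← h, ENNReal.toReal_sum fun x _ => PMF.apply_ne_top _ _]
  exact Finset.sum_congr rfl fun x _ => div_mul_cancel₀ _ (hp x).ne'

include hD hp in
-- Unquantified constants obtained from finiteness. They suffice for almost sure halting and for the
-- exact law when p is an arbitrary positive vector.
theorem exists_rate_bounds (Q : PMF (Sym2 (Fin n))) : ∃ a b ρ : ℝ, 0 < a ∧ 0 < ρ ∧
    (∀ x, a ≤ statWeight D p x) ∧ (∀ x, statWeight D p x ≤ b) ∧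
    (∀ x w, ρ * (Q s(x, w)).toReal ≤ moveRate Q D p x w) := by
  obtain ⟨x₁, h₁⟩ := Finite.exists_min (statWeight D p)
  obtain ⟨x₂, h₂⟩ := Finite.exists_max (statWeight D p)
  obtain ⟨y, h₃⟩ := Finite.exists_min fun y : Fin n × Fin n =>
    (D y.2).toReal / ((D y.1).toReal + (D y.2).toReal) * min (p y.1 / p y.2) 1
  refine ⟨_, _, _, ?_, ?_, h₁, h₂, fun x w => (mul_comm _ _).trans_le
    ((mul_le_mul_of_nonneg_left (h₃ (x, w)) ENNReal.toReal_nonneg).trans_eq ?_)⟩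
  · exact div_pos (hD _) (hp _).1
  · exact mul_pos (div_pos (hD _) (add_pos (hD _) (hD _)))
      (lt_min (div_pos (hp _).1 (hp _).1) one_pos)
  · simp only [moveRate, drawWeight, mul_assoc]

variable (hn : 2 ≤ n) (hG : (pairGraph Q).Connected) {a b ρ : ℝ} (ha : 0 < a) (hρ : 0 < ρ)
  (hga : ∀ x, a ≤ statWeight D p x) (hgb : ∀ x, statWeight D p x ≤ b)
  (hr : ∀ x w, ρ * (Q s(x, w)).toReal ≤ moveRate Q D p x w)

include hQ hD hp hn hG ha hρ hga hgb hr

/-- The disagreement divided by a² is at least 1 until coalescence, at most (nb/a)² at the start,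
and decays at the rate of `sum_moveRate_disagreement`. -/
theorem sampler_tail (k : ℕ) :
    tapeLaw Q D {ω | Running p (.done none) k ω} ≤ ENNReal.ofReal ((n * b / a) ^ 2 *
      Real.exp (-(2 * ρ * a ^ 2 * fiedler hn Q / (n * b ^ 2) * k))) := by
  have hg0 : ∀ x, 0 ≤ statWeight D p x := fun x => ha.le.trans (hga x)
  set v : Cfg n → ℝ := fun s => match s with
    | .run F => disagreement (statWeight D p) F / a ^ 2
    | .done _ => 0 with hv
  have hv0 : ∀ s, 0 ≤ v s := by
    rintro (F | o)
    · exact div_nonneg (disagreement_nonneg hg0 F) (sq_nonneg _)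
    · exact le_rfl
  have hset : ∀ F, settled p (.done none) v F = disagreement (statWeight D p) F / a ^ 2 := by
    intro F
    by_cases h : Coal F
    · rw [settled, if_pos h, disagreement_eq_zero h]; simp [hv]
    · rw [settled, if_neg h]
  have ha2 : 0 < a ^ 2 := by positivity
  refine (measure_running_le hQ hD hp (Cfg.proper_done none) hn hv0 one_pos (fun _ => rfl)
    (fun F hF => ?_) (fun F _ => ?_) k).trans (ENNReal.ofReal_le_ofReal
    (mul_le_mul_of_nonneg_right ?_ (Real.exp_pos _).le))
  · exact (one_le_div ha2).2 (le_disagreement ha hga hF)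
  · rw [drawMean_eq hQ hD hset]
    have := sum_moveRate_disagreement hn hG (fun x => (hp x).1) ha hρ hga hgb hr F
    simp only [← sub_div, mul_div_assoc', ← Finset.sum_div]
    change _ ≤ _ * (disagreement (statWeight D p) F / a ^ 2)
    rw [← add_div, mul_div_assoc', div_le_div_iff_of_pos_right ha2]
    linarith
  · rw [div_one, div_pow]
    refine div_le_div_of_nonneg_right ?_ ha2.le
    refine (disagreement_le hg0 hgb id).trans ?_
    rw [mul_pow, mul_comm]
    exact mul_le_mul_of_nonneg_right (sum_neInd_le _) (sq_nonneg _)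

/-- A rejection sends the disagreement back to its maximum, so it is no longer a supermartingale.
Its logarithm has drift bounded away from zero before coalescence, and the price of a restart is
prepaid by the g-average of (1 - p)V₀, a martingale under the dynamics of F. Since the total is at
most V, constant drift becomes contraction at rate κ. -/
theorem loop_tail {V κ : ℝ} (hV : V = (n * b + 1) * Real.log (1 + (n * b / a) ^ 2))
    (hκ : κ = ρ * a ^ 2 * fiedler hn Q / (n * b ^ 2) / V) (k : ℕ) :
    tapeLaw Q D {ω | Running p (.run id) k ω} ≤ ENNReal.ofReal (2 * V *
      Real.exp (-(κ * k))) := by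
  have hg0 : ∀ x, 0 ≤ statWeight D p x := fun x => ha.le.trans (hga x)
  have hp0 : ∀ x, 0 < p x := fun x => (hp x).1
  have hb : 0 < b := ha.trans_le ((hga 0).trans (hgb _))
  have hnpos : (0 : ℝ) < n := by positivity
  have hf := fiedler_pos hn hG
  set G := ∑ y, statWeight D p y with hGdef
  have hGpos : 0 < G :=
    Finset.sum_pos (fun y _ => ha.trans_le (hga y)) ⟨0, Finset.mem_univ _⟩
  have hGle : G ≤ n * b := by
    calc G ≤ ∑ _y : Fin n, b := Finset.sum_le_sum fun y _ => hgb y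
      _ = n * b := by simp
  set H : (Fin n → Fin n) → ℝ := fun F => disagreement (statWeight D p) F / a ^ 2 with hH
  have ha2 : 0 < a ^ 2 := by positivity
  have hH0 : ∀ F, 0 ≤ H F := fun F => div_nonneg (disagreement_nonneg hg0 F) ha2.le
  have hHle : ∀ F, H F ≤ (n * b / a) ^ 2 := fun F => by
    rw [div_pow]
    refine div_le_div_of_nonneg_right ?_ ha2.le
    refine (disagreement_le hg0 hgb F).trans ?_
    rw [mul_pow, mul_comm]
    exact mul_le_mul_of_nonneg_right (sum_neInd_le _) (sq_nonneg _)
  have hlog0 : ∀ F, 0 ≤ Real.log (1 + H F) := fun F => Real.log_nonneg (by linarith [hH0 F])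
  have hlogle : ∀ F, Real.log (1 + H F) ≤ Real.log (1 + (n * b / a) ^ 2) := fun F =>
    Real.log_le_log (by linarith [hH0 F]) (by linarith [hHle F])
  have hLpos : 0 < Real.log (1 + (n * b / a) ^ 2) :=
    Real.log_pos (by have : 0 < (n * b / a) ^ 2 := by positivity
                     linarith)
  have hVpos : 0 < V := by rw [hV]; positivity
  -- The fixed point of V₀ = (1 - 1/G)V₀ + log(1 + H(id)): a round is rejected with probability 1 -
  -- 1/G and then costs V₀ again.
  set V₀ := G * Real.log (1 + H id) with hV₀
  have hV₀0 : 0 ≤ V₀ := mul_nonneg hGpos.le (hlog0 _)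
  set f : Fin n → ℝ := fun y => (1 - p y) * V₀ with hfdef
  have hf0 : ∀ y, 0 ≤ f y := fun y => mul_nonneg (sub_nonneg.2 (hp y).2) hV₀0
  have hm0 : ∀ F, 0 ≤ statMean D p f F := fun F =>
    div_nonneg (Finset.sum_nonneg fun y _ => mul_nonneg (hg0 y) (hf0 _)) hGpos.le
  have hmle : ∀ F, statMean D p f F ≤ V₀ := fun F => by
    rw [statMean, div_le_iff₀ hGpos, mul_comm, Finset.sum_mul]
    refine Finset.sum_le_sum fun y _ => mul_le_mul_of_nonneg_left ?_ (hg0 y)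
    exact mul_le_of_le_one_left hV₀0 (by linarith [hp0 (F y)])
  set u : (Fin n → Fin n) → ℝ := fun F => statMean D p f F + Real.log (1 + H F) with hu
  set v : Cfg n → ℝ := fun s => match s with
    | .run F => u F
    | .done _ => 0 with hv
  have hv0 : ∀ s, 0 ≤ v s := by
    rintro (F | o)
    · exact add_nonneg (hm0 F) (hlog0 F)
    · exact le_rfl
  -- Since ∑ g p = 1, the g-average of 1 - p is (G - 1)/G, and the fixed point equation closes.
  have huid : u id = V₀ := by
    have h1 : ∑ y, statWeight D p y * f (id y) = (G - 1) * V₀ := by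
      rw [← sum_statWeight_mul (D := D) hp0, hGdef, ← Finset.sum_sub_distrib, Finset.sum_mul]
      exact Finset.sum_congr rfl fun y _ => by simp only [hfdef, id]; ring
    have hG0 := hGpos.ne'
    simp only [hu, statMean, h1]
    rw [← hGdef, hV₀]; field_simp; ring
  have hset : ∀ F, settled p (.run id) v F = u F := by
    intro F
    by_cases h : Coal F
    · rw [settled, if_pos h]
      have h1 : v (.run id) = V₀ := huid
      have h2 : v (.done (some (F 0))) = 0 := rfl
      have h3 : H F = 0 := by simp only [hH, disagreement_eq_zero h, zero_div]
      have h4 : u F = f (F 0) + 0 := by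
        simp only [hu]
        rw [h3, statMean_of_coal hGpos.ne' f h, add_zero, Real.log_one]
      rw [h1, h2, h4, mul_zero, zero_add, add_zero]
    · rw [settled, if_neg h]
  have huV : ∀ F, u F ≤ V := fun F => by
    have h1 := hmle F
    have h2 := hlogle F
    have h3 : V₀ ≤ n * b * Real.log (1 + (n * b / a) ^ 2) :=
      mul_le_mul hGle (hlogle id) (hlog0 id) (by positivity)
    rw [hV]; simp only [hu]; linarith
  refine (measure_running_le hQ hD hp (Cfg.proper_run (not_coal_id hn)) hn hv0
    -- Before coalescence H ≥ 1, hence u ≥ log 2 ≥ 1/2; this produces the factor 2 in front of V.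
    (c := 1 / 2) (κ := κ) (by norm_num) (fun _ => rfl)
    (fun F hF => ?_) (fun F hF => ?_) k).trans (ENNReal.ofReal_le_ofReal
    (mul_le_mul_of_nonneg_right ?_ (Real.exp_pos _).le))
  · have h1 : 1 ≤ H F := (one_le_div ha2).2 (le_disagreement ha hga hF)
    have h2 : Real.log 2 ≤ Real.log (1 + H F) := Real.log_le_log (by norm_num) (by linarith)
    have := Real.log_two_gt_d9
    have := hm0 F
    simp only [hv, hu]; linarith
  · rw [drawMean_eq hQ hD hset]
    have h1 : 1 ≤ H F := (one_le_div ha2).2 (le_disagreement ha hga hF)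
    have hdrift := sum_moveRate_disagreement hn hG hp0 ha hρ hga hgb hr F
    set γ := 2 * ρ * a ^ 2 * fiedler hn Q / (n * b ^ 2) with hγ
    have hγ0 : 0 < γ := by positivity
    have hHd : ∑ x, ∑ w, moveRate Q D p x w * (H (Function.update F x (F w)) - H F) ≤
        -γ * H F := by
      simp only [hH, ← sub_div, mul_div_assoc', ← Finset.sum_div]
      exact div_le_div_of_nonneg_right hdrift ha2.le
    -- Concavity of the logarithm: its drift is at most that of H divided by 1 + H, and H/(1 + H) ≥
    -- 1/2 while H ≥ 1.
    have hlogd : ∀ F', Real.log (1 + H F') - Real.log (1 + H F) ≤ (H F' - H F) / (1 + H F) := by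
      intro F'
      have e1 : 0 < 1 + H F := by linarith [hH0 F]
      have e2 : 0 < 1 + H F' := by linarith [hH0 F']
      rw [← Real.log_div e2.ne' e1.ne']
      refine (Real.log_le_sub_one_of_pos (div_pos e2 e1)).trans_eq ?_
      field_simp; ring
    have hd : ∑ x, ∑ w, moveRate Q D p x w * (u (Function.update F x (F w)) - u F) ≤ -(γ / 2) := by
      have e1 : 0 < 1 + H F := by linarith [hH0 F]
      have hsplit : ∑ x, ∑ w, moveRate Q D p x w * (u (Function.update F x (F w)) - u F) =
          ∑ x, ∑ w, moveRate Q D p x w *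
            (statMean D p f (Function.update F x (F w)) - statMean D p f F) +
          ∑ x, ∑ w, moveRate Q D p x w *
            (Real.log (1 + H (Function.update F x (F w))) - Real.log (1 + H F)) := by
        rw [← Finset.sum_add_distrib]
        refine Finset.sum_congr rfl fun x _ => ?_
        rw [← Finset.sum_add_distrib]
        refine Finset.sum_congr rfl fun w _ => ?_
        simp only [hu]; ring
      rw [hsplit, sum_moveRate_statMean hp0, zero_add]
      calc _ ≤ ∑ x, ∑ w, moveRate Q D p x w *
            ((H (Function.update F x (F w)) - H F) / (1 + H F)) :=
            Finset.sum_le_sum fun x _ => Finset.sum_le_sum fun w _ =>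
              mul_le_mul_of_nonneg_left (hlogd _) (moveRate_nonneg hp0 x w)
        _ = (∑ x, ∑ w, moveRate Q D p x w * (H (Function.update F x (F w)) - H F)) /
              (1 + H F) := by
            simp only [mul_div_assoc', ← Finset.sum_div]
        _ ≤ (-γ * H F) / (1 + H F) := div_le_div_of_nonneg_right hHd e1.le
        _ ≤ -(γ / 2) := by
            rw [div_le_iff₀ e1]; nlinarith
    have hκγ : κ * V = γ / 2 := by
      rw [hκ, hγ]; field_simp
    have hκ0 : 0 ≤ κ := by rw [hκ]; positivity
    have h4 := mul_le_mul_of_nonneg_left (huV F) hκ0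
    change u F + _ ≤ (1 - κ) * u F
    linarith
  · have : v (.run id) ≤ V := huV id
    linarith

end Tails

end Potential

/-! ### Execution of the basic program blocks -/

section Execution

variable {n : ℕ}

/-- The events of the theorem speak of some final state; determinism makes it the one found by
following the abstract machine. -/
theorem Exec.det {ω : Tape n} {s : Stmt} {σ τ : State} (h : Exec ω s σ τ) {τ' : State}
    (h' : Exec ω s σ τ') : τ = τ' := by
  induction h generalizing τ' with
  | setN | setR | sample | coin | skip => cases h'; rfl
  | seq _ _ ih1 ih2 =>
    cases h' with
    | seq h1 h2 => cases ih1 h1; exact ih2 h2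
  | iteTrue hb _ ih =>
    cases h' with
    | iteTrue _ h1 => exact ih h1
    | iteFalse hb' _ => exact absurd hb hb'
  | iteFalse hb _ ih =>
    cases h' with
    | iteTrue hb' _ => exact absurd hb' hb
    | iteFalse _ h1 => exact ih h1
  | whileTrue hb _ _ ih1 ih2 =>
    cases h' with
    | whileTrue _ h1 h2 => cases ih1 h1; exact ih2 h2
    | whileFalse hb' => exact absurd hb hb'
  | whileFalse hb =>
    cases h' with
    | whileTrue hb' _ _ => exact absurd hb' hb
    | whileFalse _ => rfl

namespace State

theorem tick_nat (σ : State) : σ.tick.nat = σ.nat := rfl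
theorem tick_real (σ : State) : σ.tick.real = σ.real := rfl
theorem tick_draws (σ : State) : σ.tick.draws = σ.draws := rfl
theorem tick_coins (σ : State) : σ.tick.coins = σ.coins := rfl
theorem tick_steps (σ : State) : σ.tick.steps = σ.steps + 1 := rfl

theorem writeN_nat (σ : State) (a i v b j : ℕ) :
    (σ.writeN a i v).nat b j = if b = a ∧ j = i then v else σ.nat b j := by
  simp only [writeN, Function.update_apply]
  split_ifs <;> simp_all
theorem writeN_real (σ : State) (a i v : ℕ) : (σ.writeN a i v).real = σ.real := rfl
theorem writeN_draws (σ : State) (a i v : ℕ) : (σ.writeN a i v).draws = σ.draws := rfl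
theorem writeN_coins (σ : State) (a i v : ℕ) : (σ.writeN a i v).coins = σ.coins := rfl
theorem writeN_steps (σ : State) (a i v : ℕ) : (σ.writeN a i v).steps = σ.steps := rfl

theorem writeR_real (σ : State) (a i : ℕ) (v : ℝ) (b j : ℕ) :
    (σ.writeR a i v).real b j = if b = a ∧ j = i then v else σ.real b j := by
  simp only [writeR, Function.update_apply]
  split_ifs <;> simp_all
theorem writeR_nat (σ : State) (a i : ℕ) (v : ℝ) : (σ.writeR a i v).nat = σ.nat := rfl
theorem writeR_draws (σ : State) (a i : ℕ) (v : ℝ) : (σ.writeR a i v).draws = σ.draws := rfl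
theorem writeR_coins (σ : State) (a i : ℕ) (v : ℝ) : (σ.writeR a i v).coins = σ.coins := rfl
theorem writeR_steps (σ : State) (a i : ℕ) (v : ℝ) : (σ.writeR a i v).steps = σ.steps := rfl

theorem doSample_nat (ω : Tape n) (σ : State) (a b c e j : ℕ) :
    (σ.doSample ω a b c).nat e j = if e = c ∧ j = 0 then ((ω.1 σ.draws).2.2 : ℕ) else
      if e = b ∧ j = 0 then ((ω.1 σ.draws).2.1 : ℕ) else
      if e = a ∧ j = 0 then ((ω.1 σ.draws).1 : ℕ) else σ.nat e j := by
  simp only [doSample, writeN_nat]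
theorem doSample_real (ω : Tape n) (σ : State) (a b c : ℕ) :
    (σ.doSample ω a b c).real = σ.real := rfl
theorem doSample_draws (ω : Tape n) (σ : State) (a b c : ℕ) :
    (σ.doSample ω a b c).draws = σ.draws + 1 := rfl
theorem doSample_coins (ω : Tape n) (σ : State) (a b c : ℕ) :
    (σ.doSample ω a b c).coins = σ.coins := rfl
theorem doSample_steps (ω : Tape n) (σ : State) (a b c : ℕ) :
    (σ.doSample ω a b c).steps = σ.steps := rfl

open Classical in
theorem doCoin_nat (ω : Tape n) (σ : State) (a : ℕ) (p : ℝ) (b j : ℕ) :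
    (σ.doCoin ω a p).nat b j =
      if b = a ∧ j = 0 then (if (ω.2 σ.coins : ℝ) < p then 1 else 0) else σ.nat b j := by
  simp only [doCoin, writeN_nat]
theorem doCoin_real (ω : Tape n) (σ : State) (a : ℕ) (p : ℝ) :
    (σ.doCoin ω a p).real = σ.real := rfl
theorem doCoin_draws (ω : Tape n) (σ : State) (a : ℕ) (p : ℝ) :
    (σ.doCoin ω a p).draws = σ.draws := rfl
theorem doCoin_coins (ω : Tape n) (σ : State) (a : ℕ) (p : ℝ) :
    (σ.doCoin ω a p).coins = σ.coins + 1 := rfl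
theorem doCoin_steps (ω : Tape n) (σ : State) (a : ℕ) (p : ℝ) :
    (σ.doCoin ω a p).steps = σ.steps := rfl

attribute [simp] tick_nat tick_real tick_draws tick_coins tick_steps writeN_nat writeN_real
  writeN_draws writeN_coins writeN_steps writeR_real writeR_nat writeR_draws writeR_coins
  writeR_steps doSample_nat doSample_real doSample_draws doSample_coins doSample_steps
  doCoin_nat doCoin_real doCoin_draws doCoin_coins doCoin_steps

end State

attribute [simp] NExp.val RExp.val BExp.holds

/-- A `while` loop that makes `m` turns. -/
theorem exec_while {ω : Tape n} {b : BExp} {s : Stmt} (I : ℕ → State → Prop) (m : ℕ)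
    (htest : ∀ i σ, I i σ → i ≤ m → (b.holds σ ↔ i < m))
    (hbody : ∀ i σ, I i σ → i < m → ∃ τ, Exec ω s σ.tick τ ∧ I (i + 1) τ)
    {σ : State} (h0 : I 0 σ) : ∃ τ, Exec ω (.while b s) σ τ.tick ∧ I m τ := by
  have key : ∀ j i σ, i + j = m → I i σ → ∃ τ, Exec ω (.while b s) σ τ.tick ∧ I m τ := by
    intro j
    induction j with
    | zero =>
      intro i σ hi hI
      obtain rfl : i = m := by omega
      exact ⟨σ, Exec.whileFalse fun h => absurd ((htest _ _ hI le_rfl).1 h) (lt_irrefl _), hI⟩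
    | succ j ih =>
      intro i σ hi hI
      obtain ⟨τ, h1, h2⟩ := hbody i σ hI (by omega)
      obtain ⟨ρ, h3, h4⟩ := ih (i + 1) τ (by omega) h2
      exact ⟨ρ, Exec.whileTrue ((htest _ _ hI (by omega)).2 (by omega)) h1 h3, h4⟩
  exact key m 0 σ (by omega) h0

/-- A `for` loop over the states. -/
theorem exec_forX {ω : Tape n} {s : Stmt} (I : ℕ → State → Prop)
    (hI : ∀ i σ, I i σ → σ.nat vN 0 = n ∧ σ.nat vX 0 = i)
    (hbody : ∀ i σ, I i σ → i < n → ∃ τ, Exec ω s σ.tick τ ∧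
      I (i + 1) (τ.writeN vX 0 (τ.nat vX 0 + 1)).tick)
    {σ : State} (h0 : I 0 (σ.writeN vX 0 0).tick) :
    ∃ τ, Exec ω (forX s) σ τ.tick ∧ I n τ := by
  obtain ⟨τ, h1, h2⟩ := exec_while (ω := ω) (b := .ltN (nv vX) (nv vN))
    (s := .seq s (.setN vX (.lit 0) (.add (nv vX) (.lit 1)))) I n
    (fun i σ h _ => by simp [(hI i σ h).1, (hI i σ h).2])
    (fun i σ h hi => by
      obtain ⟨τ, h1, h2⟩ := hbody i σ h hi
      exact ⟨_, Exec.seq h1 (Exec.setN _ _ _ _), h2⟩) h0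
  exact ⟨τ, Exec.seq (Exec.setN _ _ _ _) h1, h2⟩

/-- The memory of the sampler: input `n`, vector `p`, current map `F`, and the counters. -/
structure SamplerState (p : Fin n → ℝ) (F : Fin n → Fin n) (d c B : ℕ) (σ : State) : Prop where
  size : σ.nat vN 0 = n
  map : ∀ x : Fin n, σ.nat vF x = F x
  vec : ∀ x : Fin n, σ.real rP x = p x
  draws : σ.draws = d
  coins : σ.coins = c
  steps : σ.steps ≤ B

theorem exec_initMap {ω : Tape n} {p : Fin n → ℝ} {d c B : ℕ} {σ : State}
    (hN : σ.nat vN 0 = n) (hp : ∀ x : Fin n, σ.real rP x = p x) (hd : σ.draws = d)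
    (hc : σ.coins = c) (hB : σ.steps ≤ B) :
    ∃ τ, Exec ω (forX (.setN vF (nv vX) (nv vX))) σ τ ∧
      SamplerState p id d c (B + (3 * n + 2)) τ := by
  obtain ⟨τ, h1, h2⟩ := exec_forX (ω := ω) (s := .setN vF (nv vX) (nv vX))
    (fun i τ => τ.nat vX 0 = i ∧ (∀ x : ℕ, x < i → τ.nat vF x = x) ∧ τ.nat vN 0 = n ∧
      τ.real = σ.real ∧ τ.draws = d ∧ τ.coins = c ∧ τ.steps ≤ B + (3 * i + 1))
    (fun i τ h => ⟨h.2.2.1, h.1⟩)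
    (fun i τ h hi => by
      obtain ⟨h1, h2, h3, h4, h5, h6, h7⟩ := h
      refine ⟨_, Exec.setN _ _ _ _, ?_⟩
      refine ⟨by simp [h1], fun x hx => ?_, by simp [h3], by simp [h4], by simp [h5],
        by simp [h6], by simp; omega⟩
      simp only [State.tick_nat, State.writeN_nat, NExp.val, h1]
      by_cases hxi : x = i
      · simp [hxi]
      · simp [hxi]; exact h2 x (by omega))
    (σ := σ) (by simp [hN, hd, hc]; omega)
  obtain ⟨_, h3, h4, h5, h6, h7, h8⟩ := h2
  exact ⟨_, h1, by simpa using h4, fun x => by simpa using h3 x x.2, fun x => by simp [h5, hp],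
    by simp [h6], by simp [h7], by simp; omega⟩

open Classical in
theorem exec_testCoalescence [NeZero n] {ω : Tape n} {p : Fin n → ℝ} {F : Fin n → Fin n}
    {d c B : ℕ} {σ : State} (h : SamplerState p F d c B σ) :
    ∃ τ, Exec ω testCoalescence σ τ ∧ SamplerState p F d c (B + (4 * n + 3)) τ ∧
      τ.nat vCo 0 = if Coal F then 1 else 0 := by
  have hF0 : σ.nat vF 0 = F 0 := by simpa using h.map 0
  obtain ⟨τ, h1, h2⟩ := exec_forX (ω := ω)
    (s := .ite (.eqN (.get vF (nv vX)) (.get vF (.lit 0))) .skip (.setN vCo (.lit 0) (.lit 0)))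
    (fun i τ => τ.nat vX 0 = i ∧ τ.nat vF = σ.nat vF ∧ τ.nat vN 0 = n ∧
      τ.real = σ.real ∧ τ.draws = d ∧ τ.coins = c ∧ τ.steps ≤ B + (4 * i + 2) ∧
      τ.nat vCo 0 = if ∀ x : Fin n, (x : ℕ) < i → F x = F 0 then 1 else 0)
    (fun i τ h => ⟨h.2.2.1, h.1⟩)
    (fun i τ hI hi => by
      obtain ⟨h1, h2, h3, h4, h5, h6, h7, h8⟩ := hI
      have e1 : τ.nat vF i = F ⟨i, hi⟩ := by rw [h2]; exact h.map ⟨i, hi⟩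
      have e2 : τ.nat vF 0 = F 0 := by rw [h2, hF0]
      have hiff : (∀ x : Fin n, (x : ℕ) < i + 1 → F x = F 0) ↔
          (∀ x : Fin n, (x : ℕ) < i → F x = F 0) ∧ F ⟨i, hi⟩ = F 0 := by
        constructor
        · exact fun hx => ⟨fun x hxi => hx x (by omega), hx ⟨i, hi⟩ (by simp)⟩
        · rintro ⟨ha, hb⟩ x hx
          rcases Nat.lt_succ_iff_lt_or_eq.1 hx with hx | hx
          · exact ha x hx
          · have : x = ⟨i, hi⟩ := Fin.ext hx
            rw [this, hb]
      by_cases hb : F ⟨i, hi⟩ = F 0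
      · refine ⟨_, Exec.iteTrue (by simp [h1, e1, e2, hb]) (Exec.skip _), ?_⟩
        refine ⟨by simp [h1], ?_, by simp [h3], by simp [h4], by simp [h5], by simp [h6],
          by simp; omega, ?_⟩
        · ext j; simp [h2]
        · simp only [hiff, hb, and_true]; simp [h8]
      · refine ⟨_, Exec.iteFalse (by simp [h1, e1, e2, Fin.val_inj, hb]) (Exec.setN _ _ _ _), ?_⟩
        refine ⟨by simp [h1], ?_, by simp [h3], by simp [h4], by simp [h5], by simp [h6],
          by simp; omega, ?_⟩
        · ext j; simp [h2]
        · simp only [hiff, hb, and_false]; simp)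
    (σ := (σ.writeN vCo 0 1).tick) (by
      have := h.steps
      refine ⟨by simp, by ext j; simp, by simp [h.size], by simp, by simp [h.draws],
        by simp [h.coins], by simp; omega, by simp⟩)
  obtain ⟨_, h3, h4, h5, h6, h7, h8, h9⟩ := h2
  refine ⟨_, Exec.seq (Exec.setN _ _ _ _) h1, ⟨by simpa using h4, fun x => ?_, fun x => ?_,
    by simp [h6], by simp [h7], by simp; omega⟩, ?_⟩
  · simp [h3, h.map]
  · simp [h5, h.vec]
  · simp only [State.tick_nat, h9]
    refine if_congr ⟨fun hx x y => (hx x x.2).trans (hx y y.2).symm, fun hx x _ => hx x 0⟩ rfl rfl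

/-- The scan over all states does something only at the loser, where it tosses exactly one coin. So
the loop invariant switches from F to the updated map, and from c to c + 1 coins, when the counter
passes the loser. -/
theorem exec_stepBack {ω : Tape n} {p : Fin n → ℝ} {F : Fin n → Fin n}
    {d c B : ℕ} {σ : State} (h : SamplerState p F d c B σ) (hv : ValidDraw (ω.1 d)) :
    ∃ τ, Exec ω stepBack σ τ ∧
      SamplerState p (drawStep p F (ω.1 d) (ω.2 c)) (d + 1) (c + 1) (B + (6 * n + 3)) τ := by
  classical
  set t := ω.1 d with ht
  set F' := drawStep p F t (ω.2 c) with hF'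
  set l := loser t with hl
  have hF'of : ∀ x, x ≠ l → F' x = F x := by
    intro x hx
    rw [hF', drawStep]
    split_ifs
    · rw [Function.update_of_ne hx]
    · rfl
  -- The guard of the program singles out the loser only for a valid draw: distinct elements, one of
  -- which is the winner.
  have hcond : ∀ x : Fin n, ((x ≠ t.1 ∧ x ≠ t.2.1) ∨ x = t.2.2) ↔ x ≠ l := by
    intro x
    have hv1 := hv.1
    rw [hl, loser]
    rcases hv.2 with h | h
    · rw [if_pos h, h]; constructor
      · rintro (⟨_, h2⟩ | h1)
        · exact h2
        · rw [h1]; exact hv1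
      · intro h2; by_cases h3 : x = t.1
        · exact Or.inr h3
        · exact Or.inl ⟨h3, h2⟩
    · rw [if_neg (fun h' => hv1 (h'.symm.trans h)), h]; constructor
      · rintro (⟨h2, _⟩ | h1)
        · exact h2
        · rw [h1]; exact hv1.symm
      · intro h2; by_cases h3 : x = t.2.1
        · exact Or.inr h3
        · exact Or.inl ⟨h2, h3⟩
  have hwl : t.2.2 ≠ l := (hcond _).1 (Or.inr rfl)
  obtain ⟨τ, h1, h2⟩ := exec_forX (ω := ω)
    (s := (.ite
        (.or (.and (.not (.eqN (nv vX) (nv vI))) (.not (.eqN (nv vX) (nv vJ))))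
          (.eqN (nv vX) (nv vW)))
        .skip
        (.seq (.coin vC (.div (.get rP (nv vX)) (.get rP (nv vW))))
          (.ite (.eqN (nv vC) (.lit 1))
            (.setN vF (nv vX) (.get vF (nv vW)))
            .skip))))
    (fun i τ => τ.nat vX 0 = i ∧ (∀ x : Fin n, τ.nat vF x = if (l : ℕ) < i then F' x else F x) ∧
      τ.nat vN 0 = n ∧ τ.real = σ.real ∧ τ.draws = d + 1 ∧
      τ.coins = (if (l : ℕ) < i then c + 1 else c) ∧ τ.steps ≤ B + (6 * i + 2) ∧
      τ.nat vI 0 = t.1 ∧ τ.nat vJ 0 = t.2.1 ∧ τ.nat vW 0 = t.2.2)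
    (fun i τ h => ⟨h.2.2.1, h.1⟩)
    (fun i τ hI hi => by
      obtain ⟨h1, h2, h3, h4, h5, h6, h7, h8, h9, h10⟩ := hI
      have hbiff : BExp.holds τ.tick (.or (.and (.not (.eqN (nv vX) (nv vI)))
          (.not (.eqN (nv vX) (nv vJ)))) (.eqN (nv vX) (nv vW))) ↔ (⟨i, hi⟩ : Fin n) ≠ l := by
        rw [← hcond]; simp [h1, h8, h9, h10, Fin.ext_iff]
      by_cases hb : (⟨i, hi⟩ : Fin n) = l
      · have hli : (l : ℕ) = i := by rw [← hb]
        have e1 : ∀ x : Fin n, τ.nat vF x = F x := fun x => by rw [h2, if_neg (by omega)]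
        have e2 : τ.coins = c := by rw [h6, if_neg (by omega)]
        have e3 : τ.real rP i = p l := by rw [h4, ← hli, h.vec]
        have e4 : τ.real rP (t.2.2 : ℕ) = p t.2.2 := by rw [h4, h.vec]
        by_cases hcn : (ω.2 c : ℝ) < p l / p t.2.2
        · refine ⟨_, Exec.iteFalse (fun hh => hbiff.1 hh hb) (Exec.seq (Exec.coin _ _ _)
            (Exec.iteTrue ?_ (Exec.setN _ _ _ _))), ?_⟩
          · simp [h1, h10, e2, e3, e4, hcn]
          · refine ⟨by simp [h1], fun x => ?_, by simp [h3], by simp [h4], by simp [h5],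
              by simp [hli, e2], by simp; omega, by simp [h8], by simp [h9], by simp [h10]⟩
            have hF'x : F' x = if x = l then F t.2.2 else F x := by
              rw [hF', drawStep, if_pos hcn, Function.update_apply]
            rw [if_pos (by omega), hF'x]
            by_cases hx : x = l
            · simp [h1, h10, hx, hli, e1]
            · have : (x : ℕ) ≠ i := fun h' => hx (Fin.ext (h'.trans hli.symm))
              simp [h1, hx, this, e1]
        · refine ⟨_, Exec.iteFalse (fun hh => hbiff.1 hh hb) (Exec.seq (Exec.coin _ _ _)
            (Exec.iteFalse ?_ (Exec.skip _))), ?_⟩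
          · simp [h1, h10, e2, e3, e4, not_lt.1 hcn]
          · refine ⟨by simp [h1], fun x => ?_, by simp [h3], by simp [h4], by simp [h5],
              by simp [hli, e2], by simp; omega, by simp [h8], by simp [h9], by simp [h10]⟩
            have hF'x : F' x = F x := by rw [hF', drawStep, if_neg hcn]
            rw [if_pos (by omega), hF'x]
            simp [e1]
      · have hli : (l : ℕ) ≠ i := fun h' => hb (Fin.ext h'.symm)
        have hiff : (l : ℕ) < i + 1 ↔ (l : ℕ) < i := by omega
        refine ⟨_, Exec.iteTrue (hbiff.2 hb) (Exec.skip _), ?_⟩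
        exact ⟨by simp [h1], fun x => by simp only [hiff]; simpa using h2 x, by simp [h3],
          by simp [h4], by simp [h5], by simp [hiff, h6], by simp; omega, by simp [h8],
          by simp [h9], by simp [h10]⟩)
    (σ := (σ.doSample ω vI vJ vW).tick) (by
      have := h.steps
      refine ⟨by simp, fun x => by simp [h.map], by simp [h.size], by simp, by simp [h.draws],
        by simp [h.coins], by simp; omega, by simp [h.draws, ht], by simp [h.draws, ht],
        by simp [h.draws, ht]⟩)
  obtain ⟨_, h3, h4, h5, h6, h7, h8, _⟩ := h2
  refine ⟨_, Exec.seq (Exec.sample _ _ _ _) h1, ⟨by simpa using h4, fun x => ?_, fun x => ?_,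
    by simp [h6], ?_, by simp; omega⟩⟩
  · simp [h3, l.2]
  · simp [h5, h.vec]
  · simp [h7, l.2]

end Execution

/-! ### The programs follow the abstract machine -/

section SamplerRun

variable {n : ℕ} [NeZero n]

/-- The part of `exactSampler` after the initialization: the main loop and the rejection step. -/
def samplerTail : Stmt :=
  .seq (.while (.eqN (nv vCo) (.lit 0)) (.seq stepBack testCoalescence))
  (.seq (.coin vC (.get rP (.get vF (.lit 0))))
    (.ite (.eqN (nv vC) (.lit 1))
      (.setN vOut (.lit 0) (.add (.get vF (.lit 0)) (.lit 1)))
      (.setN vOut (.lit 0) (.lit 0))))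

/-- The number of states moved by `F`. -/
def movedCard (F : Fin n → Fin n) : ℕ := (Finset.univ.filter fun x => F x ≠ x).card

omit [NeZero n] in
theorem movedCard_id : movedCard (id : Fin n → Fin n) = 0 := by simp [movedCard]

omit [NeZero n] in
theorem movedCard_drawStep_le (p : Fin n → ℝ) (F : Fin n → Fin n) (t : Fin n × Fin n × Fin n)
    (u : unitInterval) : movedCard (drawStep p F t u) ≤ movedCard F + 1 := by
  refine (Finset.card_le_card (t := insert (loser t) (Finset.univ.filter fun x => F x ≠ x))
    fun x hx => ?_).trans (Finset.card_insert_le _ _)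
  rw [Finset.mem_insert]
  by_cases h : x = loser t
  · exact Or.inl h
  · refine Or.inr ?_
    have h1 := (Finset.mem_filter.1 hx).2
    refine Finset.mem_filter.2 ⟨Finset.mem_univ _, ?_⟩
    unfold drawStep at h1
    split_ifs at h1
    · rwa [Function.update_of_ne h] at h1
    · exact h1

/-- A constant map fixes at most one point, while each draw adds at most one moved point. Hence n -
1 draws are necessary, which later allows n to be replaced by the number of draws in all step
counts. -/
theorem le_movedCard_of_coal {F : Fin n → Fin n} (h : Coal F) : n ≤ movedCard F + 1 := by
  have hsub : (Finset.univ : Finset (Fin n)) ⊆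
      insert (F 0) (Finset.univ.filter fun x => F x ≠ x) := by
    intro x _
    rw [Finset.mem_insert]
    by_cases hx : F x = x
    · exact Or.inl (by rw [← hx]; exact h _ _)
    · exact Or.inr (by simp [hx])
  have := (Finset.card_le_card hsub).trans (Finset.card_insert_le _ _)
  simpa [movedCard] using this

open Classical in
theorem next_run_adv (p : Fin n → ℝ) (rej : Cfg n) (F : Fin n → Fin n) (d c : ℕ) (ω : Tape n) :
    next p rej (.run F, ω.adv d c) =
      if Coal (drawStep p F (ω.1 d) (ω.2 c)) then
        (if (ω.2 (c + 1) : ℝ) < p (drawStep p F (ω.1 d) (ω.2 c) 0) then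
          .done (some (drawStep p F (ω.1 d) (ω.2 c) 0)) else rej, ω.adv (d + 1) (c + 2))
      else (.run (drawStep p F (ω.1 d) (ω.2 c)), ω.adv (d + 1) (c + 1)) := by
  simp only [next, Tape.adv_adv]
  simp [Tape.adv]

open Classical in
theorem exec_turn {ω : Tape n} {p : Fin n → ℝ} {F : Fin n → Fin n} {d c B : ℕ} {σ : State}
    (h : SamplerState p F d c B σ) (hv : ValidDraw (ω.1 d)) :
    ∃ τ, Exec ω (.seq stepBack testCoalescence) σ.tick τ ∧
      SamplerState p (drawStep p F (ω.1 d) (ω.2 c)) (d + 1) (c + 1) (B + (10 * n + 7)) τ ∧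
      τ.nat vCo 0 = if Coal (drawStep p F (ω.1 d) (ω.2 c)) then 1 else 0 := by
  have h' : SamplerState p F d c (B + 1) σ.tick :=
    ⟨h.size, h.map, h.vec, h.draws, h.coins, Nat.succ_le_succ h.steps⟩
  obtain ⟨τ, h1, h2⟩ := exec_stepBack h' hv
  obtain ⟨ρ, h3, h4, h5⟩ := exec_testCoalescence (ω := ω) h2
  exact ⟨ρ, Exec.seq h1 h3, ⟨h4.size, h4.map, h4.vec, h4.draws, h4.coins,
    h4.steps.trans (by omega)⟩, h5⟩

open Classical in
theorem exec_samplerTail_of_coal {ω : Tape n} {p : Fin n → ℝ} {F : Fin n → Fin n} {d c B : ℕ}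
    {σ : State} (h : SamplerState p F d c B σ) (hco : σ.nat vCo 0 = 1) :
    ∃ τ, Exec ω samplerTail σ τ ∧ SamplerState p F d (c + 1) (B + 4) τ ∧
      τ.nat vOut 0 = if (ω.2 c : ℝ) < p (F 0) then (F 0 : ℕ) + 1 else 0 := by
  have hF0 : σ.nat vF 0 = F 0 := by simpa using h.map 0
  have hp0 : σ.real rP (F 0 : ℕ) = p (F 0) := h.vec _
  have hs := h.steps
  by_cases hc : (ω.2 c : ℝ) < p (F 0)
  · refine ⟨_, Exec.seq (Exec.whileFalse (by simp [hco])) (Exec.seq (Exec.coin _ _ _)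
      (Exec.iteTrue (by simp [hF0, hp0, h.coins, hc]) (Exec.setN _ _ _ _))), ?_, ?_⟩
    · exact ⟨by simp [h.size], fun x => by simp [h.map], fun x => by simp [h.vec],
        by simp [h.draws], by simp [h.coins], by simp; omega⟩
    · simp [hF0, hc]
  · refine ⟨_, Exec.seq (Exec.whileFalse (by simp [hco])) (Exec.seq (Exec.coin _ _ _)
      (Exec.iteFalse (by simp [hF0, hp0, h.coins, not_lt.1 hc]) (Exec.setN _ _ _ _))), ?_, ?_⟩
    · exact ⟨by simp [h.size], fun x => by simp [h.map], fun x => by simp [h.vec],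
        by simp [h.draws], by simp [h.coins], by simp; omega⟩
    · simp [hc]

/-- The output register for an output. -/
def outCode : Option (Fin n) → ℕ
  | none => 0
  | some x => x + 1

omit [NeZero n] in
-- Peels one turn off the main loop, so that the executions below can be built by induction on the
-- number of draws of the abstract machine.
theorem exec_samplerTail_turn {ω : Tape n} {σ σ' τ : State} (hco : σ.nat vCo 0 = 0)
    (h1 : Exec ω (.seq stepBack testCoalescence) σ.tick σ') (h2 : Exec ω samplerTail σ' τ) :
    Exec ω samplerTail σ τ := by
  cases h2 with
  | seq h3 h4 => exact Exec.seq (Exec.whileTrue (by simp [hco]) h1 h3) h4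

theorem exec_samplerTail {ω : Tape n} (hω : ∀ i, ValidDraw (ω.1 i)) {p : Fin n → ℝ} (k : ℕ) :
    ∀ (F : Fin n → Fin n) (d c B : ℕ) (σ : State) (o : Option (Fin n)),
      SamplerState p F d c B σ → σ.nat vCo 0 = 0 →
      cfgAt p (.done none) k (.run F, ω.adv d c) = .done o →
      ∃ j τ, j ≤ k ∧ Exec ω samplerTail σ τ ∧ τ.nat vOut 0 = outCode o ∧ τ.draws = d + j ∧
        τ.steps ≤ B + j * (10 * n + 7) + 4 ∧ n ≤ movedCard F + j + 1 := by
  classical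
  induction k with
  | zero => intro F d c B σ o _ _ h; exact nomatch h
  | succ k ih =>
    intro F d c B σ o hσ hco hk
    rw [cfgAt_succ, next_run_adv] at hk
    obtain ⟨σ', h1, h2, h3⟩ := exec_turn (c := c) hσ (hω d)
    have hmv := movedCard_drawStep_le p F (ω.1 d) (ω.2 c)
    set F' := drawStep p F (ω.1 d) (ω.2 c) with hF'
    by_cases hc : Coal F'
    · rw [if_pos hc] at hk h3
      obtain ⟨τ, h4, h5, h6⟩ := exec_samplerTail_of_coal (ω := ω) h2 h3
      have hmc := le_movedCard_of_coal hc
      refine ⟨1, τ, by omega, exec_samplerTail_turn hco h1 h4, ?_, h5.draws, h5.steps.trans (by omega), by omega⟩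
      rw [h6]
      split_ifs at hk ⊢ with hu
      · rw [cfgAt_done] at hk; cases hk; rfl
      · rw [cfgAt_done] at hk; cases hk; rfl
    · rw [if_neg hc] at hk h3
      obtain ⟨j, τ, h4, h5, h6, h7, h8, h9⟩ := ih F' _ _ _ σ' o h2 h3 hk
      refine ⟨j + 1, τ, by omega, exec_samplerTail_turn hco h1 h5, h6, by omega, h8.trans_eq (by ring), by omega⟩

theorem exec_samplerStart {ω : Tape n} {p : Fin n → ℝ} {d c B : ℕ} {σ : State}
    (hn : 2 ≤ n) (hN : σ.nat vN 0 = n) (hp : ∀ x : Fin n, σ.real rP x = p x) (hd : σ.draws = d)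
    (hc : σ.coins = c) (hB : σ.steps ≤ B) :
    ∃ σ', (∀ τ, Exec ω samplerTail σ' τ → Exec ω exactSampler σ τ) ∧
      SamplerState p id d c (B + (7 * n + 5)) σ' ∧ σ'.nat vCo 0 = 0 := by
  classical
  obtain ⟨σ₁, h1, h2⟩ := exec_initMap (ω := ω) hN hp hd hc hB
  obtain ⟨σ₂, h3, h4, h5⟩ := exec_testCoalescence (ω := ω) h2
  rw [if_neg (not_coal_id hn)] at h5
  exact ⟨σ₂, fun τ hτ => Exec.seq h1 (Exec.seq h3 hτ), ⟨h4.size, h4.map, h4.vec, h4.draws,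
    h4.coins, h4.steps.trans (by omega)⟩, h5⟩

/-- `exactSampler` follows the abstract machine that stops after a rejection. -/
theorem exec_exactSampler {ω : Tape n} (hω : ∀ i, ValidDraw (ω.1 i)) (hn : 2 ≤ n)
    {p : Fin n → ℝ} {σ : State} (hN : σ.nat vN 0 = n) (hp : ∀ x : Fin n, σ.real rP x = p x)
    {k : ℕ} {o : Option (Fin n)}
    (hk : cfgAt p (.done none) k (.run id, ω.adv σ.draws σ.coins) = .done o) :
    ∃ j τ, j ≤ k ∧ Exec ω exactSampler σ τ ∧ τ.nat vOut 0 = outCode o ∧ τ.draws = σ.draws + j ∧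
      τ.steps ≤ σ.steps + (j + 1) * (10 * n + 9) ∧ n ≤ j + 1 := by
  obtain ⟨σ', h1, h2, h3⟩ := exec_samplerStart (ω := ω) hn hN hp rfl rfl le_rfl
  obtain ⟨j, τ, h4, h5, h6, h7, h8, h9⟩ := exec_samplerTail hω k id _ _ _ σ' o h2 h3 hk
  rw [movedCard_id] at h9
  exact ⟨j, τ, h4, h1 τ h5, h6, h7, h8.trans (by nlinarith), by omega⟩

/-- The loop around `exactSampler` in the full algorithm. -/
def samplerLoop : Stmt := .while (.eqN (nv vOut) (.lit 0)) exactSampler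

/-- The cost per draw covers the worst case, a draw followed by rejection and restart: 10n + 7 for
the turn, 4 for the acceptance test, 1 for the outer test and 7n + 5 for the initialization, in all
17n + 17. -/
theorem exec_samplerTail_loop {ω : Tape n} (hω : ∀ i, ValidDraw (ω.1 i)) (hn : 2 ≤ n)
    {p : Fin n → ℝ} (k : ℕ) :
    ∀ (F : Fin n → Fin n) (d c B : ℕ) (σ : State) (o : Option (Fin n)),
      SamplerState p F d c B σ → σ.nat vCo 0 = 0 →
      cfgAt p (.run id) k (.run F, ω.adv d c) = .done o →
      ∃ j ρ τ x, o = some x ∧ j ≤ k ∧ Exec ω samplerTail σ ρ ∧ Exec ω samplerLoop ρ τ ∧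
        τ.nat vOut 0 = (x : ℕ) + 1 ∧ τ.draws = d + j ∧
        τ.steps ≤ B + j * (17 * n + 17) ∧ n ≤ movedCard F + j + 1 := by
  classical
  induction k with
  | zero => intro F d c B σ o _ _ h; exact nomatch h
  | succ k ih =>
    intro F d c B σ o hσ hco hk
    rw [cfgAt_succ, next_run_adv] at hk
    obtain ⟨σ', h1, h2, h3⟩ := exec_turn (c := c) hσ (hω d)
    have hmv := movedCard_drawStep_le p F (ω.1 d) (ω.2 c)
    set F' := drawStep p F (ω.1 d) (ω.2 c) with hF'
    by_cases hc : Coal F'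
    · rw [if_pos hc] at hk h3
      obtain ⟨ρ, h4, h5, h6⟩ := exec_samplerTail_of_coal (ω := ω) h2 h3
      have hmc := le_movedCard_of_coal hc
      have hturn := exec_samplerTail_turn hco h1 h4
      by_cases hu : (ω.2 (c + 1) : ℝ) < p (F' 0)
      · rw [if_pos hu] at hk h6
        rw [cfgAt_done] at hk; cases hk
        have hs := h5.steps
        exact ⟨1, ρ, ρ.tick, F' 0, rfl, by omega, hturn, Exec.whileFalse (by simp [h6]),
          by simp [h6], h5.draws, by simp; omega, by omega⟩
      · rw [if_neg hu] at hk h6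
        obtain ⟨σ₂, h7, h8, h9⟩ := exec_samplerStart (ω := ω) (σ := ρ.tick) (p := p)
          (B := B + (10 * n + 7) + 4 + 1) hn h5.size h5.vec h5.draws h5.coins
          (Nat.succ_le_succ h5.steps)
        obtain ⟨j, ρ', τ, x, e1, e2, e3, e4, e5, e6, e7, e8⟩ := ih id _ _ _ σ₂ o h8 h9 hk
        exact ⟨j + 1, ρ, τ, x, e1, by omega, hturn,
          Exec.whileTrue (by simp [h6]) (h7 _ e3) e4, e5, by omega, e7.trans (by nlinarith),
          by omega⟩
    · rw [if_neg hc] at hk h3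
      obtain ⟨j, ρ, τ, x, h0, h4, h5, h5', h6, h7, h8, h9⟩ := ih F' _ _ _ σ' o h2 h3 hk
      exact ⟨j + 1, ρ, τ, x, h0, by omega, exec_samplerTail_turn hco h1 h5, h5', h6, by omega, h8.trans (by nlinarith), by omega⟩

/-- The loop around `exactSampler` follows the abstract machine that restarts after a rejection. -/
theorem exec_samplerLoop {ω : Tape n} (hω : ∀ i, ValidDraw (ω.1 i)) (hn : 2 ≤ n)
    {p : Fin n → ℝ} {σ : State} (hN : σ.nat vN 0 = n) (hp : ∀ x : Fin n, σ.real rP x = p x)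
    (hout : σ.nat vOut 0 = 0) {k : ℕ} {o : Option (Fin n)}
    (hk : cfgAt p (.run id) k (.run id, ω.adv σ.draws σ.coins) = .done o) :
    ∃ j τ x, o = some x ∧ j ≤ k ∧ Exec ω samplerLoop σ τ ∧ τ.nat vOut 0 = (x : ℕ) + 1 ∧
      τ.draws = σ.draws + j ∧ τ.steps ≤ σ.steps + (j + 1) * (17 * n + 17) ∧ n ≤ j + 1 := by
  obtain ⟨σ', h1, h2, h3⟩ := exec_samplerStart (ω := ω) (σ := σ.tick) hn hN hp rfl rfl le_rfl
  obtain ⟨j, ρ, τ, x, h0, h4, h5, h5', h6, h7, h8, h9⟩ :=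
    exec_samplerTail_loop hω hn k id _ _ _ σ' o h2 h3 hk
  rw [movedCard_id] at h9
  refine ⟨j, τ, x, h0, h4, Exec.whileTrue (by simp [hout]) (h1 _ h5) h5', h6, h7,
    h8.trans ?_, by omega⟩
  simp only [State.tick_steps]; nlinarith

end SamplerRun

/-! ### The learning program: maximum likelihood by gradient ascent -/

section Learning

variable {n : ℕ}

/-- The truncation of `s` to `[-L, L]`. -/
noncomputable def clip (L s : ℝ) : ℝ := (√((s + L) * (s + L)) - √((s - L) * (s - L))) / 2

/-- The logistic function on `[-L, L]`, extended to the line with slope `1`. -/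
noncomputable def link (L s : ℝ) : ℝ := 1 / (1 + Real.exp (0 - clip L s)) + (s - clip L s)

/-- The contribution of the draw `t` to the gradient at `θ`. -/
noncomputable def score (L : ℝ) (θ : Fin n → ℝ) (t : Fin n × Fin n × Fin n) : ℝ :=
  1 - link L (θ t.2.2 - θ (loser t))

/-- The increment of the value of `x` along the draw `t`, as a functional of unit vectors. -/
def incidence (t : Fin n × Fin n × Fin n) (x : Fin n) : ℝ :=
  (if x = t.2.2 then 1 else 0) - (if x = loser t then 1 else 0)

/-- The gradient of the empirical log-likelihood of the first `m` draws. -/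
noncomputable def gradient (L : ℝ) (a : ℕ → Fin n × Fin n × Fin n) (m : ℕ) (θ : Fin n → ℝ)
    (x : Fin n) : ℝ :=
  ∑ i ∈ Finset.range m, score L θ (a i) * incidence (a i) x

/-- One step of gradient ascent. -/
noncomputable def ascend (L : ℝ) (a : ℕ → Fin n × Fin n × Fin n) (m : ℕ) (θ : Fin n → ℝ) :
    Fin n → ℝ :=
  fun x => θ x + gradient L a m θ x / (4 * m)

/-- The estimate of the log-weights from the first `m` draws. -/
noncomputable def logEstimate (L : ℝ) (a : ℕ → Fin n × Fin n × Fin n) (m : ℕ) : Fin n → ℝ :=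
  (ascend L a m)^[m] 0

/-- The distribution with log-weights `θ`. -/
noncomputable def softmax (θ : Fin n → ℝ) (x : Fin n) : ℝ := Real.exp (θ x) / ∑ y, Real.exp (θ y)

/-! ### The program -/

/-- Arrays of natural numbers: losers and winners of all draws, their number, the number of
gradient steps, and the index of a draw. -/
abbrev vLo : ℕ := 9
abbrev vWi : ℕ := 10
abbrev vT : ℕ := 11
abbrev vS : ℕ := 12
abbrev vR : ℕ := 13

/-- Arrays of reals: the gradient, the required number of draws, and an auxiliary scalar. -/
abbrev rG : ℕ := 5
abbrev rM : ℕ := 6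
abbrev rS : ℕ := 7

/-- The value of a real scalar variable. -/
abbrev rv (a : ℕ) : RExp := .get a (.lit 0)

abbrev rlit (k : ℕ) : RExp := .ofNat (.lit k)

/-- The expression `c n² log n log (4/δ) / λ`. -/
def targetExp (c : ℕ) : RExp :=
  .div (.mul (.mul (.mul (rlit c) (.mul (.ofNat (nv vN)) (.ofNat (nv vN))))
    (.log (.ofNat (nv vN)))) (.log (.div (rlit 4) (rv rDelta)))) (rv rLam)

def clipExp (e : RExp) : RExp :=
  .div (.sub (.sqrt (.mul (.add e (.log (rv rPhi))) (.add e (.log (rv rPhi)))))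
    (.sqrt (.mul (.sub e (.log (rv rPhi))) (.sub e (.log (rv rPhi)))))) (rlit 2)

def linkExp (e : RExp) : RExp :=
  .add (.div (rlit 1) (.add (rlit 1) (.exp (.sub (rlit 0) (clipExp e))))) (.sub e (clipExp e))

/-- Draw and store the samples. -/
def collect : Stmt :=
  .while (.ltR (.ofNat (nv vT)) (rv rM))
    (.seq (.sample vI vJ vW)
    (.seq (.setN vLo (nv vT) (.sub (.add (nv vI) (nv vJ)) (nv vW)))
    (.seq (.setN vWi (nv vT) (nv vW))
      (.setN vT (.lit 0) (.add (nv vT) (.lit 1))))))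

/-- Accumulate the gradient. -/
def gradientPass : Stmt :=
  .seq (forX (.setR rG (nv vX) (rlit 0)))
  (.seq (.setN vR (.lit 0) (.lit 0))
    (.while (.ltN (nv vR) (nv vT))
      (.seq (.setR rS (.lit 0) (.sub (rlit 1) (linkExp
        (.sub (.get rP (.get vWi (nv vR))) (.get rP (.get vLo (nv vR)))))))
      (.seq (.setR rG (.get vWi (nv vR)) (.add (.get rG (.get vWi (nv vR))) (rv rS)))
      (.seq (.setR rG (.get vLo (nv vR)) (.sub (.get rG (.get vLo (nv vR))) (rv rS)))
        (.setN vR (.lit 0) (.add (nv vR) (.lit 1))))))))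

/-- One step of gradient ascent. -/
def ascentStep : Stmt :=
  .seq gradientPass
    (forX (.setR rP (nv vX) (.add (.get rP (nv vX))
      (.div (.get rG (nv vX)) (.mul (rlit 4) (.ofNat (nv vT)))))))

/-- As many steps of gradient ascent as there are draws. -/
def ascent : Stmt :=
  .while (.ltN (nv vS) (nv vT)) (.seq ascentStep (.setN vS (.lit 0) (.add (nv vS) (.lit 1))))

/-- Exponentiate and normalize. -/
def normalize : Stmt :=
  .seq (.setR rS (.lit 0) (rlit 0))
  (.seq (forX (.setR rS (.lit 0) (.add (rv rS) (.exp (.get rP (nv vX))))))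
    (forX (.setR rP (nv vX) (.div (.exp (.get rP (nv vX))) (rv rS)))))

/-- Maximum likelihood estimation of the log-weights by gradient ascent. -/
def learner (c : ℕ) : Stmt :=
  .seq (.setR rM (.lit 0) (targetExp c)) (.seq collect (.seq ascent normalize))

/-- The number of draws of the learner. -/
noncomputable def learnDraws (c n : ℕ) (δ lam : ℝ) : ℕ :=
  ⌈c * ((n : ℝ) * n) * Real.log n * Real.log (4 / δ) / lam⌉₊

/-- The memory during gradient ascent. -/
structure LearnState (φ : ℝ) (a : ℕ → Fin n × Fin n × Fin n) (m : ℕ) (θ : Fin n → ℝ) (s B : ℕ)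
    (σ : State) : Prop where
  size : σ.nat vN 0 = n
  losers : ∀ i < m, σ.nat vLo i = loser (a i)
  winners : ∀ i < m, σ.nat vWi i = (a i).2.2
  count : σ.nat vT 0 = m
  turn : σ.nat vS 0 = s
  vec : ∀ x : Fin n, σ.real rP x = θ x
  phi : σ.real rPhi 0 = φ
  draws : σ.draws = m
  coins : σ.coins = 0
  steps : σ.steps ≤ B

/-- The program obtains the loser without a branch as i + j - w; truncation of the subtraction is
harmless because w is one of i and j. -/
theorem loser_val {t : Fin n × Fin n × Fin n} (h : ValidDraw t) :
    (t.1 : ℕ) + t.2.1 - t.2.2 = loser t := by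
  unfold loser
  rcases h.2 with h1 | h1
  · rw [if_pos h1, h1]; omega
  · rw [if_neg (fun h' => h.1 (h'.symm.trans h1)), h1]; omega

theorem loser_ne_winner {t : Fin n × Fin n × Fin n} (h : ValidDraw t) : loser t ≠ t.2.2 := by
  unfold loser
  rcases h.2 with h1 | h1
  · rw [if_pos h1, h1]; exact h.1.symm
  · rw [if_neg (fun h' => h.1 (h'.symm.trans h1)), h1]; exact h.1

theorem exec_collect {ω : Tape n} (hω : ∀ i, ValidDraw (ω.1 i)) {φ : ℝ} {B : ℕ} {σ : State}
    (h : LearnState φ ω.1 0 0 0 B σ) :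
    ∃ τ, Exec ω collect σ τ ∧ LearnState φ ω.1 ⌈σ.real rM 0⌉₊ 0 0 (B + (5 * ⌈σ.real rM 0⌉₊ + 1)) τ := by
  obtain ⟨τ, h1, h2⟩ := exec_while (ω := ω) (b := .ltR (.ofNat (nv vT)) (rv rM))
    (s := .seq (.sample vI vJ vW)
      (.seq (.setN vLo (nv vT) (.sub (.add (nv vI) (nv vJ)) (nv vW)))
      (.seq (.setN vWi (nv vT) (nv vW))
        (.setN vT (.lit 0) (.add (nv vT) (.lit 1))))))
    (fun i τ => LearnState φ ω.1 i 0 0 (B + 5 * i) τ ∧ τ.real rM 0 = σ.real rM 0)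
    ⌈σ.real rM 0⌉₊
    -- The loop compares the counter with a real bound; for an integer counter this is the
    -- comparison with the ceiling.
    (fun i τ hI _ => by
      simp only [BExp.holds, RExp.val, NExp.val, hI.1.count, hI.2]
      exact Nat.lt_ceil.symm)
    (fun i τ hI _ => by
      obtain ⟨hI, hM⟩ := hI
      have hl := loser_val (hω i)
      have hst := hI.steps
      refine ⟨_, Exec.seq (Exec.sample _ _ _ _) (Exec.seq (Exec.setN _ _ _ _)
        (Exec.seq (Exec.setN _ _ _ _) (Exec.setN _ _ _ _))), ?_, ?_⟩
      · refine ⟨by simp [hI.size], fun j hj => ?_, fun j hj => ?_, by simp [hI.count],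
          by simp [hI.turn], fun x => by simp [hI.vec], by simp [hI.phi], by simp [hI.draws],
          by simp [hI.coins], by simp; omega⟩
        · by_cases hji : j = i
          · simp [hI.count, hI.draws, hji, hl]
          · simp [hI.count, hji]; exact hI.losers j (by omega)
        · by_cases hji : j = i
          · simp [hI.count, hI.draws, hji]
          · simp [hI.count, hji]; exact hI.winners j (by omega)
      · simp [hM])
    (σ := σ) ⟨h, rfl⟩
  obtain ⟨h2, _⟩ := h2
  exact ⟨_, h1, h2.size, h2.losers, h2.winners, h2.count, h2.turn, h2.vec, h2.phi, h2.draws,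
    h2.coins, by have := h2.steps; simp; omega⟩

theorem linkExp_val (σ : State) (e : RExp) :
    (linkExp e).val σ = link (Real.log (σ.real rPhi 0)) (e.val σ) := by
  simp [linkExp, clipExp, link, clip]

theorem exec_gradientPass {ω : Tape n} {a : ℕ → Fin n × Fin n × Fin n}
    (ha : ∀ i, ValidDraw (a i)) {φ : ℝ} {m s B : ℕ} {θ : Fin n → ℝ} {σ : State}
    (h : LearnState φ a m θ s B σ) :
    ∃ τ, Exec ω gradientPass σ τ ∧ LearnState φ a m θ s (B + (3 * n + 5 * m + 4)) τ ∧
      ∀ x : Fin n, τ.real rG x = gradient (Real.log φ) a m θ x := by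
  obtain ⟨σ₁, h1, h2⟩ := exec_forX (ω := ω) (s := .setR rG (nv vX) (rlit 0))
    (fun i τ => τ.nat vX 0 = i ∧ LearnState φ a m θ s (B + (3 * i + 1)) τ ∧
      ∀ x : ℕ, x < i → τ.real rG x = 0)
    (fun i τ h => ⟨h.2.1.size, h.1⟩)
    (fun i τ hI hi => by
      obtain ⟨hX, hI, h0⟩ := hI
      have hst := hI.steps
      refine ⟨_, Exec.setR _ _ _ _, by simp [hX], ⟨by simp [hI.size], fun j hj => ?_,
        fun j hj => ?_, by simp [hI.count], by simp [hI.turn], fun x => by simp [hI.vec],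
        by simp [hI.phi], by simp [hI.draws], by simp [hI.coins], by simp; omega⟩, fun x hx => ?_⟩
      · simp [hI.losers j hj]
      · simp [hI.winners j hj]
      · by_cases hxi : x = i
        · simp [hX, hxi]
        · simp [hX, hxi]; exact h0 x (by omega))
    (σ := σ) (by
      have hst := h.steps
      exact ⟨by simp, ⟨by simp [h.size], fun j hj => by simp [h.losers j hj],
        fun j hj => by simp [h.winners j hj], by simp [h.count], by simp [h.turn],
        fun x => by simp [h.vec], by simp [h.phi], by simp [h.draws], by simp [h.coins],
        by simp; omega⟩, fun x hx => absurd hx (by omega)⟩)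
  obtain ⟨_, h2, h20⟩ := h2
  obtain ⟨τ, h3, h4⟩ := exec_while (ω := ω) (b := .ltN (nv vR) (nv vT))
    (s := .seq (.setR rS (.lit 0) (.sub (rlit 1) (linkExp
        (.sub (.get rP (.get vWi (nv vR))) (.get rP (.get vLo (nv vR)))))))
      (.seq (.setR rG (.get vWi (nv vR)) (.add (.get rG (.get vWi (nv vR))) (rv rS)))
      (.seq (.setR rG (.get vLo (nv vR)) (.sub (.get rG (.get vLo (nv vR))) (rv rS)))
        (.setN vR (.lit 0) (.add (nv vR) (.lit 1))))))
    (fun i τ => τ.nat vR 0 = i ∧ LearnState φ a m θ s (B + (3 * n + 1) + 2 + 5 * i) τ ∧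
      ∀ x : Fin n, τ.real rG x = gradient (Real.log φ) a i θ x) m
    (fun i τ hI _ => by simp [hI.1, hI.2.1.count])
    (fun i τ hI hi => by
      obtain ⟨hR, hI, hG⟩ := hI
      have hst := hI.steps
      have hw := hI.winners i hi
      have hl := hI.losers i hi
      have hne := loser_ne_winner (ha i)
      -- The winner's and the loser's cells differ, so the two consecutive writes to the gradient do
      -- not interfere.
      have hne' : ((a i).2.2 : ℕ) ≠ loser (a i) := fun h' => hne (Fin.ext h'.symm)
      have hsc : 1 - link (Real.log (τ.real rPhi 0))
          (τ.real rP ((a i).2.2 : ℕ) - τ.real rP (loser (a i) : ℕ)) =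
          score (Real.log φ) θ (a i) := by
        rw [hI.vec, hI.vec, hI.phi]; rfl
      refine ⟨_, Exec.seq (Exec.setR _ _ _ _) (Exec.seq (Exec.setR _ _ _ _)
        (Exec.seq (Exec.setR _ _ _ _) (Exec.setN _ _ _ _))), by simp [hR],
        ⟨by simp [hI.size], fun j hj => ?_, fun j hj => ?_, by simp [hI.count], by simp [hI.turn],
        fun x => by simp [hI.vec], by simp [hI.phi], by simp [hI.draws], by simp [hI.coins],
        by simp; omega⟩, fun x => ?_⟩
      · simp [hI.losers j hj]
      · simp [hI.winners j hj]
      · have hgs : gradient (Real.log φ) a (i + 1) θ x = gradient (Real.log φ) a i θ x +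
            score (Real.log φ) θ (a i) * incidence (a i) x := by
          rw [gradient, Finset.sum_range_succ]; rfl
        rw [hgs, ← hsc, ← hG x, incidence]
        by_cases h1 : x = (a i).2.2
        · have h2 : x ≠ loser (a i) := fun h' => hne (h'.symm.trans h1)
          subst h1
          simp [linkExp_val, hR, hw, hl, hne', h2]
        · have h1' : (x : ℕ) ≠ (a i).2.2 := fun h' => h1 (Fin.ext h')
          by_cases h2 : x = loser (a i)
          · subst h2
            simp [linkExp_val, hR, hw, hl, h1, h1']
            ring
          · have h2' : (x : ℕ) ≠ loser (a i) := fun h' => h2 (Fin.ext h')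
            simp [linkExp_val, hR, hw, hl, h1, h1', h2, h2'])
    (σ := (σ₁.tick.writeN vR 0 0).tick) (by
      have hst := h2.steps
      exact ⟨by simp, ⟨by simp [h2.size], fun j hj => by simp [h2.losers j hj],
        fun j hj => by simp [h2.winners j hj], by simp [h2.count], by simp [h2.turn],
        fun x => by simp [h2.vec], by simp [h2.phi], by simp [h2.draws], by simp [h2.coins],
        by simp; omega⟩, fun x => by simp [h20, gradient]⟩)
  obtain ⟨_, h4, h5⟩ := h4
  exact ⟨_, Exec.seq h1 (Exec.seq (Exec.setN _ _ _ _) h3), ⟨h4.size, h4.losers, h4.winners,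
    h4.count, h4.turn, h4.vec, h4.phi, h4.draws, h4.coins,
    by have := h4.steps; simp; omega⟩, h5⟩

/-- The whole gradient is stored before the vector is touched, so the coordinates can be overwritten
in place; the invariant holds new values below the counter and old ones above. -/
theorem exec_ascentStep {ω : Tape n} {a : ℕ → Fin n × Fin n × Fin n}
    (ha : ∀ i, ValidDraw (a i)) {φ : ℝ} {m s B : ℕ} {θ : Fin n → ℝ} {σ : State}
    (h : LearnState φ a m θ s B σ) :
    ∃ τ, Exec ω ascentStep σ τ ∧
      LearnState φ a m (ascend (Real.log φ) a m θ) s (B + (6 * n + 5 * m + 6)) τ := by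
  obtain ⟨σ₁, h1, h2, hg⟩ := exec_gradientPass (ω := ω) ha h
  obtain ⟨τ, h3, h4⟩ := exec_forX (ω := ω) (s := (.setR rP (nv vX) (.add (.get rP (nv vX))
      (.div (.get rG (nv vX)) (.mul (rlit 4) (.ofNat (nv vT)))))))
    (fun i τ => τ.nat vX 0 = i ∧ LearnState φ a m
      (fun x => if (x : ℕ) < i then ascend (Real.log φ) a m θ x else θ x) s
        (B + (3 * n + 5 * m + 4) + (3 * i + 1)) τ ∧
      ∀ x : Fin n, τ.real rG x = gradient (Real.log φ) a m θ x)
    (fun i τ h => ⟨h.2.1.size, h.1⟩)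
    (fun i τ hI hi => by
      obtain ⟨hX, hI, hg⟩ := hI
      have hst := hI.steps
      refine ⟨_, Exec.setR _ _ _ _, by simp [hX], ⟨by simp [hI.size], fun j hj => ?_,
        fun j hj => ?_, by simp [hI.count], by simp [hI.turn], fun x => ?_,
        by simp [hI.phi], by simp [hI.draws], by simp [hI.coins], by simp; omega⟩, fun x => ?_⟩
      · simp [hI.losers j hj]
      · simp [hI.winners j hj]
      · by_cases hxi : (x : ℕ) = i
        · have e1 : τ.real rP i = θ x := by
            rw [← hxi, hI.vec, if_neg (by omega)]
          have e2 : τ.real rG i = gradient (Real.log φ) a m θ x := by rw [← hxi, hg]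
          rw [if_pos (by omega)]
          simp [hX, hxi, hI.count, e1, e2, ascend]
        · have e1 : ((x : ℕ) < i + 1) ↔ (x : ℕ) < i := by omega
          simp only [e1]
          simpa [hX, hxi] using hI.vec x
      · simp [hg])
    (σ := σ₁) (by
      have hst := h2.steps
      exact ⟨by simp, ⟨by simp [h2.size], fun j hj => by simp [h2.losers j hj],
        fun j hj => by simp [h2.winners j hj], by simp [h2.count], by simp [h2.turn],
        fun x => by simp [h2.vec], by simp [h2.phi], by simp [h2.draws], by simp [h2.coins],
        by simp; omega⟩, fun x => by simp [hg]⟩)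
  obtain ⟨_, h4, _⟩ := h4
  exact ⟨_, Exec.seq h1 h3, h4.size, h4.losers, h4.winners,
    h4.count, h4.turn, fun x => (h4.vec x).trans (if_pos x.2), h4.phi, h4.draws, h4.coins,
    by have := h4.steps; simp; omega⟩

theorem exec_ascent {ω : Tape n} {a : ℕ → Fin n × Fin n × Fin n}
    (ha : ∀ i, ValidDraw (a i)) {φ : ℝ} {m B : ℕ} {σ : State}
    (h : LearnState φ a m 0 0 B σ) :
    ∃ τ, Exec ω ascent σ τ ∧
      LearnState φ a m (logEstimate (Real.log φ) a m) m (B + m * (6 * n + 5 * m + 8) + 1) τ := by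
  obtain ⟨τ, h1, h2⟩ := exec_while (ω := ω) (b := .ltN (nv vS) (nv vT))
    (s := .seq ascentStep (.setN vS (.lit 0) (.add (nv vS) (.lit 1))))
    (fun i τ => LearnState φ a m ((ascend (Real.log φ) a m)^[i] 0) i
      (B + i * (6 * n + 5 * m + 8)) τ) m
    (fun i τ hI _ => by simp [hI.turn, hI.count])
    (fun i τ hI _ => by
      have hst := hI.steps
      have hI' : LearnState φ a m ((ascend (Real.log φ) a m)^[i] 0) i
          (B + i * (6 * n + 5 * m + 8) + 1) τ.tick :=
        ⟨hI.size, hI.losers, hI.winners, hI.count, hI.turn, hI.vec, hI.phi, hI.draws, hI.coins,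
          Nat.succ_le_succ hst⟩
      obtain ⟨ρ, h1, h2⟩ := exec_ascentStep (ω := ω) ha hI'
      refine ⟨_, Exec.seq h1 (Exec.setN _ _ _ _), by simp [h2.size],
        fun j hj => by simp [h2.losers j hj], fun j hj => by simp [h2.winners j hj],
        by simp [h2.count], by simp [h2.turn], fun x => ?_, by simp [h2.phi], by simp [h2.draws],
        by simp [h2.coins], ?_⟩
      · rw [Function.iterate_succ_apply']; simp [h2.vec]
      · have := h2.steps
        simp only [State.tick_steps, State.writeN_steps]
        rw [add_mul]; omega)
    (σ := σ) (by simpa using h)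
  exact ⟨_, h1, h2.size, h2.losers, h2.winners, h2.count, h2.turn, h2.vec, h2.phi, h2.draws,
    h2.coins, by have := h2.steps; simp; omega⟩

theorem exec_normalize {ω : Tape n} {θ : Fin n → ℝ} {d B : ℕ} {σ : State}
    (hN : σ.nat vN 0 = n) (hv : ∀ x : Fin n, σ.real rP x = θ x) (hd : σ.draws = d)
    (hc : σ.coins = 0) (hB : σ.steps ≤ B) :
    ∃ τ, Exec ω normalize σ τ ∧ τ.nat vN 0 = n ∧ (∀ x : Fin n, τ.real rP x = softmax θ x) ∧
      τ.draws = d ∧ τ.coins = 0 ∧ τ.steps ≤ B + (6 * n + 5) := by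
  obtain ⟨σ₁, h1, h2⟩ := exec_forX (ω := ω)
    (s := .setR rS (.lit 0) (.add (rv rS) (.exp (.get rP (nv vX)))))
    (fun i τ => τ.nat vX 0 = i ∧ τ.nat vN 0 = n ∧ (∀ x : Fin n, τ.real rP x = θ x) ∧
      τ.real rS 0 = ∑ x : Fin n, (if (x : ℕ) < i then Real.exp (θ x) else 0) ∧ τ.draws = d ∧
      τ.coins = 0 ∧ τ.steps ≤ B + (3 * i + 2))
    (fun i τ h => ⟨h.2.1, h.1⟩)
    (fun i τ hI hi => by
      obtain ⟨h1, h2, h3, h4, h5, h6, h7⟩ := hI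
      refine ⟨_, Exec.setR _ _ _ _, by simp [h1], by simp [h2], fun x => by simp [h3], ?_,
        by simp [h5], by simp [h6], by simp; omega⟩
      have e1 : τ.real rP i = θ ⟨i, hi⟩ := h3 ⟨i, hi⟩
      have e2 : ∀ x : Fin n, (if (x : ℕ) < i + 1 then Real.exp (θ x) else 0) =
          (if (x : ℕ) < i then Real.exp (θ x) else 0) +
            (if x = ⟨i, hi⟩ then Real.exp (θ x) else 0) := by
        intro x
        by_cases hx : x = ⟨i, hi⟩
        · have : (x : ℕ) = i := by rw [hx]
          rw [if_pos (by omega), if_neg (by omega), if_pos hx, zero_add]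
        · have : (x : ℕ) ≠ i := fun h' => hx (Fin.ext h')
          rw [if_neg hx, add_zero]
          exact if_congr (by omega) rfl rfl
      simp only [e2, Finset.sum_add_distrib, Finset.sum_ite_eq', Finset.mem_univ, if_true]
      simp [h1, h4, e1])
    (σ := (σ.writeR rS 0 0).tick) (by
      refine ⟨by simp, by simp [hN], fun x => by simp [hv], by simp, by simp [hd], by simp [hc],
        by simp; omega⟩)
  obtain ⟨_, e2, e3, e4, e5, e6, e7⟩ := h2
  have hS : σ₁.real rS 0 = ∑ y, Real.exp (θ y) := by
    rw [e4]; exact Finset.sum_congr rfl fun x _ => if_pos x.2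
  obtain ⟨τ, h3, h4⟩ := exec_forX (ω := ω)
    (s := .setR rP (nv vX) (.div (.exp (.get rP (nv vX))) (rv rS)))
    (fun i τ => τ.nat vX 0 = i ∧ τ.nat vN 0 = n ∧
      (∀ x : Fin n, τ.real rP x = if (x : ℕ) < i then softmax θ x else θ x) ∧
      τ.real rS 0 = ∑ y, Real.exp (θ y) ∧ τ.draws = d ∧
      τ.coins = 0 ∧ τ.steps ≤ B + (3 * n + 2) + (3 * i + 2))
    (fun i τ h => ⟨h.2.1, h.1⟩)
    (fun i τ hI hi => by
      obtain ⟨h1, h2, h3, h4, h5, h6, h7⟩ := hI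
      refine ⟨_, Exec.setR _ _ _ _, by simp [h1], by simp [h2], fun x => ?_, by simp [h4],
        by simp [h5], by simp [h6], by simp; omega⟩
      by_cases hxi : (x : ℕ) = i
      · have e1 : τ.real rP i = θ x := by rw [← hxi, h3, if_neg (by omega)]
        rw [if_pos (by omega)]
        simp [h1, hxi, e1, h4, softmax]
      · have e1 : ((x : ℕ) < i + 1) ↔ (x : ℕ) < i := by omega
        simp only [e1]
        simpa [h1, hxi] using h3 x)
    (σ := σ₁.tick) (by
      exact ⟨by simp, by simp [e2], fun x => by simp [e3], by simp [hS], by simp [e5],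
        by simp [e6], by simp; omega⟩)
  obtain ⟨_, f2, f3, _, f5, f6, f7⟩ := h4
  refine ⟨_, Exec.seq (Exec.setR _ _ _ _) (Exec.seq (by simpa using h1) h3), f2,
    fun x => (f3 x).trans (if_pos x.2), f5, f6, by simp; omega⟩

/-- The learning phase computes the estimate from the first `learnDraws` draws. -/
theorem exec_learningPhase {ω : Tape n} (hω : ∀ i, ValidDraw (ω.1 i)) (c : ℕ) {δ lam φ : ℝ}
    {m : ℕ} (hm : m = learnDraws c n δ lam) :
    ∃ τ, Exec ω (learningPhase (learner c)) (initState n (algorithmInput δ lam φ)) τ ∧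
      τ.nat vN 0 = n ∧ (∀ x : Fin n, τ.real rP x = softmax (logEstimate (Real.log φ) ω.1 m) x) ∧
      τ.draws = m ∧ τ.coins = 0 ∧ τ.steps ≤ (m + 1) * (6 * n + 5 * m + 14) := by
  set σ₀ := initState n (algorithmInput δ lam φ) with hσ₀
  set σ₁ := (σ₀.writeR rEps 0 ((RExp.div (.ofNat (.lit 1)) (.sqrt (.ofNat (nv vN)))).val σ₀)).tick
    with hσ₁
  set σ₂ := (σ₁.writeR rM 0 ((targetExp c).val σ₁)).tick with hσ₂
  have hM : ⌈σ₂.real rM 0⌉₊ = m := by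
    rw [hm, learnDraws]
    congr 1
  -- Ascent starts at θ = 0 because unset cells of the initial memory are zero.
  have hS : LearnState φ ω.1 0 0 0 2 σ₂ := by
    refine ⟨by simp [hσ₂, hσ₁, hσ₀, initState], fun i hi => absurd hi (by omega),
      fun i hi => absurd hi (by omega), by simp [hσ₂, hσ₁, hσ₀, initState],
      by simp [hσ₂, hσ₁, hσ₀, initState], fun x => by simp [hσ₂, hσ₁, hσ₀, initState, algorithmInput],
      by simp [hσ₂, hσ₁, hσ₀, initState, algorithmInput], by simp [hσ₂, hσ₁, hσ₀, initState],
      by simp [hσ₂, hσ₁, hσ₀, initState], by simp [hσ₂, hσ₁, hσ₀, initState]⟩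
  obtain ⟨σ₃, h3, h4⟩ := exec_collect hω hS
  rw [hM] at h4
  obtain ⟨σ₄, h5, h6⟩ := exec_ascent (ω := ω) hω h4
  obtain ⟨σ₅, h7, h8, h9, h10, h11, h12⟩ := exec_normalize (ω := ω) h6.size h6.vec h6.draws
    h6.coins h6.steps
  exact ⟨σ₅, Exec.seq (Exec.setR _ _ _ _) (Exec.seq (Exec.setR _ _ _ _)
    (Exec.seq h3 (Exec.seq h5 h7))), h8, h9, h10, h11, h12.trans (by nlinarith)⟩

end Learning

/-! ### Monotonicity and Lipschitz bounds for the link function -/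

section Link

/-- Programs have square roots but no absolute value, hence the detour through √(t · t). -/
theorem clip_eq (L s : ℝ) : clip L s = (|s + L| - |s - L|) / 2 := by
  rw [clip, Real.sqrt_mul_self_eq_abs, Real.sqrt_mul_self_eq_abs]

theorem clip_of_abs_le {L s : ℝ} (h : |s| ≤ L) : clip L s = s := by
  rw [abs_le] at h
  rw [clip_eq, abs_of_nonneg (by linarith), abs_of_nonpos (by linarith)]; ring

theorem abs_clip_le {L : ℝ} (hL : 0 ≤ L) (s : ℝ) : |clip L s| ≤ L := by
  rw [clip_eq, abs_le]
  constructor <;> cases abs_cases (s + L) <;> cases abs_cases (s - L) <;> linarith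

theorem clip_mono {L s t : ℝ} (hL : 0 ≤ L) (h : s ≤ t) : clip L s ≤ clip L t := by
  rw [clip_eq, clip_eq]
  cases abs_cases (s + L) <;> cases abs_cases (s - L) <;> cases abs_cases (t + L) <;>
    cases abs_cases (t - L) <;> linarith

theorem clip_sub_le {L s t : ℝ} (hL : 0 ≤ L) (h : s ≤ t) : clip L t - clip L s ≤ t - s := by
  rw [clip_eq, clip_eq]
  cases abs_cases (s + L) <;> cases abs_cases (s - L) <;> cases abs_cases (t + L) <;>
    cases abs_cases (t - L) <;> linarith

theorem link_eq (L s : ℝ) : link L s = Real.sigmoid (clip L s) + (s - clip L s) := by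
  rw [link, Real.sigmoid_def, zero_sub, one_div]

/-- The minimal slope of the logistic function on `[-log φ, log φ]`. -/
noncomputable def minSlope (φ : ℝ) : ℝ := φ / (1 + φ) ^ 2

theorem minSlope_pos {φ : ℝ} (hφ : 1 < φ) : 0 < minSlope φ := by
  unfold minSlope; positivity

theorem minSlope_le {φ : ℝ} (hφ : 1 < φ) : minSlope φ ≤ 1 / 4 := by
  unfold minSlope
  rw [div_le_div_iff₀ (by positivity) (by norm_num)]
  nlinarith [sq_nonneg (φ - 1)]

/-- The derivative is σ(1 - σ). On the interval σ stays between 1/(1+φ) and φ/(1+φ), where this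
product is at least its value φ/(1+φ)² at the endpoints, and it never exceeds 1/4. -/
theorem sigmoid_sub_bounds {φ : ℝ} (hφ : 1 < φ) {x y : ℝ} (hx : |x| ≤ Real.log φ)
    (hy : |y| ≤ Real.log φ) (hxy : x ≤ y) :
    minSlope φ * (y - x) ≤ Real.sigmoid y - Real.sigmoid x ∧
      Real.sigmoid y - Real.sigmoid x ≤ 1 * (y - x) := by
  have hφ0 : 0 < φ := by linarith
  have hder : ∀ z, deriv Real.sigmoid z = Real.sigmoid z * (1 - Real.sigmoid z) := fun z =>
    by rw [Real.deriv_sigmoid]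
  have hcont : ContinuousOn Real.sigmoid (Set.Icc x y) := continuous_sigmoid.continuousOn
  have hdiff : DifferentiableOn ℝ Real.sigmoid (interior (Set.Icc x y)) :=
    differentiable_sigmoid.differentiableOn
  have hlow : Real.sigmoid (-Real.log φ) = 1 / (1 + φ) := by
    rw [Real.sigmoid_def, neg_neg, Real.exp_log hφ0, one_div]
  have hupp : Real.sigmoid (Real.log φ) = φ / (1 + φ) := by
    have := Real.sigmoid_neg (Real.log φ)
    rw [hlow] at this
    have h1 : (1 + φ) ≠ 0 := by positivity
    field_simp at this ⊢; linarith
  rw [abs_le] at hx hy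
  constructor
  · refine Convex.mul_sub_le_image_sub_of_le_deriv (convex_Icc x y) hcont hdiff
      (fun z hz => ?_) x ⟨le_rfl, hxy⟩ y ⟨hxy, le_rfl⟩ hxy
    rw [interior_Icc] at hz
    have h1 := Real.sigmoid_monotone (show -Real.log φ ≤ z by linarith [hz.1])
    have h2 := Real.sigmoid_monotone (show z ≤ Real.log φ by linarith [hz.2])
    rw [hlow] at h1; rw [hupp] at h2
    rw [hder]
    have h3 := mul_nonneg (sub_nonneg.2 h1) (sub_nonneg.2 h2)
    have h4 : (Real.sigmoid z - 1 / (1 + φ)) * (φ / (1 + φ) - Real.sigmoid z) =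
        Real.sigmoid z * (1 - Real.sigmoid z) - minSlope φ := by
      unfold minSlope
      have h1 : (1 + φ) ≠ 0 := by positivity
      field_simp; ring
    linarith
  · refine Convex.image_sub_le_mul_sub_of_deriv_le (convex_Icc x y) hcont hdiff
      (fun z _ => ?_) x ⟨le_rfl, hxy⟩ y ⟨hxy, le_rfl⟩ hxy
    rw [hder]
    nlinarith [sq_nonneg (Real.sigmoid z - 1 / 2)]

/-- An increment splits into the part inside the truncation interval, handled by the logistic
function, and the part outside, which has slope exactly 1. -/
theorem link_sub_bounds {φ : ℝ} (hφ : 1 < φ) {s t : ℝ} (h : s ≤ t) :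
    minSlope φ * (t - s) ≤ link (Real.log φ) t - link (Real.log φ) s ∧
      link (Real.log φ) t - link (Real.log φ) s ≤ t - s := by
  have hL : 0 ≤ Real.log φ := Real.log_nonneg hφ.le
  have h1 := sigmoid_sub_bounds hφ (abs_clip_le hL s) (abs_clip_le hL t) (clip_mono hL h)
  have h2 := clip_sub_le hL h
  have h3 := minSlope_le hφ
  rw [link_eq, link_eq]
  constructor <;> nlinarith [h1.1, h1.2]

/-- Strong monotonicity and cocoercivity on the whole line. They give descent and control of the
step length without any need to keep the iterates bounded. -/
theorem link_strong_mono {φ : ℝ} (hφ : 1 < φ) (s t : ℝ) :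
    minSlope φ * (s - t) ^ 2 ≤ (link (Real.log φ) s - link (Real.log φ) t) * (s - t) ∧
      (link (Real.log φ) s - link (Real.log φ) t) ^ 2 ≤
        (link (Real.log φ) s - link (Real.log φ) t) * (s - t) := by
  have hc := minSlope_pos hφ
  have key : ∀ {x y : ℝ}, x ≤ y →
      minSlope φ * (y - x) ^ 2 ≤ (link (Real.log φ) y - link (Real.log φ) x) * (y - x) ∧
        (link (Real.log φ) y - link (Real.log φ) x) ^ 2 ≤
          (link (Real.log φ) y - link (Real.log φ) x) * (y - x) := by
    intro x y h
    obtain ⟨h1, h2⟩ := link_sub_bounds hφ h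
    have hd : 0 ≤ y - x := sub_nonneg.2 h
    have h3 := mul_nonneg hc.le hd
    generalize link (Real.log φ) y - link (Real.log φ) x = d at *
    constructor
    · nlinarith [mul_nonneg (sub_nonneg.2 h1) hd]
    · nlinarith [mul_nonneg (h3.trans h1) (sub_nonneg.2 h2)]
  rcases le_total s t with h | h
  · obtain ⟨h1, h2⟩ := key h
    constructor <;> linarith
  · exact key h

end Link

/-! ### Convergence of gradient ascent under concentration -/

section Descent

variable {n : ℕ}

/-- The increment of `v` from the loser to the winner of a draw. -/
def inc (v : Fin n → ℝ) (t : Fin n × Fin n × Fin n) : ℝ := v t.2.2 - v (loser t)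

theorem sum_incidence (v : Fin n → ℝ) (t : Fin n × Fin n × Fin n) :
    ∑ x, incidence t x * v x = inc v t := by
  simp [incidence, inc, sub_mul, Finset.sum_sub_distrib]

/-- The average over the first `m` draws. -/
noncomputable def empMean (a : ℕ → Fin n × Fin n × Fin n) (m : ℕ)
    (f : Fin n × Fin n × Fin n → ℝ) : ℝ := (∑ i ∈ Finset.range m, f (a i)) / m

theorem sum_gradient (L : ℝ) (a : ℕ → Fin n × Fin n × Fin n) (m : ℕ) (θ v : Fin n → ℝ) :
    ∑ x, gradient L a m θ x / m * v x = empMean a m fun t => score L θ t * inc v t := by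
  rw [empMean, Finset.sum_div]
  simp only [gradient, Finset.sum_div, Finset.sum_mul]
  rw [Finset.sum_comm]
  refine Finset.sum_congr rfl fun i _ => ?_
  rw [← sum_incidence, Finset.mul_sum, Finset.sum_div]
  exact Finset.sum_congr rfl fun x _ => by ring

theorem empMean_mono {a : ℕ → Fin n × Fin n × Fin n} {m : ℕ}
    {f g : Fin n × Fin n × Fin n → ℝ} (h : ∀ i, f (a i) ≤ g (a i)) :
    empMean a m f ≤ empMean a m g :=
  div_le_div_of_nonneg_right (Finset.sum_le_sum fun i _ => h i) (Nat.cast_nonneg m)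

theorem empMean_const_mul (a : ℕ → Fin n × Fin n × Fin n) (m : ℕ) (c : ℝ)
    (f : Fin n × Fin n × Fin n → ℝ) : empMean a m (fun t => c * f t) = c * empMean a m f := by
  rw [empMean, empMean, ← Finset.mul_sum, mul_div_assoc]

theorem empMean_add (a : ℕ → Fin n × Fin n × Fin n) (m : ℕ)
    (f g : Fin n × Fin n × Fin n → ℝ) :
    empMean a m (fun t => f t + g t) = empMean a m f + empMean a m g := by
  rw [empMean, empMean, empMean, Finset.sum_add_distrib, add_div]

theorem empMean_sub (a : ℕ → Fin n × Fin n × Fin n) (m : ℕ)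
    (f g : Fin n × Fin n × Fin n → ℝ) :
    empMean a m (fun t => f t - g t) = empMean a m f - empMean a m g := by
  rw [empMean, empMean, empMean, Finset.sum_sub_distrib, sub_div]

theorem inc_sq_le {t : Fin n × Fin n × Fin n} (ht : ValidDraw t) (v : Fin n → ℝ) :
    inc v t ^ 2 ≤ 2 * ∑ x, v x ^ 2 := by
  have h3 : v (loser t) ^ 2 + v t.2.2 ^ 2 ≤ ∑ x, v x ^ 2 := by
    rw [← Finset.sum_pair (f := fun x => v x ^ 2) (loser_ne_winner ht)]
    exact Finset.sum_le_sum_of_subset_of_nonneg (Finset.subset_univ _) fun _ _ _ => sq_nonneg _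
  unfold inc
  nlinarith [sq_nonneg (v t.2.2 + v (loser t))]

/-- Each incidence vector sums to zero. The iterates thus stay in the hyperplane where the Poincaré
inequality controls the full Euclidean norm. -/
theorem sum_ascend (L : ℝ) (a : ℕ → Fin n × Fin n × Fin n) (m : ℕ) (θ : Fin n → ℝ) :
    ∑ x, ascend L a m θ x = ∑ x, θ x := by
  have h0 : ∑ x, gradient L a m θ x = 0 := by
    simp only [gradient]
    rw [Finset.sum_comm]
    refine Finset.sum_eq_zero fun i _ => ?_
    rw [← Finset.mul_sum]
    simp [incidence]
  simp only [ascend, Finset.sum_add_distrib, ← Finset.sum_div, h0, zero_div, add_zero]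

/-- One step of gradient ascent contracts the distance to `θ'`, up to the noise level `r`. -/
theorem ascend_contracts {φ : ℝ} (hφ : 1 < φ) {a : ℕ → Fin n × Fin n × Fin n}
    (ha : ∀ i, ValidDraw (a i)) {m : ℕ} (hm : 0 < m) {E : (Fin n → ℝ) → ℝ} {lam r : ℝ}
    {θ' : Fin n → ℝ} (hr : 0 ≤ r)
    (hE : ∀ v, E v ≤ 2 * ∑ x, v x ^ 2) (hE0 : ∀ v, 0 ≤ E v)
    (hpoin : ∀ v : Fin n → ℝ, ∑ x, v x = 0 → lam * ∑ x, v x ^ 2 ≤ E v)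
    (hquad : ∀ v, E v / 2 ≤ empMean a m fun t => inc v t ^ 2)
    (hnoise : ∀ v, (empMean a m fun t => score (Real.log φ) θ' t * inc v t) ^ 2 ≤ r * E v)
    {θ : Fin n → ℝ} (hsum : ∑ x, θ x = ∑ x, θ' x) :
    ∑ x, (ascend (Real.log φ) a m θ x - θ' x) ^ 2 ≤
      (1 - minSlope φ * lam / 16) * ∑ x, (θ x - θ' x) ^ 2 + (1 / minSlope φ + 1 / 4) * r := by
  set c := minSlope φ with hcdef
  have hc : 0 < c := minSlope_pos hφ
  set L := Real.log φ with hL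
  set Δ : Fin n → ℝ := fun x => θ x - θ' x with hΔ
  -- The averaged gradient at θ is Z - K: Z is the noise at the target θ', and K is the restoring
  -- force produced by the displacement Δ.
  set Z : Fin n → ℝ := fun x => gradient L a m θ' x / m with hZ
  set K : Fin n → ℝ := fun x => Z x - gradient L a m θ x / m with hK
  have hm0 : (m : ℝ) ≠ 0 := by positivity
  let k : Fin n × Fin n × Fin n → ℝ := fun t => score L θ' t - score L θ t
  have hk : ∀ t, c * inc Δ t ^ 2 ≤ k t * inc Δ t ∧ k t ^ 2 ≤ k t * inc Δ t := by
    intro t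
    have := link_strong_mono hφ (θ t.2.2 - θ (loser t)) (θ' t.2.2 - θ' (loser t))
    have e1 : k t = link L (θ t.2.2 - θ (loser t)) - link L (θ' t.2.2 - θ' (loser t)) := by
      simp only [k, score]; ring
    have e2 : inc Δ t = (θ t.2.2 - θ (loser t)) - (θ' t.2.2 - θ' (loser t)) := by
      simp only [inc, hΔ]; ring
    rw [e1, e2]; exact this
  have hZv : ∀ v, ∑ x, Z x * v x = empMean a m fun t => score L θ' t * inc v t :=
    fun v => sum_gradient L a m θ' v
  have hKv : ∀ v, ∑ x, K x * v x = empMean a m fun t => k t * inc v t := by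
    intro v
    have h1 := hZv v
    have h2 := sum_gradient L a m θ v
    simp only [hK, sub_mul, Finset.sum_sub_distrib, h1, h2, k]
    rw [empMean_sub]
  set A := empMean a m fun t => k t * inc Δ t with hA
  have hAE : c * E Δ / 2 ≤ A := by
    calc c * E Δ / 2 = c * (E Δ / 2) := by ring
      _ ≤ c * empMean a m fun t => inc Δ t ^ 2 := mul_le_mul_of_nonneg_left (hquad Δ) hc.le
      _ = empMean a m fun t => c * inc Δ t ^ 2 := (empMean_const_mul _ _ _ _).symm
      _ ≤ A := empMean_mono fun i => (hk _).1
  -- A self-bounding estimate. Cocoercivity and k · inc K ≤ k² + (inc K)²/4 give ∑K² ≤ A + ½∑K².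
  have hKsq : ∑ x, K x ^ 2 ≤ 2 * A := by
    have h1 : ∑ x, K x ^ 2 = empMean a m fun t => k t * inc K t := by
      rw [← hKv]; exact Finset.sum_congr rfl fun x _ => pow_two _
    have h2 : (empMean a m fun t => k t * inc K t) ≤
        empMean a m fun t => k t * inc Δ t + 1 / 2 * ∑ x, K x ^ 2 := by
      refine empMean_mono fun i => ?_
      have e1 := (hk (a i)).2
      have e2 := inc_sq_le (ha i) K
      nlinarith [sq_nonneg (k (a i) - inc K (a i) / 2)]
    rw [empMean_add] at h2
    have h3 : (empMean a m fun _ => 1 / 2 * ∑ x, K x ^ 2) = 1 / 2 * ∑ x, K x ^ 2 := by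
      rw [empMean]; simp; field_simp
    rw [h3, ← h1] at h2
    linarith
  -- The noise bound tested against v = Z itself.
  have hZsq : ∑ x, Z x ^ 2 ≤ 2 * r := by
    have h1 := hnoise Z
    rw [← hZv] at h1
    have h2 : ∑ x, Z x * Z x = ∑ x, Z x ^ 2 := Finset.sum_congr rfl fun x _ => (pow_two _).symm
    rw [h2] at h1
    have h3 := mul_le_mul_of_nonneg_left (hE Z) hr
    have h0 : 0 ≤ ∑ x, Z x ^ 2 := Finset.sum_nonneg fun x _ => sq_nonneg _
    by_contra hcon
    push Not at hcon
    nlinarith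
  -- Weighted arithmetic–geometric mean inequality; the weight 1/16 leaves enough of the descent
  -- term A ≥ cE/2 to absorb E.
  have hcross : (∑ x, Z x * Δ x) / 2 ≤ c * E Δ / 16 + r / c := by
    have h1 := hnoise Δ
    rw [← hZv] at h1
    have hy : 0 ≤ c * E Δ / 16 + r / c := by have := hE0 Δ; positivity
    refine abs_le_of_sq_le_sq' ?_ hy |>.2
    have : 4 * (c * E Δ / 16) * (r / c) = r * E Δ / 4 := by field_simp; ring
    nlinarith [sq_nonneg (c * E Δ / 16 - r / c)]
  -- The division by 4m in `ascend` is step size 1/4 for the averaged gradient. Of the -A/2 obtained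
  -- here, the quadratic term consumes at most A/4, and the remaining A/4 ≥ cE/8 beats the cE/16 of
  -- the cross term.
  have hexp : ∑ x, (ascend L a m θ x - θ' x) ^ 2 = ∑ x, Δ x ^ 2 +
      1 / 2 * (∑ x, Z x * Δ x - ∑ x, K x * Δ x) + 1 / 16 * ∑ x, (Z x - K x) ^ 2 := by
    rw [← Finset.sum_sub_distrib, Finset.mul_sum, Finset.mul_sum, ← Finset.sum_add_distrib,
      ← Finset.sum_add_distrib]
    refine Finset.sum_congr rfl fun x _ => ?_
    have : gradient L a m θ x / (4 * m) = (Z x - K x) / 4 := by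
      simp only [hK]; field_simp; ring
    rw [ascend, this]; simp only [hΔ]; ring
  have hZK : ∑ x, (Z x - K x) ^ 2 ≤ 2 * ∑ x, Z x ^ 2 + 2 * ∑ x, K x ^ 2 := by
    rw [Finset.mul_sum, Finset.mul_sum, ← Finset.sum_add_distrib]
    exact Finset.sum_le_sum fun x _ => by nlinarith [sq_nonneg (Z x + K x)]
  have hKA : ∑ x, K x * Δ x = A := hKv Δ
  have hp := hpoin Δ (by simp only [hΔ, Finset.sum_sub_distrib, hsum, sub_self])
  have hp' := mul_le_mul_of_nonneg_left hp (show 0 ≤ c / 16 by positivity)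
  rw [hexp, hKA]
  have : (1 / c + 1 / 4) * r = r / c + r / 4 := by ring
  rw [this]
  nlinarith

/-- Gradient ascent converges to the noise level. -/
theorem iterate_ascend_le {φ : ℝ} (hφ : 1 < φ) {a : ℕ → Fin n × Fin n × Fin n}
    (ha : ∀ i, ValidDraw (a i)) {m : ℕ} (hm : 0 < m) {E : (Fin n → ℝ) → ℝ} {lam r : ℝ}
    {θ' : Fin n → ℝ} (hr : 0 ≤ r) (hlam : 0 < lam) (hlam2 : lam ≤ 2)
    (hE : ∀ v, E v ≤ 2 * ∑ x, v x ^ 2) (hE0 : ∀ v, 0 ≤ E v)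
    (hpoin : ∀ v : Fin n → ℝ, ∑ x, v x = 0 → lam * ∑ x, v x ^ 2 ≤ E v)
    (hquad : ∀ v, E v / 2 ≤ empMean a m fun t => inc v t ^ 2)
    (hnoise : ∀ v, (empMean a m fun t => score (Real.log φ) θ' t * inc v t) ^ 2 ≤ r * E v)
    (hsum : ∑ x, θ' x = 0) (k : ℕ) :
    ∑ x, ((ascend (Real.log φ) a m)^[k] 0 x - θ' x) ^ 2 ≤
      Real.exp (-(minSlope φ * lam / 16 * k)) * ∑ x, θ' x ^ 2 +
        20 * r / (minSlope φ ^ 2 * lam) := by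
  set c := minSlope φ with hcdef
  have hc : 0 < c := minSlope_pos hφ
  have hc4 : c ≤ 1 / 4 := minSlope_le hφ
  have hs : ∀ k, ∑ x, (ascend (Real.log φ) a m)^[k] 0 x = ∑ x, θ' x := by
    intro k
    induction k with
    | zero => simp [hsum]
    | succ k ih => rw [Function.iterate_succ_apply', sum_ascend, ih]
  induction k with
  | zero =>
    have : 0 ≤ 20 * r / (c ^ 2 * lam) := by positivity
    simpa using this
  | succ k ih =>
    rw [Function.iterate_succ_apply']
    have hq0 : 0 ≤ 1 - c * lam / 16 := by nlinarith
    refine (ascend_contracts hφ ha hm hr hE hE0 hpoin hquad hnoise (hs k)).trans ?_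
    refine (add_le_add (mul_le_mul_of_nonneg_left ih hq0) le_rfl).trans ?_
    have h1 : (1 - c * lam / 16) * Real.exp (-(c * lam / 16 * k)) ≤
        Real.exp (-(c * lam / 16 * (k + 1 : ℕ))) := by
      rw [show -(c * lam / 16 * ((k + 1 : ℕ) : ℝ)) = -(c * lam / 16) + -(c * lam / 16 * k) by
        push_cast; ring, Real.exp_add]
      exact mul_le_mul_of_nonneg_right (by linarith [Real.add_one_le_exp (-(c * lam / 16))])
        (Real.exp_pos _).le
    have h2 : (1 / c + 1 / 4) * r ≤ 5 / 4 * r / c := by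
      rw [show 5 / 4 * r / c = (5 / 4 / c) * r by ring]
      refine mul_le_mul_of_nonneg_right ?_ hr
      rw [div_add' _ _ _ hc.ne']
      exact div_le_div_of_nonneg_right (by linarith) hc.le
    -- The additive constant in the claim is the fixed point of the recursion x ↦ (1 - cλ/16)x +
    -- (5/4)r/c.
    have h3 : c * lam / 16 * (20 * r / (c ^ 2 * lam)) = 5 / 4 * r / c := by
      field_simp; ring
    have h4 := mul_le_mul_of_nonneg_right h1
      (Finset.sum_nonneg fun x _ => sq_nonneg (θ' x) : 0 ≤ ∑ x, θ' x ^ 2)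
    nlinarith

end Descent

/-! ### Bernstein bounds for empirical covariances and noise -/

section Concentration

open MeasureTheory

theorem lintegral_prod_range {α : Type*} [MeasurableSpace α] (ν : Measure α)
    [IsProbabilityMeasure ν] {g : α → ENNReal} (hg : Measurable g) (m : ℕ) :
    ∫⁻ a, ∏ i ∈ Finset.range m, g (a i) ∂(Measure.infinitePi fun _ : ℕ => ν) =
      (∫⁻ t, g t ∂ν) ^ m := by
  induction m with
  | zero => simp
  | succ m ih =>
    have h1 : Measurable fun b : ℕ → α => ∏ i ∈ Finset.range m, g (b i) := by fun_prop
    have h2 := lintegral_head ν (f := fun t b => (∏ i ∈ Finset.range m, g (b i)) * g t)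
      ((h1.comp measurable_snd).mul (hg.comp measurable_fst))
    simp only [add_comm 1] at h2
    simp only [Finset.prod_range_succ']
    rw [h2]
    simp only [lintegral_mul_const _ h1, ih]
    rw [lintegral_const_mul _ hg, pow_succ]

theorem exp_le_one_add_add_sq {y : ℝ} (hy : |y| ≤ 1) : Real.exp y ≤ 1 + y + y ^ 2 := by
  have := (abs_le.1 (Real.abs_exp_sub_one_sub_id_le hy)).2
  linarith

variable {n : ℕ} {Q : PMF (Sym2 (Fin n))} {D : PMF (Fin n)}

/-- Bernstein's inequality for the draws, upper tail. -/
theorem measure_sum_draws_ge_le (hQ : IsPairDistribution Q) (hD : ∀ x, 0 < (D x).toReal)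
    {f : Fin n → Fin n → ℝ} {V K s : ℝ}
    (hmean : ∑ x, ∑ w, drawWeight Q D x w * f x w = 0)
    (hvar : ∑ x, ∑ w, drawWeight Q D x w * f x w ^ 2 ≤ V)
    (hK : ∀ x w, drawWeight Q D x w ≠ 0 → |f x w| ≤ K) (hs : 0 ≤ s) (hsK : s * K ≤ 1)
    (τ : ℝ) (m : ℕ) :
    (Measure.infinitePi fun _ : ℕ => (samp Q D).toMeasure)
      {a | m * τ ≤ ∑ i ∈ Finset.range m, f (loser (a i)) (a i).2.2} ≤
        ENNReal.ofReal (Real.exp (-(m * (s * τ - s ^ 2 * V)))) := by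
  set P := Measure.infinitePi fun _ : ℕ => (samp Q D).toMeasure
  let g : Fin n × Fin n × Fin n → ENNReal := fun t =>
    ENNReal.ofReal (Real.exp (s * f (loser t) t.2.2))
  have hg : Measurable g := measurable_of_finite g
  -- Since s|f| ≤ 1 wherever the weight is nonzero, exp(y) ≤ 1 + y + y² applies, and the linear term
  -- has mean zero.
  have hmgf : ∫⁻ t, g t ∂(samp Q D).toMeasure ≤ ENNReal.ofReal (Real.exp (s ^ 2 * V)) := by
    have h1 := lintegral_samp_eq hQ hD fun x w => ENNReal.ofReal (Real.exp (s * f x w))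
    have h2 : ∑ x, ∑ w, ENNReal.ofReal (drawWeight Q D x w) *
        ENNReal.ofReal (Real.exp (s * f x w)) =
        ENNReal.ofReal (∑ x, ∑ w, drawWeight Q D x w * Real.exp (s * f x w)) := by
      have h0 : ∀ x w, 0 ≤ drawWeight Q D x w * Real.exp (s * f x w) := fun x w =>
        mul_nonneg (drawWeight_nonneg _ _ _ _) (Real.exp_pos _).le
      rw [ENNReal.ofReal_sum_of_nonneg fun x _ => Finset.sum_nonneg fun w _ => h0 x w]
      refine Finset.sum_congr rfl fun x _ => ?_
      rw [ENNReal.ofReal_sum_of_nonneg fun w _ => h0 x w]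
      exact Finset.sum_congr rfl fun w _ => (ENNReal.ofReal_mul (drawWeight_nonneg _ _ _ _)).symm
    rw [h1.trans h2]
    refine ENNReal.ofReal_le_ofReal ?_
    calc ∑ x, ∑ w, drawWeight Q D x w * Real.exp (s * f x w)
        ≤ ∑ x, ∑ w, (drawWeight Q D x w + s * (drawWeight Q D x w * f x w) +
            s ^ 2 * (drawWeight Q D x w * f x w ^ 2)) := by
          refine Finset.sum_le_sum fun x _ => Finset.sum_le_sum fun w _ => ?_
          by_cases h0 : drawWeight Q D x w = 0
          · simp [h0]
          · have hle : |s * f x w| ≤ 1 := by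
              rw [abs_mul, abs_of_nonneg hs]
              exact (mul_le_mul_of_nonneg_left (hK x w h0) hs).trans hsK
            have := mul_le_mul_of_nonneg_left (exp_le_one_add_add_sq hle)
              (drawWeight_nonneg Q D x w)
            linarith
      _ = 1 + s ^ 2 * ∑ x, ∑ w, drawWeight Q D x w * f x w ^ 2 := by
          simp only [Finset.sum_add_distrib, ← Finset.mul_sum, hmean, sum_drawWeight hQ hD]
          ring
      _ ≤ s ^ 2 * V + 1 := by nlinarith [sq_nonneg s]
      _ ≤ Real.exp (s ^ 2 * V) := Real.add_one_le_exp _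
  have hmark := mul_meas_ge_le_lintegral₀ (μ := P)
    (f := fun a => ∏ i ∈ Finset.range m, g (a i))
    (by fun_prop : Measurable fun a : ℕ → Fin n × Fin n × Fin n =>
      ∏ i ∈ Finset.range m, g (a i)).aemeasurable (ENNReal.ofReal (Real.exp (s * (m * τ))))
  rw [lintegral_prod_range _ hg] at hmark
  have hsub : {a : ℕ → Fin n × Fin n × Fin n |
      m * τ ≤ ∑ i ∈ Finset.range m, f (loser (a i)) (a i).2.2} ⊆
      {a | ENNReal.ofReal (Real.exp (s * (m * τ))) ≤ ∏ i ∈ Finset.range m, g (a i)} := by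
    intro a ha
    simp only [Set.mem_ofPred_eq, g] at ha ⊢
    rw [← ENNReal.ofReal_prod_of_nonneg fun i _ => (Real.exp_pos _).le, ← Real.exp_sum,
      ← Finset.mul_sum]
    exact ENNReal.ofReal_le_ofReal (Real.exp_le_exp.2 (mul_le_mul_of_nonneg_left ha hs))
  have h1 := (mul_le_mul_right (measure_mono hsub) _).trans
    (hmark.trans (pow_le_pow_left' hmgf m))
  rw [← ENNReal.ofReal_pow (Real.exp_pos _).le, ← Real.exp_nat_mul] at h1
  have h2 : ENNReal.ofReal (Real.exp (m * (s ^ 2 * V))) =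
      ENNReal.ofReal (Real.exp (s * (m * τ))) *
        ENNReal.ofReal (Real.exp (-(m * (s * τ - s ^ 2 * V)))) := by
    rw [← ENNReal.ofReal_mul (Real.exp_pos _).le, ← Real.exp_add]
    congr 2; ring
  rw [h2] at h1
  exact (ENNReal.mul_le_mul_iff_right (by simp [Real.exp_pos]) ENNReal.ofReal_ne_top).1 h1

/-- Bernstein's inequality for the draws. -/
theorem measure_abs_empMean_ge_le (hQ : IsPairDistribution Q) (hD : ∀ x, 0 < (D x).toReal)
    {f : Fin n → Fin n → ℝ} {V K s : ℝ}
    (hmean : ∑ x, ∑ w, drawWeight Q D x w * f x w = 0)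
    (hvar : ∑ x, ∑ w, drawWeight Q D x w * f x w ^ 2 ≤ V)
    (hK : ∀ x w, drawWeight Q D x w ≠ 0 → |f x w| ≤ K) (hs : 0 ≤ s) (hsK : s * K ≤ 1)
    (τ : ℝ) {m : ℕ} (hm : 0 < m) :
    (Measure.infinitePi fun _ : ℕ => (samp Q D).toMeasure)
      {a | ¬ |empMean a m fun t => f (loser t) t.2.2| ≤ τ} ≤
        ENNReal.ofReal (2 * Real.exp (-(m * (s * τ - s ^ 2 * V)))) := by
  have h1 := measure_sum_draws_ge_le hQ hD hmean hvar hK hs hsK τ m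
  have h2 := measure_sum_draws_ge_le hQ hD (f := fun x w => -f x w) (V := V) (K := K) (s := s)
    (by simp [hmean]) (by simpa using hvar) (fun x w h => by rw [abs_neg]; exact hK x w h)
    hs hsK τ m
  rw [two_mul, ENNReal.ofReal_add (Real.exp_pos _).le (Real.exp_pos _).le]
  refine le_trans (measure_mono fun a ha => ?_) ((measure_union_le _ _).trans (add_le_add h1 h2))
  have hm' : (0 : ℝ) < m := Nat.cast_pos.2 hm
  simp only [Set.mem_ofPred_eq, not_le, empMean, lt_abs] at ha
  rcases ha with ha | ha
  · left
    rw [lt_div_iff₀ hm'] at ha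
    simp only [Set.mem_ofPred_eq]
    linarith
  · right
    rw [← neg_div, lt_div_iff₀ hm'] at ha
    simp only [Set.mem_ofPred_eq, Finset.sum_neg_distrib]
    linarith

/-! ### The two events -/

/-- The products are bounded by 2/λ, and their second moment is also at most 2/λ since `u` has
energy at most 1. This gain over (2/λ)² makes the exponent linear in λ. With s = λ/(8n) and τ =
1/(2n) one gets sτ - s²V = λ/(32n²). -/
theorem measure_covariance (hn : 2 ≤ n) (hQ : IsPairDistribution Q)
    (hD : ∀ x, 0 < (D x).toReal) {lam : ℝ} (hlam : 0 < lam) {u v : Fin n → ℝ}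
    (hu : edgeForm Q u u ≤ 1)
    (hu2 : ∀ x y, (u x - u y) ^ 2 ≤ 2 / lam) (hv2 : ∀ x y, (v x - v y) ^ 2 ≤ 2 / lam)
    {m : ℕ} (hm : 0 < m) :
    (Measure.infinitePi fun _ : ℕ => (samp Q D).toMeasure)
      {a | ¬ |(empMean a m fun t => inc u t * inc v t) - edgeForm Q u v| ≤ 1 / (2 * n)} ≤
        ENNReal.ofReal (2 * Real.exp (-(m * lam / (32 * n ^ 2)))) := by
  have hn0 : (0 : ℝ) < n := by exact_mod_cast (by omega : 0 < n)
  have hn1 : (1 : ℝ) ≤ n := by exact_mod_cast (by omega : 1 ≤ n)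
  set e := edgeForm Q u v with he
  let g : Fin n → Fin n → ℝ := fun x w => (u x - u w) * (v x - v w)
  have hgabs : ∀ x w, |g x w| ≤ 2 / lam := fun x w => by
    have h1 := hu2 x w
    have h2 := hv2 x w
    simp only [g]
    rw [abs_le]
    constructor <;> nlinarith [sq_nonneg ((u x - u w) + (v x - v w)),
      sq_nonneg ((u x - u w) - (v x - v w))]
  have hmean : ∑ x, ∑ w, drawWeight Q D x w * g x w = e := sum_drawWeight_mul hD u v
  have heabs : |e| ≤ 2 / lam := by
    rw [← hmean]
    calc |∑ x, ∑ w, drawWeight Q D x w * g x w|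
        ≤ ∑ x, ∑ w, drawWeight Q D x w * (2 / lam) := by
          refine (Finset.abs_sum_le_sum_abs _ _).trans (Finset.sum_le_sum fun x _ => ?_)
          refine (Finset.abs_sum_le_sum_abs _ _).trans (Finset.sum_le_sum fun w _ => ?_)
          rw [abs_mul, abs_of_nonneg (drawWeight_nonneg _ _ _ _)]
          exact mul_le_mul_of_nonneg_left (hgabs x w) (drawWeight_nonneg _ _ _ _)
      _ = 2 / lam := by simp only [← Finset.sum_mul, sum_drawWeight hQ hD, one_mul]
  have hsq : ∑ x, ∑ w, drawWeight Q D x w * g x w ^ 2 ≤ 2 / lam := by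
    calc ∑ x, ∑ w, drawWeight Q D x w * g x w ^ 2
        ≤ ∑ x, ∑ w, (2 / lam) * (drawWeight Q D x w * ((u x - u w) * (u x - u w))) := by
          refine Finset.sum_le_sum fun x _ => Finset.sum_le_sum fun w _ => ?_
          have h1 := mul_le_mul_of_nonneg_left (hv2 x w)
            (mul_nonneg (drawWeight_nonneg Q D x w) (sq_nonneg (u x - u w)))
          simp only [g]
          nlinarith
      _ = (2 / lam) * edgeForm Q u u := by
          simp only [← Finset.mul_sum, sum_drawWeight_mul hD]
      _ ≤ 2 / lam := mul_le_of_le_one_right (by positivity) hu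
  have hvar : ∑ x, ∑ w, drawWeight Q D x w * (g x w - e) ^ 2 ≤ 2 / lam := by
    have : ∑ x, ∑ w, drawWeight Q D x w * (g x w - e) ^ 2 =
        ∑ x, ∑ w, (drawWeight Q D x w * g x w ^ 2 - 2 * e * (drawWeight Q D x w * g x w) +
          e ^ 2 * drawWeight Q D x w) :=
      Finset.sum_congr rfl fun x _ => Finset.sum_congr rfl fun w _ => by ring
    rw [this]
    simp only [Finset.sum_add_distrib, Finset.sum_sub_distrib, ← Finset.mul_sum, hmean,
      sum_drawWeight hQ hD]
    nlinarith [sq_nonneg e]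
  have h := measure_abs_empMean_ge_le hQ hD (f := fun x w => g x w - e) (V := 2 / lam)
    (K := 4 / lam) (s := lam / (8 * n))
    (by simp only [mul_sub, Finset.sum_sub_distrib, hmean, ← Finset.sum_mul,
          sum_drawWeight hQ hD]; ring) hvar
    (fun x w _ => (abs_sub _ _).trans (by
      have := add_le_add (hgabs x w) heabs
      calc _ ≤ _ := this
        _ = 4 / lam := by ring)) (by positivity)
    (by
      rw [show lam / (8 * (n : ℝ)) * (4 / lam) = 1 / (2 * n) by field_simp; norm_num,
        div_le_one (by positivity)]
      linarith) (1 / (2 * n)) hm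
  rw [show lam / (8 * (n : ℝ)) * (1 / (2 * n)) - (lam / (8 * n)) ^ 2 * (2 / lam) =
    lam / (32 * n ^ 2) by field_simp; norm_num, ← mul_div_assoc] at h
  refine le_trans (measure_mono fun a ha => ?_) h
  have hm' : (m : ℝ) ≠ 0 := by positivity
  have h1 : (empMean a m fun t => g (loser t) t.2.2 - e) =
      (empMean a m fun t => inc u t * inc v t) - e := by
    rw [empMean_sub]
    congr 1
    · congr 1; funext t; simp only [g, inc]; ring
    · simp [empMean]; field_simp
  simp only [Set.mem_ofPred_eq] at ha ⊢
  rw [h1]; exact ha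

/-- The log-weights of `D`, normalized to have sum `0`. -/
noncomputable def logWeights (D : PMF (Fin n)) (x : Fin n) : ℝ :=
  Real.log (D x).toReal - (∑ y, Real.log (D y).toReal) / n

theorem logWeights_sub (D : PMF (Fin n)) (x y : Fin n) :
    logWeights D x - logWeights D y = Real.log (D x).toReal - Real.log (D y).toReal := by
  simp [logWeights]

theorem sum_logWeights (hn : n ≠ 0) (D : PMF (Fin n)) : ∑ x, logWeights D x = 0 := by
  have : (n : ℝ) ≠ 0 := Nat.cast_ne_zero.2 hn
  simp only [logWeights, Finset.sum_sub_distrib, Finset.sum_const, Finset.card_univ,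
    Fintype.card_fin, nsmul_eq_mul]
  field_simp; ring

theorem abs_log_sub_le {φ : ℝ} (hφ : 1 < φ) (hD : ∀ x, 0 < (D x).toReal)
    (hB : BoundedRatios D Q φ) {x y : Fin n} (h : s(x, y) ∈ Q.support) :
    |Real.log (D x).toReal - Real.log (D y).toReal| ≤ Real.log φ := by
  have h1 := Real.log_le_log (hD x) (hB x y h)
  have h2 := Real.log_le_log (hD y) (hB y x (Sym2.eq_swap ▸ h))
  rw [Real.log_mul (by positivity) (hD _).ne'] at h1 h2
  rw [abs_le]; constructor <;> linarith

theorem mem_support_of_drawWeight_ne_zero {x w : Fin n} (h : drawWeight Q D x w ≠ 0) :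
    s(x, w) ∈ Q.support := by
  rw [PMF.mem_support_iff]
  intro h0
  exact h (by simp [drawWeight, h0])

/-- On an edge of the support the truncation is inactive, so at the true parameter the score is the
model probability of the opposite outcome. -/
theorem score_logWeights {φ : ℝ} (hφ : 1 < φ) (hD : ∀ x, 0 < (D x).toReal)
    (hB : BoundedRatios D Q φ) {x w : Fin n} (h : s(x, w) ∈ Q.support) :
    1 - link (Real.log φ) (logWeights D w - logWeights D x) =
      (D x).toReal / ((D x).toReal + (D w).toReal) := by
  have h0 := hD x
  have h1 := hD w
  have h' : s(w, x) ∈ Q.support := Sym2.eq_swap ▸ h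
  rw [link_eq, clip_of_abs_le (by rw [logWeights_sub]; exact abs_log_sub_le hφ hD hB h'), logWeights_sub, Real.sigmoid_def, neg_sub, Real.exp_sub,
    Real.exp_log h0, Real.exp_log h1]
  field_simp
  ring

/-- The weight of a draw times its score is symmetric in loser and winner while the increment is
antisymmetric, so the mean vanishes; the variance is at most the energy of `v`. Bernstein is used
with s = τ/2, and τ² ≤ λ keeps s times the range below 1. -/
theorem measure_noise {φ : ℝ} (hφ : 1 < φ) (hQ : IsPairDistribution Q)
    (hD : ∀ x, 0 < (D x).toReal) (hB : BoundedRatios D Q φ) {lam : ℝ} (hlam : 0 < lam)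
    {v : Fin n → ℝ} (hv : edgeForm Q v v ≤ 1) (hv2 : ∀ x y, (v x - v y) ^ 2 ≤ 2 / lam)
    {τ : ℝ} (hτ : 0 ≤ τ) (hτ2 : τ ^ 2 ≤ lam) {m : ℕ} (hm : 0 < m) :
    (Measure.infinitePi fun _ : ℕ => (samp Q D).toMeasure)
      {a | ¬ |empMean a m fun t => score (Real.log φ) (logWeights D) t * inc v t| ≤ τ} ≤
        ENNReal.ofReal (2 * Real.exp (-(m * τ ^ 2 / 4))) := by
  let f : Fin n → Fin n → ℝ := fun x w =>
    (1 - link (Real.log φ) (logWeights D w - logWeights D x)) * (v w - v x)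
  have hf : ∀ x w, drawWeight Q D x w ≠ 0 →
      f x w = (D x).toReal / ((D x).toReal + (D w).toReal) * (v w - v x) := fun x w h => by
    simp only [f, score_logWeights hφ hD hB (mem_support_of_drawWeight_ne_zero h)]
  have hfsq : ∀ x w, drawWeight Q D x w ≠ 0 → f x w ^ 2 ≤ (v x - v w) ^ 2 := fun x w h => by
    have h0 := hD x
    have h1 := hD w
    rw [hf x w h, mul_pow, show (v x - v w) ^ 2 = 1 * (v w - v x) ^ 2 by ring]
    refine mul_le_mul_of_nonneg_right (pow_le_one₀ (by positivity) ?_) (sq_nonneg _)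
    rw [div_le_one (by positivity)]; linarith
  have hmean : ∑ x, ∑ w, drawWeight Q D x w * f x w = 0 := by
    have h1 : ∀ x w, drawWeight Q D x w * f x w = -(drawWeight Q D w x * f w x) := by
      intro x w
      have h0 := hD x
      have h1 := hD w
      have e : ∀ x w, drawWeight Q D x w * f x w =
          drawWeight Q D x w * ((D x).toReal / ((D x).toReal + (D w).toReal) * (v w - v x)) := by
        intro x w
        by_cases h : drawWeight Q D x w = 0
        · simp [h]
        · rw [hf x w h]
      rw [e, e]
      unfold drawWeight
      rw [Sym2.eq_swap (a := w), add_comm (D w).toReal]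
      ring
    have h2 : ∑ x, ∑ w, drawWeight Q D x w * f x w = -∑ x, ∑ w, drawWeight Q D x w * f x w := by
      conv_rhs => rw [Finset.sum_comm]
      simp only [← Finset.sum_neg_distrib]
      exact Finset.sum_congr rfl fun x _ => Finset.sum_congr rfl fun w _ => h1 x w
    linarith
  have hvar : ∑ x, ∑ w, drawWeight Q D x w * f x w ^ 2 ≤ 1 := by
    refine le_trans (Finset.sum_le_sum fun x _ => Finset.sum_le_sum fun w _ => ?_)
      ((sum_drawWeight_mul hD v v).le.trans hv)
    by_cases h : drawWeight Q D x w = 0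
    · simp [h]
    · rw [← pow_two]
      exact mul_le_mul_of_nonneg_left (hfsq x w h) (drawWeight_nonneg _ _ _ _)
  have h := measure_abs_empMean_ge_le hQ hD (f := f) (V := 1) (K := √(2 / lam)) (s := τ / 2)
    hmean hvar (fun x w h => Real.abs_le_sqrt ((hfsq x w h).trans (hv2 x w))) (by positivity)
    (by
      have h1 : τ ≤ √lam := Real.le_sqrt_of_sq_le hτ2
      calc τ / 2 * √(2 / lam) ≤ √lam / 2 * √(2 / lam) := by gcongr
        _ = √lam * √(2 / lam) / 2 := by ring
        _ = √2 / 2 := by rw [← Real.sqrt_mul hlam.le, mul_div_cancel₀ _ hlam.ne']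
        _ ≤ 1 := by
            have := Real.sqrt_two_lt_three_halves
            linarith) τ hm
  rw [show (m : ℝ) * (τ / 2 * τ - (τ / 2) ^ 2 * 1) = m * τ ^ 2 / 4 by ring] at h
  exact h

theorem edgeForm_comm (v w : Fin n → ℝ) : edgeForm Q v w = edgeForm Q w v := by
  simp only [edgeForm, mul_comm]

/-- The form sees only increments, so expanding increments is enough; the vector v itself is
determined by them only up to a constant. -/
theorem edgeForm_eq_sum {b : Fin n → Fin n → ℝ} {c v : Fin n → ℝ}
    (h : ∀ x y, v x - v y = ∑ k, c k * (b k x - b k y)) (w : Fin n → ℝ) :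
    edgeForm Q v w = ∑ k, c k * edgeForm Q (b k) w := by
  have h1 : ∀ k, c k * edgeForm Q (b k) w = 1 / 2 * ∑ x, ∑ y, c k * ((Q s(x, y)).toReal *
      ((b k x - b k y) * (w x - w y))) := by
    intro k
    simp only [edgeForm, ← Finset.mul_sum]; ring
  simp only [h1]
  rw [← Finset.mul_sum, edgeForm]
  congr 1
  rw [Finset.sum_comm (s := (Finset.univ : Finset (Fin n))) (t := (Finset.univ : Finset (Fin n)))
    (f := fun k x => ∑ y, c k * ((Q s(x, y)).toReal * ((b k x - b k y) * (w x - w y))))]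
  refine Finset.sum_congr rfl fun x _ => ?_
  rw [Finset.sum_comm (s := (Finset.univ : Finset (Fin n))) (t := (Finset.univ : Finset (Fin n)))
    (f := fun k y => c k * ((Q s(x, y)).toReal * ((b k x - b k y) * (w x - w y))))]
  refine Finset.sum_congr rfl fun y _ => ?_
  rw [h, Finset.sum_mul, Finset.mul_sum]
  exact Finset.sum_congr rfl fun k _ => by ring

/-- If the empirical covariances of a frame are close to their means, then the empirical
quadratic form dominates half of the Dirichlet form. -/
theorem half_edgeForm_le {b : Fin n → Fin n → ℝ}
    (hb : ∀ v, ∃ c : Fin n → ℝ, ∑ k, c k ^ 2 = edgeForm Q v v ∧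
      ∀ x y, v x - v y = ∑ k, c k * (b k x - b k y))
    {a : ℕ → Fin n × Fin n × Fin n} {m : ℕ}
    (h : ∀ k l, |(empMean a m fun t => inc (b k) t * inc (b l) t) - edgeForm Q (b k) (b l)| ≤
      1 / (2 * n)) (v : Fin n → ℝ) :
    edgeForm Q v v / 2 ≤ empMean a m fun t => inc v t ^ 2 := by
  obtain ⟨c, hc, hcv⟩ := hb v
  have h1 : (empMean a m fun t => inc v t ^ 2) =
      ∑ k, ∑ l, c k * c l * empMean a m fun t => inc (b k) t * inc (b l) t := by
    simp only [empMean, Finset.sum_div, Finset.mul_sum]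
    have : ∀ t, inc v t ^ 2 = ∑ k, ∑ l, c k * c l * (inc (b k) t * inc (b l) t) := by
      intro t
      rw [inc, hcv, pow_two, Finset.sum_mul_sum]
      exact Finset.sum_congr rfl fun k _ => Finset.sum_congr rfl fun l _ => by
        simp only [inc]; ring
    simp only [this, Finset.sum_div]
    rw [Finset.sum_comm]
    refine Finset.sum_congr rfl fun k _ => ?_
    rw [Finset.sum_comm]
    exact Finset.sum_congr rfl fun l _ => Finset.sum_congr rfl fun i _ => by ring
  have h2 : edgeForm Q v v = ∑ k, ∑ l, c k * c l * edgeForm Q (b k) (b l) := by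
    rw [edgeForm_eq_sum hcv]
    refine Finset.sum_congr rfl fun k _ => ?_
    rw [edgeForm_comm, edgeForm_eq_sum hcv, Finset.mul_sum]
    exact Finset.sum_congr rfl fun l _ => by rw [edgeForm_comm, mul_assoc]
  have hn' : (∑ k, |c k|) ^ 2 ≤ n * ∑ k, c k ^ 2 := by
    have := sq_sum_le_card_mul_sum_sq (s := (Finset.univ : Finset (Fin n))) (f := fun k => |c k|)
    simpa using this
  -- Entrywise error 1/(2n) costs at most (∑|c|)²/(2n), which by Cauchy–Schwarz is at most ∑c²/2,
  -- half of the form.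
  have h3 : |(empMean a m fun t => inc v t ^ 2) - edgeForm Q v v| ≤
      1 / (2 * n) * (∑ k, |c k|) ^ 2 := by
    rw [h1, h2, pow_two, Finset.sum_mul_sum, Finset.mul_sum, ← Finset.sum_sub_distrib]
    refine (Finset.abs_sum_le_sum_abs _ _).trans (Finset.sum_le_sum fun k _ => ?_)
    rw [Finset.mul_sum, ← Finset.sum_sub_distrib]
    refine (Finset.abs_sum_le_sum_abs _ _).trans (Finset.sum_le_sum fun l _ => ?_)
    rw [← mul_sub, abs_mul, abs_mul, mul_comm]
    exact mul_le_mul_of_nonneg_right (h k l) (by positivity)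
  rcases Nat.eq_zero_or_pos n with h0 | h0
  · subst h0; simp [edgeForm, empMean]
    exact div_nonneg (Finset.sum_nonneg fun _ _ => sq_nonneg _) (Nat.cast_nonneg _)
  have hn0 : (0 : ℝ) < n := Nat.cast_pos.2 h0
  have h4 : 1 / (2 * (n : ℝ)) * (∑ k, |c k|) ^ 2 ≤ edgeForm Q v v / 2 := by
    rw [← hc]
    calc _ ≤ 1 / (2 * (n : ℝ)) * (n * ∑ k, c k ^ 2) := by gcongr
      _ = _ := by field_simp
  have := (abs_le.1 (h3.trans h4)).1
  linarith

/-- Cauchy–Schwarz in frame coordinates: n coordinates of size τ form a dual vector of squared norm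
at most nτ². -/
theorem sq_empMean_le {b : Fin n → Fin n → ℝ}
    (hb : ∀ v, ∃ c : Fin n → ℝ, ∑ k, c k ^ 2 = edgeForm Q v v ∧
      ∀ x y, v x - v y = ∑ k, c k * (b k x - b k y))
    {a : ℕ → Fin n × Fin n × Fin n} {m : ℕ} {g : Fin n × Fin n × Fin n → ℝ} {τ : ℝ}
    (h : ∀ k, |empMean a m fun t => g t * inc (b k) t| ≤ τ) (v : Fin n → ℝ) :
    (empMean a m fun t => g t * inc v t) ^ 2 ≤ n * τ ^ 2 * edgeForm Q v v := by
  obtain ⟨c, hc, hcv⟩ := hb v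
  have h1 : (empMean a m fun t => g t * inc v t) =
      ∑ k, c k * empMean a m fun t => g t * inc (b k) t := by
    simp only [empMean, ← mul_div_assoc, ← Finset.sum_div, Finset.mul_sum]
    rw [Finset.sum_comm]
    congr 1
    refine Finset.sum_congr rfl fun i _ => ?_
    rw [inc, hcv, Finset.mul_sum]
    exact Finset.sum_congr rfl fun k _ => by simp only [inc]; ring
  rw [h1, ← hc]
  refine (Finset.sum_mul_sq_le_sq_mul_sq _ _ _).trans ?_
  rw [mul_comm]
  refine mul_le_mul_of_nonneg_right ?_ (Finset.sum_nonneg fun _ _ => sq_nonneg _)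
  calc _ ≤ ∑ _k : Fin n, τ ^ 2 := Finset.sum_le_sum fun k _ => sq_le_sq' (abs_le.1 (h k)).1
        (abs_le.1 (h k)).2
    _ = n * τ ^ 2 := by simp

end Concentration

/-! ### Sample size and accuracy of the learner -/

section Accuracy

open MeasureTheory

variable {n : ℕ} {Q : PMF (Sym2 (Fin n))} {D : PMF (Fin n)}

theorem edgeForm_self_le (hQ : IsPairDistribution Q) (hD : ∀ x, 0 < (D x).toReal)
    (v : Fin n → ℝ) : edgeForm Q v v ≤ 2 * ∑ x, v x ^ 2 := by
  rw [← sum_drawWeight_mul hD]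
  have h : ∀ x y, drawWeight Q D x y * ((v x - v y) * (v x - v y)) ≤
      drawWeight Q D x y * (2 * ∑ x, v x ^ 2) := by
    intro x y
    refine mul_le_mul_of_nonneg_left ?_ (drawWeight_nonneg _ _ _ _)
    by_cases hxy : x = y
    · subst hxy
      simp only [sub_self, mul_zero]
      exact mul_nonneg zero_le_two (Finset.sum_nonneg fun _ _ => sq_nonneg _)
    · have h3 : v x ^ 2 + v y ^ 2 ≤ ∑ x, v x ^ 2 := by
        rw [← Finset.sum_pair (f := fun x => v x ^ 2) hxy]
        exact Finset.sum_le_sum_of_subset_of_nonneg (Finset.subset_univ _)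
          fun _ _ _ => sq_nonneg _
      nlinarith [sq_nonneg (v x + v y)]
  refine (Finset.sum_le_sum fun x _ => Finset.sum_le_sum fun y _ => h x y).trans_eq ?_
  simp only [← Finset.sum_mul, sum_drawWeight hQ hD, one_mul]

theorem poincare_of_sum_eq_zero (hn : 2 ≤ n) (hG : (pairGraph Q).Connected) {v : Fin n → ℝ}
    (hv : ∑ x, v x = 0) : fiedler hn Q * ∑ x, v x ^ 2 ≤ edgeForm Q v v := by
  have := poincare hn hG v
  rw [hv] at this
  simpa using this

/-- Tested on the difference of two unit vectors; the bound keeps the contraction factor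
nonnegative. -/
theorem fiedler_le_two (hn : 2 ≤ n) (hQ : IsPairDistribution Q) (hD : ∀ x, 0 < (D x).toReal)
    (hG : (pairGraph Q).Connected) : fiedler hn Q ≤ 2 := by
  let x₀ : Fin n := ⟨0, by omega⟩
  let x₁ : Fin n := ⟨1, by omega⟩
  have h01 : x₁ ≠ x₀ := by simp [x₀, x₁, Fin.ext_iff]
  let v : Fin n → ℝ := fun x => (if x = x₀ then 1 else 0) - (if x = x₁ then 1 else 0)
  have hv : ∑ x, v x = 0 := by simp [v]
  have hpos : 0 < ∑ x, v x ^ 2 := by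
    refine Finset.sum_pos' (fun _ _ => sq_nonneg _) ⟨x₀, Finset.mem_univ _, ?_⟩
    simp [v, h01.symm]
  have h := (poincare_of_sum_eq_zero hn hG hv).trans (edgeForm_self_le hQ hD v)
  exact le_of_mul_le_mul_right h hpos

/-- A path has fewer than n edges, each changing the logarithm by at most log φ. This crude bound
enters only the initial error, which the ascent damps exponentially. -/
theorem abs_log_sub_le_of_connected {φ : ℝ} (hφ : 1 < φ) (hD : ∀ x, 0 < (D x).toReal)
    (hG : (pairGraph Q).Connected) (hB : BoundedRatios D Q φ) (x y : Fin n) :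
    |Real.log (D x).toReal - Real.log (D y).toReal| ≤ n * Real.log φ := by
  have hL : 0 ≤ Real.log φ := Real.log_nonneg hφ.le
  have key : ∀ {x y : Fin n} (p : (pairGraph Q).Walk x y),
      |Real.log (D x).toReal - Real.log (D y).toReal| ≤ p.length * Real.log φ := by
    intro x y p
    induction p with
    | nil => simp
    | @cons u v w hadj p ih =>
      have h1 : s(u, v) ∈ Q.support := ((SimpleGraph.fromEdgeSet_adj _).1 hadj).1
      have h2 := abs_log_sub_le hφ hD hB h1
      have h3 := abs_sub_le (Real.log (D u).toReal) (Real.log (D v).toReal)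
        (Real.log (D w).toReal)
      rw [SimpleGraph.Walk.length_cons]
      push_cast
      linarith
  obtain ⟨p, hp⟩ := hG.exists_isPath x y
  have h1 : p.length < n := by simpa using hp.length_lt
  exact (key p).trans (mul_le_mul_of_nonneg_right (by exact_mod_cast h1.le) hL)

theorem abs_logWeights_le {φ : ℝ} (hφ : 1 < φ) (hn : 0 < n) (hD : ∀ x, 0 < (D x).toReal)
    (hG : (pairGraph Q).Connected) (hB : BoundedRatios D Q φ) (x : Fin n) :
    |logWeights D x| ≤ n * Real.log φ := by
  have hn0 : (0 : ℝ) < n := Nat.cast_pos.2 hn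
  have h1 : logWeights D x =
      (∑ y, (Real.log (D x).toReal - Real.log (D y).toReal)) / n := by
    rw [logWeights, Finset.sum_sub_distrib]
    simp only [Finset.sum_const, Finset.card_univ, Fintype.card_fin, nsmul_eq_mul]
    field_simp
  rw [h1, abs_div, abs_of_pos hn0, div_le_iff₀ hn0]
  refine (Finset.abs_sum_le_sum_abs _ _).trans ((Finset.sum_le_sum fun y _ =>
    abs_log_sub_le_of_connected hφ hD hG hB x y).trans_eq ?_)
  simp [mul_comm]

theorem softmax_pos (hn : 0 < n) (θ : Fin n → ℝ) (x : Fin n) : 0 < softmax θ x :=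
  div_pos (Real.exp_pos _) (Finset.sum_pos (fun _ _ => Real.exp_pos _) ⟨⟨0, hn⟩, Finset.mem_univ _⟩)

theorem sum_softmax (hn : 0 < n) (θ : Fin n → ℝ) : ∑ x, softmax θ x = 1 := by
  simp only [softmax]
  rw [← Finset.sum_div, div_self]
  exact (Finset.sum_pos (fun _ _ => Real.exp_pos _) ⟨⟨0, hn⟩, Finset.mem_univ _⟩).ne'

theorem softmax_le_one (hn : 0 < n) (θ : Fin n → ℝ) (x : Fin n) : softmax θ x ≤ 1 := by
  rw [← sum_softmax hn θ]
  exact Finset.single_le_sum (fun y _ => (softmax_pos hn θ y).le) (Finset.mem_univ x)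

theorem sum_toReal (D : PMF (Fin n)) : ∑ x, (D x).toReal = 1 := by
  rw [← ENNReal.toReal_sum fun x _ => D.apply_ne_top x, ← tsum_fintype (L := .unconditional _), D.tsum_coe]
  simp

theorem softmax_logWeights (hD : ∀ x, 0 < (D x).toReal) (x : Fin n) :
    softmax (logWeights D) x = (D x).toReal := by
  simp only [softmax, logWeights, Real.exp_sub, Real.exp_log (hD _), ← Finset.sum_div, sum_toReal]
  field_simp

/-- The numerator and the normalizing sum each contribute one factor exp(η). -/
theorem softmax_le_mul (hn : 0 < n) {θ θ' : Fin n → ℝ} {η : ℝ} (h : ∀ x, |θ x - θ' x| ≤ η)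
    (x : Fin n) : softmax θ x ≤ Real.exp (2 * η) * softmax θ' x := by
  have hs : ∀ θ : Fin n → ℝ, 0 < ∑ y, Real.exp (θ y) := fun θ =>
    Finset.sum_pos (fun _ _ => Real.exp_pos _) ⟨⟨0, hn⟩, Finset.mem_univ _⟩
  have h1 : Real.exp (θ x) ≤ Real.exp η * Real.exp (θ' x) := by
    rw [← Real.exp_add, Real.exp_le_exp]; linarith [(abs_le.1 (h x)).2]
  have h2 : ∑ y, Real.exp (θ' y) ≤ Real.exp η * ∑ y, Real.exp (θ y) := by
    rw [Finset.mul_sum]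
    refine Finset.sum_le_sum fun y _ => ?_
    rw [← Real.exp_add, Real.exp_le_exp]; linarith [(abs_le.1 (h y)).1]
  rw [softmax, softmax, ← mul_div_assoc, div_le_div_iff₀ (hs θ) (hs θ'), two_mul, Real.exp_add]
  have := mul_le_mul h1 h2 (hs θ').le (by positivity)
  linarith

theorem relErrorLE_softmax (hn : 0 < n) (hD : ∀ x, 0 < (D x).toReal) {θ : Fin n → ℝ} {ε : ℝ}
    (hε : ε ≤ 1) (h : ∀ x, |θ x - logWeights D x| ≤ ε / 5) : RelErrorLE D (softmax θ) ε := by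
  intro x
  have hε0 : 0 ≤ ε := by have := (abs_nonneg _).trans (h x); linarith
  -- The choice ε/5 works because 2ε/5 + (2ε/5)² ≤ ε for ε ≤ 1.
  have hE : Real.exp (2 * (ε / 5)) ≤ 1 + ε := by
    have := exp_le_one_add_add_sq (y := 2 * (ε / 5)) (by rw [abs_of_nonneg (by positivity)]; linarith)
    nlinarith
  have h1 := softmax_le_mul hn h x
  have h2 := softmax_le_mul hn (fun y => (abs_sub_comm _ _).trans_le (h y)) x
  rw [softmax_logWeights hD] at h1 h2
  have hp := softmax_pos hn θ x
  have hd := hD x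
  set p := softmax θ x
  set d := (D x).toReal
  have h1' : p ≤ (1 + ε) * d := h1.trans (mul_le_mul_of_nonneg_right hE hd.le)
  have h2' : d ≤ (1 + ε) * p := h2.trans (mul_le_mul_of_nonneg_right hE hp.le)
  have aux : ∀ {a b : ℝ}, 0 < a → 0 < b → a ≤ (1 + ε) * b → b ≤ (1 + ε) * a →
      |1 - a / b| ≤ ε := by
    intro a b ha hb hab hba
    have e1 : a / b ≤ 1 + ε := (div_le_iff₀ hb).2 hab
    have e2 : 1 - ε ≤ a / b := by
      rw [le_div_iff₀ hb]
      nlinarith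
    rw [abs_le]; constructor <;> linarith
  exact ⟨aux hd hp h2' h1', aux hp hd h1' h2'⟩

theorem half_le_log {n : ℕ} (hn : 2 ≤ n) : 1 / 2 ≤ Real.log n := by
  have h1 : Real.log 2 ≤ Real.log n := Real.log_le_log (by norm_num) (by exact_mod_cast hn)
  linarith [Real.log_two_gt_d9]

theorem one_le_log_four_div {δ : ℝ} (hδ : 0 < δ) (hδ1 : δ < 1) : 1 ≤ Real.log (4 / δ) := by
  have h1 : Real.log 4 ≤ Real.log (4 / δ) := Real.log_le_log (by norm_num) (by
    rw [le_div_iff₀ hδ]; linarith)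
  have h2 : Real.log 4 = 2 * Real.log 2 := by
    rw [show (4 : ℝ) = 2 ^ 2 by norm_num, Real.log_pow]; norm_num
  linarith [Real.log_two_gt_d9]

theorem learnDraws_mul_ge (c : ℕ) {δ lam : ℝ} (hlam : 0 < lam) :
    c * ((n : ℝ) * n) * Real.log n * Real.log (4 / δ) ≤ learnDraws c n δ lam * lam := by
  rw [← div_le_iff₀ hlam]
  exact Nat.le_ceil _

/-- Concentration of the first `m` draws, in the form that gradient ascent needs. -/
structure Concentrated (Q : PMF (Sym2 (Fin n))) (D : PMF (Fin n)) (φ r : ℝ) (m : ℕ)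
    (a : ℕ → Fin n × Fin n × Fin n) : Prop where
  quad : ∀ v, edgeForm Q v v / 2 ≤ empMean a m fun t => inc v t ^ 2
  noise : ∀ v, (empMean a m fun t => score (Real.log φ) (logWeights D) t * inc v t) ^ 2 ≤
    r * edgeForm Q v v

theorem measure_not_concentrated (hn : 2 ≤ n) (hQ : IsPairDistribution Q) {φ : ℝ} (hφ : 1 < φ)
    (hG : (pairGraph Q).Connected) (hB : BoundedRatios D Q φ) {m : ℕ} (hm : 0 < m) :
    (Measure.infinitePi fun _ : ℕ => (samp Q D).toMeasure)
      {a | ¬ Concentrated Q D φ (minSlope φ ^ 2 * fiedler hn Q / (1600 * n)) m a} ≤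
      ENNReal.ofReal (2 * (n ^ 2 + n) *
        Real.exp (-(minSlope φ ^ 2 * (m * fiedler hn Q) / (6400 * n ^ 2)))) := by
  have hD := pos_of_boundedRatios hG hB
  have hlam := fiedler_pos hn hG
  obtain ⟨b, hb1, hb2, hb3⟩ := exists_edgeForm_frame hn hG
  have hc := minSlope_pos hφ
  have hc4 := minSlope_le hφ
  set lam := fiedler hn Q
  set c := minSlope φ
  have hn0 : (0 : ℝ) < n := by exact_mod_cast (by omega : 0 < n)
  have hn1 : (1 : ℝ) ≤ n := by exact_mod_cast (by omega : 1 ≤ n)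
  have hcsq : c ^ 2 ≤ 1 := pow_le_one₀ hc.le (by linarith)
  -- Chosen so that nτ² is the noise level c²λ/(1600n) of the statement. The exponent mτ²/4 is then
  -- the weaker one of the two families of events and serves as common bound for the n² + n of them.
  set τ := c * √lam / (40 * n) with hτ
  have hτsq : τ ^ 2 = c ^ 2 * lam / (1600 * n ^ 2) := by
    rw [hτ, div_pow, mul_pow, Real.sq_sqrt hlam.le, mul_pow]; norm_num
  have hτ2 : τ ^ 2 ≤ lam := by
    rw [hτsq, div_le_iff₀ (by positivity)]
    have h1 : 1 ≤ (n : ℝ) ^ 2 := one_le_pow₀ hn1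
    have h2 := mul_le_mul_of_nonneg_right hcsq hlam.le
    have h3 := mul_le_mul_of_nonneg_left h1 hlam.le
    linarith
  set P := Measure.infinitePi fun _ : ℕ => (samp Q D).toMeasure
  set X := Real.exp (-(c ^ 2 * (m * lam) / (6400 * n ^ 2))) with hX
  have hA : ∀ k l, P {a | ¬ |(empMean a m fun t => inc (b k) t * inc (b l) t) -
      edgeForm Q (b k) (b l)| ≤ 1 / (2 * n)} ≤ ENNReal.ofReal (2 * X) := fun k l => by
    refine (measure_covariance hn hQ hD hlam (hb1 k) (hb2 k) (hb2 l) hm).trans ?_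
    refine ENNReal.ofReal_le_ofReal (mul_le_mul_of_nonneg_left (Real.exp_le_exp.2
      (neg_le_neg ?_)) zero_le_two)
    rw [div_le_div_iff₀ (by positivity) (by positivity)]
    have : 0 ≤ m * lam * (n : ℝ) ^ 2 := by positivity
    have := mul_le_mul_of_nonneg_right hcsq this
    linarith
  have hZ : ∀ k, P {a | ¬ |empMean a m fun t => score (Real.log φ) (logWeights D) t *
      inc (b k) t| ≤ τ} ≤ ENNReal.ofReal (2 * X) := fun k => by
    refine (measure_noise hφ hQ hD hB hlam (hb1 k) (hb2 k) (by positivity) hτ2 hm).trans_eq ?_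
    rw [hX, hτsq]
    congr 4
    field_simp; norm_num
  have hsub : {a | ¬ Concentrated Q D φ (c ^ 2 * lam / (1600 * n)) m a} ⊆
      (⋃ k, ⋃ l, {a | ¬ |(empMean a m fun t => inc (b k) t * inc (b l) t) -
        edgeForm Q (b k) (b l)| ≤ 1 / (2 * n)}) ∪
      ⋃ k, {a | ¬ |empMean a m fun t => score (Real.log φ) (logWeights D) t *
        inc (b k) t| ≤ τ} := by
    intro a ha
    by_contra hcon
    simp only [Set.mem_union, Set.mem_iUnion, Set.mem_ofPred_eq, not_or, not_exists,
      not_not] at hcon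
    refine ha ⟨half_edgeForm_le hb3 hcon.1, fun v => ?_⟩
    have := sq_empMean_le hb3 hcon.2 v
    rwa [hτsq, show (n : ℝ) * (c ^ 2 * lam / (1600 * n ^ 2)) = c ^ 2 * lam / (1600 * n) by
      field_simp] at this
  calc P _ ≤ _ := measure_mono hsub
    _ ≤ _ := measure_union_le _ _
    _ ≤ (∑ _k : Fin n, ∑ _l : Fin n, ENNReal.ofReal (2 * X)) +
        ∑ _k : Fin n, ENNReal.ofReal (2 * X) := by
      refine add_le_add ((measure_iUnion_fintype_le _ _).trans (Finset.sum_le_sum fun k _ =>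
        (measure_iUnion_fintype_le _ _).trans (Finset.sum_le_sum fun l _ => hA k l)))
        ((measure_iUnion_fintype_le _ _).trans (Finset.sum_le_sum fun k _ => hZ k))
    _ = ENNReal.ofReal (2 * (n ^ 2 + n) * X) := by
      have hX0 : 0 ≤ 2 * X := by positivity
      simp only [Finset.sum_const, Finset.card_univ, Fintype.card_fin, nsmul_eq_mul]
      rw [show 2 * ((n : ℝ) ^ 2 + n) * X = n * (n * (2 * X)) + n * (2 * X) by ring,
        ENNReal.ofReal_add (by positivity) (by positivity),
        ENNReal.ofReal_mul (Nat.cast_nonneg n), ENNReal.ofReal_mul (Nat.cast_nonneg n),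
        ENNReal.ofReal_natCast]

/-- A sample size constant that suffices for the learner. -/
def Suffices (φ : ℝ) (c : ℕ) : Prop :=
  51200 ≤ minSlope φ ^ 2 * c ∧ 384 * Real.log φ ≤ minSlope φ * c

theorem exists_suffices {φ : ℝ} (hφ : 1 < φ) : ∃ c, 0 < c ∧ Suffices φ c := by
  have hc := minSlope_pos hφ
  obtain ⟨c, h⟩ := exists_nat_ge (max (51200 / minSlope φ ^ 2) (384 * Real.log φ / minSlope φ))
  refine ⟨c + 1, Nat.succ_pos _, ?_, ?_⟩
  · have := (le_max_left _ _).trans h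
    rw [div_le_iff₀ (by positivity)] at this
    push_cast; nlinarith [sq_nonneg (minSlope φ)]
  · have := (le_max_right _ _).trans h
    rw [div_le_iff₀ (by positivity)] at this
    push_cast; nlinarith

theorem learnDraws_pos (hn : 2 ≤ n) {c : ℕ} (hc : 0 < c) {δ lam : ℝ} (hlam : 0 < lam)
    (hδ : 0 < δ) (hδ1 : δ < 1) : 0 < learnDraws c n δ lam := by
  have h1 := half_le_log hn
  have h2 := one_le_log_four_div hδ hδ1
  have hn0 : (0 : ℝ) < n := by exact_mod_cast (by omega : 0 < n)
  have : (0 : ℝ) < c := Nat.cast_pos.2 hc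
  exact Nat.ceil_pos.2 (by positivity)

/-- The squared error is at most 1/(80n) from noise plus 1/(64n) from stopping after m steps,
together below (1/(5√n))². Bounding the Euclidean norm bounds every coordinate. -/
theorem relErrorLE_of_concentrated (hn : 2 ≤ n) (hQ : IsPairDistribution Q) {φ : ℝ}
    (hφ : 1 < φ) (hG : (pairGraph Q).Connected) (hB : BoundedRatios D Q φ) {c m : ℕ}
    (hc : Suffices φ c) (hm : 0 < m) (hmc : (c * n ^ 2 / 2 : ℝ) ≤ m * fiedler hn Q)
    {a : ℕ → Fin n × Fin n × Fin n} (ha : ∀ i, ValidDraw (a i))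
    (hconc : Concentrated Q D φ (minSlope φ ^ 2 * fiedler hn Q / (1600 * n)) m a) :
    RelErrorLE D (softmax (logEstimate (Real.log φ) a m)) (1 / √n) := by
  have hD := pos_of_boundedRatios hG hB
  have hlam := fiedler_pos hn hG
  have hs := minSlope_pos hφ
  have hL : 0 < Real.log φ := Real.log_pos hφ
  have hn0 : (0 : ℝ) < n := by exact_mod_cast (by omega : 0 < n)
  have hn1 : (1 : ℝ) ≤ n := by exact_mod_cast (by omega : 1 ≤ n)
  have hlam2 := fiedler_le_two hn hQ hD hG
  set lam := fiedler hn Q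
  set s := minSlope φ
  set L := Real.log φ
  have hgd := iterate_ascend_le hφ ha hm (E := fun v => edgeForm Q v v) (lam := lam)
    (r := s ^ 2 * lam / (1600 * n)) (θ' := logWeights D) (by positivity) hlam hlam2
    (edgeForm_self_le hQ hD) (edgeForm_self_nonneg Q)
    (fun v => poincare_of_sum_eq_zero hn hG) hconc.quad hconc.noise
    (sum_logWeights (by omega) D) m
  have hr : 20 * (s ^ 2 * lam / (1600 * n)) / (s ^ 2 * lam) = 1 / (80 * n) := by
    field_simp; norm_num
  rw [hr] at hgd
  have hθ : ∑ x, logWeights D x ^ 2 ≤ n * (n * L) ^ 2 := by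
    calc _ ≤ ∑ _x : Fin n, (n * L) ^ 2 := Finset.sum_le_sum fun x _ => by
          have := abs_le.1 (abs_logWeights_le hφ (by omega) hD hG hB x)
          exact sq_le_sq' this.1 this.2
      _ = _ := by simp
  set y := s * lam / 16 * m with hy
  -- The constant 384 = 12 · 16 · 2 of `Suffices`: the 16 comes from the contraction rate and the 2
  -- from `hmc`.
  have hy1 : 12 * L * n ^ 2 ≤ y := by
    have h1 := mul_le_mul_of_nonneg_left hmc hs.le
    have h2 := mul_le_mul_of_nonneg_right hc.2 (sq_nonneg (n : ℝ))
    simp only [hy]; linarith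
  have hy0 : 0 < y := by positivity
  have hexp : Real.exp (-y) ≤ 2 / y ^ 2 := by
    rw [Real.exp_neg, inv_eq_one_div, div_le_div_iff₀ (Real.exp_pos _) (by positivity)]
    have := Real.quadratic_le_exp_of_nonneg hy0.le
    linarith
  have hbias : Real.exp (-y) * ∑ x, logWeights D x ^ 2 ≤ 1 / (64 * n) := by
    calc _ ≤ 2 / y ^ 2 * (n * (n * L) ^ 2) := by gcongr
      _ ≤ 2 / (12 * L * n ^ 2) ^ 2 * (n * (n * L) ^ 2) := by gcongr
      _ = 1 / (72 * n) := by field_simp; norm_num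
      _ ≤ _ := by gcongr; norm_num
  refine relErrorLE_softmax (by omega) hD (by
    rw [div_le_one (Real.sqrt_pos.2 hn0)]; exact Real.one_le_sqrt.2 hn1) fun x => ?_
  refine abs_le_of_sq_le_sq ?_ (by positivity)
  have hx : (logEstimate L a m x - logWeights D x) ^ 2 ≤
      ∑ x, ((ascend L a m)^[m] 0 x - logWeights D x) ^ 2 :=
    Finset.single_le_sum (f := fun x => ((ascend L a m)^[m] 0 x - logWeights D x) ^ 2)
      (fun _ _ => sq_nonneg _) (Finset.mem_univ x)
  refine hx.trans (hgd.trans ((add_le_add hbias le_rfl).trans ?_))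
  rw [div_pow, div_pow, Real.sq_sqrt hn0.le,
    show 1 / (64 * (n : ℝ)) + 1 / (80 * n) = (9 / 320) / n by field_simp; norm_num,
    show (1 ^ 2 / (n : ℝ)) / 5 ^ 2 = (1 / 25) / n by field_simp; norm_num]
  exact div_le_div_of_nonneg_right (by norm_num) hn0.le

theorem ae_validDraws (hQ : IsPairDistribution Q) (hD : ∀ x, 0 < (D x).toReal) :
    ∀ᵐ a ∂(Measure.infinitePi fun _ : ℕ => (samp Q D).toMeasure), ∀ i, ValidDraw (a i) := by
  rw [ae_all_iff]
  exact fun i => (measurePreserving_eval_infinitePi (fun _ : ℕ => (samp Q D).toMeasure) i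
    ).quasiMeasurePreserving.ae (ae_validDraw hQ hD)

/-- The learner is accurate with high probability. -/
theorem measure_not_relErrorLE (hn : 2 ≤ n) (hQ : IsPairDistribution Q) {φ : ℝ} (hφ : 1 < φ)
    (hG : (pairGraph Q).Connected) (hB : BoundedRatios D Q φ) {c : ℕ} (hc0 : 0 < c)
    (hc : Suffices φ c) {δ : ℝ} (hδ : 0 < δ) (hδ1 : δ < 1) :
    (Measure.infinitePi fun _ : ℕ => (samp Q D).toMeasure)
      {a | ¬ RelErrorLE D (softmax (logEstimate (Real.log φ) a (learnDraws c n δ (fiedler hn Q))))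
        (1 / √n)} ≤ ENNReal.ofReal (δ / 2) := by
  have hD := pos_of_boundedRatios hG hB
  have hlam := fiedler_pos hn hG
  have hs := minSlope_pos hφ
  have hn0 : (0 : ℝ) < n := by exact_mod_cast (by omega : 0 < n)
  have hn2 : (2 : ℝ) ≤ n := by exact_mod_cast hn
  have hm := learnDraws_pos hn hc0 hlam hδ hδ1
  have h1 := half_le_log hn
  have h2 := one_le_log_four_div hδ hδ1
  have hM := learnDraws_mul_ge (n := n) c (δ := δ) hlam
  set m := learnDraws c n δ (fiedler hn Q)
  set A := Real.log (4 / δ) with hA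
  set l := Real.log n with hl
  have hc1 : (0 : ℝ) < c := Nat.cast_pos.2 hc0
  have hlA : 1 / 2 ≤ l * A := by nlinarith
  have hmc : (c * n ^ 2 / 2 : ℝ) ≤ m * fiedler hn Q := by
    refine le_trans ?_ hM
    have := mul_le_mul_of_nonneg_left hlA (show 0 ≤ c * ((n : ℝ) * n) by positivity)
    linarith
  refine le_trans (measure_mono_ae ?_) ((measure_not_concentrated hn hQ hφ hG hB hm).trans ?_)
  · filter_upwards [ae_validDraws hQ hD] with a ha h hcon
    exact h (relErrorLE_of_concentrated hn hQ hφ hG hB hc hm hmc ha hcon)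
  · refine ENNReal.ofReal_le_ofReal ?_
    -- The constant 51200 = 8 · 6400 of `Suffices` yields the exponent 8lA, which dominates 4l + A;
    -- the failure probability is then at most δ/(4n⁴) per event, up to the factor 2.
    have hexp : 4 * l + A ≤ minSlope φ ^ 2 * (m * fiedler hn Q) / (6400 * n ^ 2) := by
      rw [le_div_iff₀ (by positivity)]
      have e1 := mul_le_mul_of_nonneg_left hM (sq_nonneg (minSlope φ))
      have e2 := mul_le_mul_of_nonneg_right hc.1 (show 0 ≤ (n : ℝ) * n * (l * A) by positivity)
      have e3 : 4 * l + A ≤ 8 * (l * A) := by nlinarith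
      have e4 := mul_le_mul_of_nonneg_right e3 (show 0 ≤ 6400 * (n : ℝ) ^ 2 by positivity)
      nlinarith
    have hX : Real.exp (-(minSlope φ ^ 2 * (m * fiedler hn Q) / (6400 * n ^ 2))) ≤
        δ / 4 / n ^ 4 := by
      calc _ ≤ Real.exp (-(4 * l + A)) := Real.exp_le_exp.2 (neg_le_neg hexp)
        _ = δ / 4 / n ^ 4 := by
          rw [neg_add, Real.exp_add, Real.exp_neg, Real.exp_neg, hA, Real.exp_log (by positivity),
            show 4 * l = ((4 : ℕ) : ℝ) * l by norm_num, Real.exp_nat_mul, hl, Real.exp_log hn0]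
          field_simp
    calc _ ≤ 2 * ((n : ℝ) ^ 2 + n) * (δ / 4 / n ^ 4) := by gcongr
      _ ≤ 2 * (n ^ 4 / 2) * (δ / 4 / n ^ 4) := by
        gcongr
        nlinarith [mul_pos hn0 hn0, mul_le_mul hn2 hn2 zero_le_two hn0.le, pow_pos hn0 3]
      _ ≤ δ / 2 := by field_simp; norm_num

end Accuracy

/-! ### Conditioning on the learning phase, and explicit cutoffs -/

section Final

open MeasureTheory

variable {n : ℕ} {Q : PMF (Sym2 (Fin n))} {D : PMF (Fin n)}

theorem ae_validTape (hQ : IsPairDistribution Q) (hD : ∀ x, 0 < (D x).toReal) :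
    ∀ᵐ ω ∂(tapeLaw Q D), ∀ i, ValidDraw (ω.1 i) :=
  measurePreserving_fst.quasiMeasurePreserving.ae (ae_validDraws hQ hD)

theorem measure_tape_fst_le (Q : PMF (Sym2 (Fin n))) (D : PMF (Fin n))
    (s : Set (ℕ → Fin n × Fin n × Fin n)) :
    tapeLaw Q D {ω | ω.1 ∈ s} ≤ (Measure.infinitePi fun _ : ℕ => (samp Q D).toMeasure) s := by
  have h := Measure.le_map_apply (μ := tapeLaw Q D) measurable_fst.aemeasurable s
  rwa [tapeLaw, measurePreserving_fst.map_eq] at h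

/-- Uses only subadditivity, so the event may be any set; measurability of the events about program
executions is never needed. -/
theorem ofReal_one_sub_le {α : Type*} [MeasurableSpace α] {μ : Measure α} [IsProbabilityMeasure μ]
    {s : Set α} {δ : ℝ} (hδ : 0 ≤ δ) (h : μ sᶜ ≤ ENNReal.ofReal δ) :
    ENNReal.ofReal (1 - δ) ≤ μ s := by
  rw [ENNReal.ofReal_sub _ hδ, ENNReal.ofReal_one, tsub_le_iff_right]
  calc (1 : ENNReal) = μ (s ∪ sᶜ) := by rw [Set.union_compl_self, measure_univ]
    _ ≤ μ s + μ sᶜ := measure_union_le _ _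
    _ ≤ _ := by gcongr

/-- A random choice that is made from the first `m` draws is independent of the remaining tape. -/
theorem measure_adv_draws (Q : PMF (Sym2 (Fin n))) (D : PMF (Fin n)) {α : Type*} (m : ℕ)
    {P : (ℕ → Fin n × Fin n × Fin n) → α} (hP : ∀ a b, (∀ i < m, a i = b i) → P a = P b)
    {S : α → Set (Tape n)} (hS : ∀ p, MeasurableSet (S p)) :
    tapeLaw Q D {ω | ω.adv m 0 ∈ S (P ω.1)} =
      ∫⁻ a, tapeLaw Q D (S (P a)) ∂(Measure.infinitePi fun _ : ℕ => (samp Q D).toMeasure) := by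
  rcases isEmpty_or_nonempty (Fin n × Fin n × Fin n) with hempty | ⟨⟨t₀⟩⟩
  · exact absurd (samp Q D).support_nonempty (by
      rw [Set.not_nonempty_iff_eq_empty]; exact Set.eq_empty_of_isEmpty _)
  have hf : Measurable (Function.uncurry fun (a : ℕ → Fin n × Fin n × Fin n) (ω : Tape n) =>
      (S (P a)).indicator (fun _ => (1 : ENNReal)) ω) := by
    -- P factors through the first m draws, which range over a finite set; hence joint
    -- measurability. The value t₀ is mere padding.
    let e : (Fin m → Fin n × Fin n × Fin n) → ℕ → Fin n × Fin n × Fin n := fun r i =>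
      if h : i < m then r ⟨i, h⟩ else t₀
    have h1 : Measurable fun q : (Fin m → Fin n × Fin n × Fin n) × Tape n =>
        (S (P (e q.1))).indicator (fun _ => (1 : ENNReal)) q.2 :=
      measurable_from_prod_countable_right fun r =>
        (measurable_const (a := (1 : ENNReal))).indicator (hS (P (e r)))
    have h2 := h1.comp (f := fun q : (ℕ → Fin n × Fin n × Fin n) × Tape n =>
      ((fun i : Fin m => q.1 i), q.2)) (by fun_prop)
    convert h2 using 1
    funext q
    have : P (e fun i : Fin m => q.1 i) = P q.1 := hP _ _ fun i hi => by simp [e, hi]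
    simp [Function.uncurry, this]
  have h := lintegral_adv_draws Q D m hf fun a b hab => by rw [hP a b hab]
  simp only [lintegral_indicator_const (hS _), one_mul] at h
  rw [← h]
  have hmeas : MeasurableSet {ω : Tape n | ω.adv m 0 ∈ S (P ω.1)} := by
    have := hf.comp (f := fun ω : Tape n => (ω.1, ω.adv m 0))
      (measurable_fst.prodMk (Tape.measurable_adv m 0))
    convert this (measurableSet_singleton 1) using 1
    ext ω
    simp [Function.uncurry]
  rw [← lintegral_indicator_one hmeas]
  rfl

theorem logEstimate_congr (L : ℝ) {a b : ℕ → Fin n × Fin n × Fin n} {m : ℕ}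
    (h : ∀ i < m, a i = b i) : logEstimate L a m = logEstimate L b m := by
  have : ascend L a m = ascend L b m := by
    funext θ x
    simp only [ascend, gradient]
    congr 2
    exact Finset.sum_congr rfl fun i hi => by rw [h i (Finset.mem_range.1 hi)]
  rw [logEstimate, logEstimate, this]

/-- For n ≥ 2 the error 1/√n is below 3/4, so D/p lies in [1/4, 2]. On an edge the winner's
probability is then at least 1/(1+φ), and p(x)/p(w) at least D(x)/(8D(w)) ≥ 1/(8φ). -/
theorem rate_bounds_of_relErrorLE {φ : ℝ} (hφ : 1 < φ) (hn : 2 ≤ n)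
    (hD : ∀ x, 0 < (D x).toReal) (hB : BoundedRatios D Q φ) {p : Fin n → ℝ} (hp : ∀ x, 0 < p x)
    (h : RelErrorLE D p (1 / √n)) : (∀ x, 1 / 4 ≤ statWeight D p x) ∧
      (∀ x, statWeight D p x ≤ 2) ∧
      ∀ x w, 1 / (8 * φ * (1 + φ)) * (Q s(x, w)).toReal ≤ moveRate Q D p x w := by
  have hn0 : (0 : ℝ) < n := by exact_mod_cast (by omega : 0 < n)
  have hn2 : (2 : ℝ) ≤ n := by exact_mod_cast hn
  have hε : 1 / √(n : ℝ) ≤ 3 / 4 := by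
    rw [div_le_div_iff₀ (Real.sqrt_pos.2 hn0) (by norm_num)]
    have : 4 / 3 ≤ √(n : ℝ) := Real.le_sqrt_of_sq_le (by norm_num; linarith)
    linarith
  have hlo : ∀ x, 1 / 4 ≤ statWeight D p x := fun x => by
    have := (abs_le.1 (h x).1).2
    unfold statWeight; linarith
  have hhi : ∀ x, statWeight D p x ≤ 2 := fun x => by
    have := (abs_le.1 (h x).1).1
    unfold statWeight; linarith
  refine ⟨hlo, hhi, fun x w => ?_⟩
  by_cases hq : s(x, w) ∈ Q.support
  · have h1 := hB x w hq
    have h2 := hB w x (Sym2.eq_swap ▸ hq)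
    have hx := hD x; have hw := hD w
    have e1 : 1 / (1 + φ) ≤ (D w).toReal / ((D x).toReal + (D w).toReal) := by
      rw [div_le_div_iff₀ (by positivity) (by positivity)]; linarith
    have e2 : 1 / (8 * φ) ≤ min (p x / p w) 1 := by
      refine le_min ?_ ?_
      · have e3 : (D x).toReal ≤ 2 * p x := by
          have := hhi x; unfold statWeight at this; rwa [div_le_iff₀ (hp x)] at this
        have e4 : 1 / 4 * p w ≤ (D w).toReal := by
          have := hlo w; unfold statWeight at this; rwa [le_div_iff₀ (hp w)] at this
        rw [div_le_div_iff₀ (by positivity) (hp w)]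
        nlinarith
      · rw [div_le_one (by positivity)]; linarith
    unfold moveRate drawWeight
    calc _ = (Q s(x, w)).toReal * (1 / (1 + φ)) * (1 / (8 * φ)) := by field_simp
      _ ≤ _ := by gcongr
  · rw [PMF.mem_support_iff, not_not] at hq
    simp [moveRate, drawWeight, hq]

section Cutoff

variable [NeZero n]

/-- For B ≥ 1 the integer part is at least B/2; this is the factor 2 required of κB. -/
theorem measure_running_floor_le {p : Fin n → ℝ} {rej : Cfg n} {K κ B δ : ℝ} (hκ : 0 < κ)
    (hK : 0 < K) (hδ : 0 < δ) (hB : 1 ≤ B) (hB2 : 2 * Real.log (K / δ) ≤ κ * B)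
    (htail : ∀ k, tapeLaw Q D {ω | Running p rej k ω} ≤
      ENNReal.ofReal (K * Real.exp (-(κ * k)))) :
    tapeLaw Q D {ω | Running p rej ⌊B⌋₊ ω} ≤ ENNReal.ofReal δ := by
  refine (htail _).trans (ENNReal.ofReal_le_ofReal ?_)
  have h1 : (1 : ℝ) ≤ ⌊B⌋₊ := by exact_mod_cast (Nat.one_le_floor_iff B).2 hB
  have h2 := Nat.lt_floor_add_one B
  have h3 : Real.log (K / δ) ≤ κ * ⌊B⌋₊ := by nlinarith
  calc K * Real.exp (-(κ * ⌊B⌋₊)) ≤ K * Real.exp (-Real.log (K / δ)) := by gcongr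
    _ = δ := by rw [Real.exp_neg, Real.exp_log (by positivity)]; field_simp

theorem le_log_two_div {δ : ℝ} (hδ : 0 < δ) (hδ1 : δ < 1) : Real.log 2 ≤ Real.log (2 / δ) :=
  Real.log_le_log (by norm_num) (by rw [le_div_iff₀ hδ]; linarith)

omit [NeZero n] in
theorem log_mul_sq_div_le (hn : 2 ≤ n) {δ : ℝ} (hδ : 0 < δ) (hδ1 : δ < 1) (k : ℕ) :
    Real.log (2 ^ k * n ^ 2 / δ) ≤ (2 * k + 6) * (Real.log n * Real.log (2 / δ)) := by
  have hn0 : (0 : ℝ) < n := by exact_mod_cast (by omega : 0 < n)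
  have h1 : Real.log 2 ≤ Real.log n := Real.log_le_log (by norm_num) (by exact_mod_cast hn)
  have h2 := le_log_two_div hδ hδ1
  have h3 := Real.log_two_gt_d9
  rw [show (2 : ℝ) ^ k * n ^ 2 / δ = 2 ^ k * n ^ 2 * (2 / δ) / 2 by ring,
    Real.log_div (by positivity) (by norm_num), Real.log_mul (by positivity) (by positivity),
    Real.log_mul (by positivity) (by positivity), Real.log_pow, Real.log_pow]
  set l := Real.log n
  set A := Real.log (2 / δ)
  set t := Real.log 2
  have e1 : t ≤ 2 * (l * A) := by nlinarith
  have e2 : l ≤ 2 * (l * A) := by nlinarith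
  have e3 : A ≤ 2 * (l * A) := by nlinarith
  have e4 := mul_le_mul_of_nonneg_left e1 (Nat.cast_nonneg (α := ℝ) k)
  push_cast
  linarith

variable (hQ : IsPairDistribution Q) {φ : ℝ} (hφ : 1 < φ) (hn : 2 ≤ n)
  (hG : (pairGraph Q).Connected) (hB : BoundedRatios D Q φ) {p : Fin n → ℝ}
  (hp : ∀ x, 0 < p x ∧ p x ≤ 1)
include hQ hφ hn hG hB hp

theorem measure_sampler_running_le (h : RelErrorLE D p (1 / √n)) {δ : ℝ} (hδ : 0 < δ)
    (hδ1 : δ < 1) {C : ℝ} (hC : 9216 * (φ * (1 + φ)) ≤ C) :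
    tapeLaw Q D {ω | Running p (.done none)
      ⌊C * (n * Real.log n / fiedler hn Q * Real.log (2 / δ))⌋₊ ω} ≤ ENNReal.ofReal δ := by
  have hD := pos_of_boundedRatios hG hB
  have hlam := fiedler_pos hn hG
  have hlam2 := fiedler_le_two hn hQ hD hG
  have hn0 : (0 : ℝ) < n := by exact_mod_cast (by omega : 0 < n)
  have hn2 : (2 : ℝ) ≤ n := by exact_mod_cast hn
  obtain ⟨h1, h2, h3⟩ := rate_bounds_of_relErrorLE hφ hn hD hB (fun x => (hp x).1) h
  have htail := sampler_tail hQ hD hp hn hG (by norm_num) (by positivity) h1 h2 h3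
  have hl := half_le_log hn
  have hA : 1 / 2 ≤ Real.log (2 / δ) := by
    linarith [le_log_two_div hδ hδ1, Real.log_two_gt_d9]
  have hlog := log_mul_sq_div_le hn hδ hδ1 6
  set lam := fiedler hn Q
  set l := Real.log n
  set A := Real.log (2 / δ)
  have hlA : 1 / 4 ≤ l * A := by nlinarith
  -- With a = 1/4, b = 2 and ρ = 1/(8φ(1+φ)) the tail has K = (8n)² and rate λ/(256φ(1+φ)n). The
  -- logarithm is at most 18 log n log(2/δ), and 9216 = 2 · 18 · 256.
  refine measure_running_floor_le (K := 2 ^ 6 * n ^ 2) (κ := lam / (256 * (φ * (1 + φ)) * n))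
    (by positivity) (by positivity) hδ ?_ ?_ fun k => (htail k).trans_eq ?_
  · have e1 : 1 ≤ (n : ℝ) * l / lam * A * 4 := by
      rw [show (n : ℝ) * l / lam * A * 4 = (n * (l * A) * 4) / lam by ring, le_div_iff₀ hlam]
      nlinarith
    have e2 : 1 ≤ φ * (1 + φ) := by nlinarith
    nlinarith
  · have e1 : lam / (256 * (φ * (1 + φ)) * n) * (C * (n * l / lam * A)) =
        C * (l * A) / (256 * (φ * (1 + φ))) := by
      field_simp
    rw [e1, le_div_iff₀ (by positivity)]
    have e2 := mul_le_mul_of_nonneg_right hC (show 0 ≤ l * A by positivity)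
    have e3 := mul_le_mul_of_nonneg_right hlog (show 0 ≤ φ * (1 + φ) by positivity)
    push_cast at e3
    nlinarith
  · congr 1
    rw [show ((n : ℝ) * 2 / (1 / 4)) ^ 2 = 2 ^ 6 * n ^ 2 by ring]
    congr 2
    field_simp
    norm_num [mul_comm]

theorem measure_loop_running_le (h : RelErrorLE D p (1 / √n)) {δ : ℝ} (hδ : 0 < δ)
    (hδ1 : δ < 1) {C : ℝ} (hC : 622080 * (φ * (1 + φ)) ≤ C) :
    tapeLaw Q D {ω | Running p (.run id)
      ⌊C * ((n : ℝ) ^ 2 * Real.log n ^ 2 / fiedler hn Q * Real.log (2 / δ))⌋₊ ω} ≤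
      ENNReal.ofReal (δ / 2) := by
  have hD := pos_of_boundedRatios hG hB
  have hlam := fiedler_pos hn hG
  have hlam2 := fiedler_le_two hn hQ hD hG
  have hn0 : (0 : ℝ) < n := by exact_mod_cast (by omega : 0 < n)
  have hn2 : (2 : ℝ) ≤ n := by exact_mod_cast hn
  obtain ⟨h1, h2, h3⟩ := rate_bounds_of_relErrorLE hφ hn hD hB (fun x => (hp x).1) h
  have htail := loop_tail hQ hD hp hn hG (by norm_num) (by positivity) h1 h2 h3 rfl rfl
  have hl := half_le_log hn
  have hl2 : Real.log 2 ≤ Real.log n := Real.log_le_log (by norm_num) hn2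
  have hln : Real.log n ≤ n := (Real.log_le_sub_one_of_pos hn0).trans (by linarith)
  have hA : 1 / 2 ≤ Real.log (2 / δ) := by
    linarith [le_log_two_div hδ hδ1, Real.log_two_gt_d9]
  have hlog := log_mul_sq_div_le hn hδ hδ1 7
  have hVlog : Real.log (1 + ((n : ℝ) * 2 / (1 / 4)) ^ 2) ≤ 9 * Real.log n := by
    have : Real.log (1 + ((n : ℝ) * 2 / (1 / 4)) ^ 2) ≤ Real.log (2 ^ 7 * n ^ 2) := by
      refine Real.log_le_log (by positivity) ?_
      nlinarith
    refine this.trans ?_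
    rw [Real.log_mul (by positivity) (by positivity), Real.log_pow, Real.log_pow]
    push_cast; linarith
  have hVpos : 0 < Real.log (1 + ((n : ℝ) * 2 / (1 / 4)) ^ 2) := Real.log_pos (by
    have : 0 < ((n : ℝ) * 2 / (1 / 4)) ^ 2 := by positivity
    linarith)
  set V := ((n : ℝ) * 2 + 1) * Real.log (1 + ((n : ℝ) * 2 / (1 / 4)) ^ 2) with hV
  set lam := fiedler hn Q
  set l := Real.log n
  set A := Real.log (2 / δ)
  have hV0 : 0 < V := by positivity
  have hVle : V ≤ 27 * n * l := by
    calc V ≤ (3 * n) * (9 * l) := by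
          rw [hV]; gcongr; linarith
      _ = _ := by ring
  have hlA : 1 / 4 ≤ l * A := by nlinarith
  -- The same a, b and ρ, now with V ≤ 27 n log n and a logarithm of at most 20 log n log(2/δ); the
  -- constant 622080 exceeds 2 · 20 · 512 · 27.
  refine measure_running_floor_le (K := 2 * V) (κ := lam / (512 * (φ * (1 + φ)) * n * V))
    (by positivity) (by positivity) (by positivity) ?_ ?_ fun k => (htail k).trans_eq ?_
  · have e1 : 1 ≤ (n : ℝ) ^ 2 * l ^ 2 / lam * A * 4 := by
      rw [show (n : ℝ) ^ 2 * l ^ 2 / lam * A * 4 = (n ^ 2 * (l * (l * A)) * 4) / lam by ring,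
        le_div_iff₀ hlam]
      have : 1 / 8 ≤ l * (l * A) := by nlinarith
      nlinarith
    have e2 : 1 ≤ φ * (1 + φ) := by nlinarith
    nlinarith
  · have e0 : Real.log (2 * V / (δ / 2)) ≤ 20 * (l * A) := by
      refine (Real.log_le_log (by positivity) ?_).trans (hlog.trans_eq (by push_cast; ring))
      rw [show 2 * V / (δ / 2) = 4 * V / δ by ring]
      refine div_le_div_of_nonneg_right ?_ hδ.le
      have := mul_le_mul_of_nonneg_left hln hn0.le
      nlinarith
    have e1 : lam / (512 * (φ * (1 + φ)) * n * V) * (C * (n ^ 2 * l ^ 2 / lam * A)) =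
        C * (l * A) * (n * l) / (512 * (φ * (1 + φ)) * V) := by
      field_simp
    rw [e1, le_div_iff₀ (by positivity)]
    have e2 := mul_le_mul_of_nonneg_right hC (show 0 ≤ l * A * (n * l) by positivity)
    have e3 := mul_le_mul_of_nonneg_right e0 (show 0 ≤ 1024 * (φ * (1 + φ)) * V by positivity)
    have e4 := mul_le_mul_of_nonneg_left hVle
      (show 0 ≤ 20 * (l * A) * (1024 * (φ * (1 + φ))) by positivity)
    have e5 : 0 ≤ φ * (1 + φ) * (l * A * (n * l)) := by positivity
    nlinarith
  · congr 3
    field_simp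
    norm_num [mul_comm]

end Cutoff

end Final

/-! ### A single execution of the sampler -/

section SingleRun

open MeasureTheory

variable {n : ℕ} [NeZero n] {Q : PMF (Sym2 (Fin n))} {D : PMF (Fin n)}
  (hQ : IsPairDistribution Q) (hD : ∀ x, 0 < (D x).toReal) (hn : 2 ≤ n)
  (hG : (pairGraph Q).Connected) {p : Fin n → ℝ} (hp : ∀ x, 0 < p x ∧ p x ≤ 1)

include hQ hD hn hG hp in
theorem exists_sampler_tail : ∃ K κ : ℝ, 0 < κ ∧ ∀ k,
    tapeLaw Q D {ω | Running p (.done none) k ω} ≤ ENNReal.ofReal (K * Real.exp (-(κ * k))) := by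
  obtain ⟨a, b, ρ, ha, hρ, h1, h2, h3⟩ := exists_rate_bounds hD hp Q
  have hb : 0 < b := ha.trans_le ((h1 0).trans (h2 0))
  have hlam := fiedler_pos hn hG
  have hn0 : (0 : ℝ) < n := by exact_mod_cast (by omega : 0 < n)
  exact ⟨_, _, by positivity, sampler_tail hQ hD hp hn hG ha hρ h1 h2 h3⟩

include hQ hD hn hG hp in
theorem exists_loop_tail : ∃ K κ : ℝ, 0 < κ ∧ ∀ k,
    tapeLaw Q D {ω | Running p (.run id) k ω} ≤ ENNReal.ofReal (K * Real.exp (-(κ * k))) := by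
  obtain ⟨a, b, ρ, ha, hρ, h1, h2, h3⟩ := exists_rate_bounds hD hp Q
  have hb : 0 < b := ha.trans_le ((h1 0).trans (h2 0))
  have hlam := fiedler_pos hn hG
  have hn0 : (0 : ℝ) < n := by exact_mod_cast (by omega : 0 < n)
  have hlog : 0 < Real.log (1 + (n * b / a) ^ 2) := Real.log_pos (by
    have : 0 < (n * b / a) ^ 2 := by positivity
    linarith)
  exact ⟨_, _, by positivity, loop_tail hQ hD hp hn hG ha hρ h1 h2 h3 rfl rfl⟩

include hQ hD hn hG hp in
theorem measure_sampler_output (x : Fin n) :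
    tapeLaw Q D {ω | ∃ k, cfgAt p (.done none) k (.run id, ω) = .done (some x)} =
      ENNReal.ofReal ((D x).toReal / ∑ y, (D y).toReal / p y) := by
  obtain ⟨K, κ, hκ, htail⟩ := exists_sampler_tail hQ hD hn hG hp
  rw [measure_output hQ hD hp (Cfg.proper_done none) hn hκ x (c := 0) (fun y => rfl) le_rfl
    zero_le_one (.inl ⟨rfl, rfl⟩) htail]
  congr 1
  have : ∑ y, statWeight D p y * (p y * (if y = x then 1 else 0) + (1 - p y) * 0) =
      (D x).toReal := by
    have hx := (hp x).1.ne'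
    simp [statWeight, div_mul_cancel₀ _ hx]
  simp only [statMean, id, this]
  rfl

include hQ hD hn hG hp in
theorem measure_loop_output (x : Fin n) :
    tapeLaw Q D {ω | ∃ k, cfgAt p (.run id) k (.run id, ω) = .done (some x)} = D x := by
  obtain ⟨K, κ, hκ, htail⟩ := exists_loop_tail hQ hD hn hG hp
  have hG0 : 0 < ∑ y, statWeight D p y :=
    Finset.sum_pos (fun y _ => div_pos (hD y) (hp y).1) ⟨0, Finset.mem_univ _⟩
  -- Self-consistency of the guess c = D(x): the mean is (D(x) + (G - 1)D(x))/G, because ∑ g p = 1.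
  have hmean : statMean D p (fun y => p y * (if y = x then 1 else 0) + (1 - p y) * (D x).toReal)
      id = (D x).toReal := by
    rw [statMean, div_eq_iff hG0.ne']
    have h1 : ∀ y, statWeight D p y * (p (id y) * (if id y = x then 1 else 0) +
        (1 - p (id y)) * (D x).toReal) = statWeight D p y * p y * (if y = x then 1 else 0) +
          (D x).toReal * statWeight D p y - (D x).toReal * (statWeight D p y * p y) := fun y => by
      simp only [id]; ring
    have hx := (hp x).1.ne'
    simp only [h1, Finset.sum_sub_distrib, Finset.sum_add_distrib, ← Finset.mul_sum,
      sum_statWeight_mul fun x => (hp x).1]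
    simp [statWeight, div_mul_cancel₀ _ hx]
  have hle : (D x).toReal ≤ 1 := ENNReal.toReal_le_of_le_ofReal zero_le_one (by
    simpa using D.coe_le_one x)
  rw [measure_output hQ hD hp (Cfg.proper_run (not_coal_id hn)) hn hκ x
    (c := (D x).toReal) (fun y => rfl) (hD x).le hle (.inr ⟨rfl, hmean.symm⟩) htail, hmean,
    ENNReal.ofReal_toReal (D.apply_ne_top x)]

theorem exec_exactSampler_initState {ω : Tape n} (hω : ∀ i, ValidDraw (ω.1 i)) (hn : 2 ≤ n)
    {p : Fin n → ℝ} {k : ℕ} {o : Option (Fin n)}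
    (hk : cfgAt p (.done none) k (.run id, ω) = .done o) :
    ∃ τ, Exec ω exactSampler (initState n (samplerInput p)) τ ∧ τ.nat vOut 0 = outCode o ∧
      τ.draws ≤ k ∧ τ.steps ≤ 58 * τ.draws ^ 2 := by
  obtain ⟨j, τ, h1, h2, h3, h4, h5, h6⟩ := exec_exactSampler hω hn
    (σ := initState n (samplerInput p)) (p := p) (k := k) (o := o) (by simp [initState])
    (fun x => by simp [initState, samplerInput]) (by simpa [initState, Tape.adv_zero] using hk)
  simp only [initState, zero_add] at h4 h5
  refine ⟨τ, h2, h3, by omega, h5.trans ?_⟩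
  rw [h4]
  have hj : 1 ≤ j := by omega
  -- Here n ≤ j + 1 and j ≥ 1 convert the dependence on n into draws.
  calc (j + 1) * (10 * n + 9) ≤ (2 * j) * (29 * j) := Nat.mul_le_mul (by omega) (by omega)
    _ = 58 * j ^ 2 := by ring

include hQ hD hn hG hp

theorem ae_exists_exec_sampler : ∀ᵐ ω ∂(tapeLaw Q D), (∀ i, ValidDraw (ω.1 i)) ∧
    ∃ k o, cfgAt p (.done none) k (.run id, ω) = .done o := by
  obtain ⟨K, κ, hκ, htail⟩ := exists_sampler_tail hQ hD hn hG hp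
  filter_upwards [ae_validTape hQ hD, ae_stops hκ htail] with ω h1 h2 using ⟨h1, h2⟩

theorem measure_exec_sampler_output (x : Fin n) :
    tapeLaw Q D {ω | ∃ τ, Exec ω exactSampler (initState n (samplerInput p)) τ ∧
      τ.nat vOut 0 = (x : ℕ) + 1} =
      ENNReal.ofReal ((D x).toReal / ∑ y, (D y).toReal / p y) := by
  rw [← measure_sampler_output hQ hD hn hG hp x]
  refine measure_congr ?_
  filter_upwards [ae_exists_exec_sampler hQ hD hn hG hp] with ω ⟨hω, k, o, hk⟩
  refine propext ⟨?_, ?_⟩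
  · rintro ⟨τ, h1, h2⟩
    obtain ⟨τ', h3, h4, -⟩ := exec_exactSampler_initState hω hn hk
    rw [h1.det h3, h4] at h2
    refine ⟨k, hk.trans ?_⟩
    cases o with
    | none => simp [outCode] at h2
    | some y => simp only [outCode, Nat.add_right_cancel_iff] at h2; rw [Fin.ext h2]
  · rintro ⟨k', hk'⟩
    obtain ⟨τ', h3, h4, -⟩ := exec_exactSampler_initState hω hn hk'
    exact ⟨τ', h3, h4⟩

omit hG hp in
theorem measure_compl_sampler_draws_le {B : ℝ} (hB : 0 ≤ B) :
    tapeLaw Q D {ω | ∃ τ, Exec ω exactSampler (initState n (samplerInput p)) τ ∧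
      (τ.draws : ℝ) ≤ B}ᶜ ≤ tapeLaw Q D {ω | Running p (.done none) ⌊B⌋₊ ω} := by
  refine measure_mono_ae ?_
  filter_upwards [ae_validTape hQ hD] with ω hω h
  by_contra hrun
  rcases hk : cfgAt p (.done none) ⌊B⌋₊ (.run id, ω) with F | o
  · exact hrun ⟨F, hk⟩
  · obtain ⟨τ, h1, -, h2, -⟩ := exec_exactSampler_initState hω hn hk
    exact h ⟨τ, h1, (Nat.cast_le.2 h2).trans (Nat.floor_le hB)⟩

end SingleRun

/-! ### The full algorithm -/

section FullAlgorithm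

open MeasureTheory

variable {n : ℕ} [NeZero n] {Q : PMF (Sym2 (Fin n))} {D : PMF (Fin n)}

/-- The estimate that the learner computes from the draws `a`. -/
noncomputable def learnedDist (φ : ℝ) (m : ℕ) (a : ℕ → Fin n × Fin n × Fin n) : Fin n → ℝ :=
  softmax (logEstimate (Real.log φ) a m)

omit [NeZero n] in
theorem learnedDist_congr (φ : ℝ) (m : ℕ) (a b : ℕ → Fin n × Fin n × Fin n)
    (h : ∀ i < m, a i = b i) : learnedDist φ m a = learnedDist φ m b := by
  rw [learnedDist, learnedDist, logEstimate_congr _ h]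

theorem learnedDist_bounds (φ : ℝ) (m : ℕ) (a : ℕ → Fin n × Fin n × Fin n) (x : Fin n) :
    0 < learnedDist φ m a x ∧ learnedDist φ m a x ≤ 1 :=
  ⟨softmax_pos (NeZero.pos n) _ x, softmax_le_one (NeZero.pos n) _ x⟩

omit [NeZero n] in
theorem exec_learningPhase_estimate {ω : Tape n} (hω : ∀ i, ValidDraw (ω.1 i)) (c : ℕ)
    {δ lam φ : ℝ} : ∃ τ, Exec ω (learningPhase (learner c))
      (initState n (algorithmInput δ lam φ)) τ ∧ τ.nat vN 0 = n ∧
      τ.estimate n = learnedDist φ (learnDraws c n δ lam) ω.1 := by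
  obtain ⟨τ, h1, h2, h3, -⟩ := exec_learningPhase hω c rfl
  exact ⟨τ, h1, h2, funext h3⟩

theorem exec_exactSamplerWithLearning {ω : Tape n} (hω : ∀ i, ValidDraw (ω.1 i)) (hn : 2 ≤ n)
    (c : ℕ) {δ lam φ : ℝ} {m : ℕ} (hm : m = learnDraws c n δ lam) {k : ℕ} {o : Option (Fin n)}
    (hk : cfgAt (learnedDist φ m ω.1) (.run id) k (.run id, ω.adv m 0) = .done o) :
    ∃ τ x, Exec ω (exactSamplerWithLearning (learner c))
        (initState n (algorithmInput δ lam φ)) τ ∧ o = some x ∧ τ.nat vOut 0 = (x : ℕ) + 1 ∧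
      τ.draws ≤ m + k ∧ τ.steps ≤ 165 * τ.draws ^ 2 := by
  obtain ⟨σ, h1, h2, h3, h4, h5, h6⟩ := exec_learningPhase hω c (φ := φ) hm
  obtain ⟨j, τ, x, e1, e2, e3, e4, e5, e6, e7⟩ := exec_samplerLoop hω hn
    (σ := (σ.writeN vOut 0 0).tick) (p := learnedDist φ m ω.1) (k := k) (o := o)
    (by simp [h2]) (fun x => by rw [learnedDist]; simpa using h3 x) (by simp) (by simpa [h4, h5] using hk)
  refine ⟨τ, x, .seq h1 (.seq (.setN _ _ _ _) e3), e1, e4, ?_, ?_⟩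
  · simp only [State.tick_draws, State.writeN_draws, h4] at e5; omega
  · simp only [State.tick_draws, State.writeN_draws, h4] at e5
    simp only [State.tick_steps, State.writeN_steps] at e6
    have hj : 1 ≤ j := by omega
    set N := τ.draws with hN
    -- Both phases are bounded by the total N = m + j of draws, using n ≤ j + 1 ≤ N + 1; the sum
    -- 82N(N + 1) + 1 is at most 165N².
    have f1 : (m + 1) * (6 * n + 5 * m + 14) ≤ (N + 1) * (31 * N) :=
      Nat.mul_le_mul (by omega) (by omega)
    have f2 : (j + 1) * (17 * n + 17) ≤ (N + 1) * (51 * N) :=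
      Nat.mul_le_mul (by omega) (by omega)
    have f3 : 1 ≤ N := by omega
    nlinarith

variable (hQ : IsPairDistribution Q) {φ : ℝ} (hφ : 1 < φ) (hn : 2 ≤ n)
  (hG : (pairGraph Q).Connected) (hB : BoundedRatios D Q φ) (c : ℕ) {δ : ℝ}

include hQ hG hB hn

/-- Conditionally on the learning draws, the loop runs on a fresh tape with a fixed vector in (0,
1]ⁿ, for which it halts almost surely whatever the quality of the estimate. -/
theorem ae_exists_exec_loop (m : ℕ) : ∀ᵐ ω ∂(tapeLaw Q D), (∀ i, ValidDraw (ω.1 i)) ∧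
    ∃ k o, cfgAt (learnedDist φ m ω.1) (.run id) k (.run id, ω.adv m 0) = .done o := by
  have hD := pos_of_boundedRatios hG hB
  refine (ae_validTape hQ hD).and ?_
  rw [ae_iff]
  have hS : ∀ p : Fin n → ℝ, MeasurableSet
      {ω : Tape n | ¬ ∃ k o, cfgAt p (.run id) k (.run id, ω) = .done o} := fun p => by
    have h : {ω : Tape n | ∃ k o, cfgAt p (.run id) k (.run id, ω) = .done o} =
        ⋃ k, {ω | cfgAt p (.run id) k (.run id, ω) ∈ Set.range Cfg.done} := by
      ext ω; simp [eq_comm]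
    have h' := MeasurableSet.iUnion fun k =>
      measurableSet_cfgAt p (.run id) k (Set.range Cfg.done)
    rw [← h] at h'
    exact h'.compl
  refine (measure_adv_draws Q D m (learnedDist_congr φ m) hS).trans ?_
  rw [lintegral_eq_zero_of_ae_eq_zero]
  refine Filter.Eventually.of_forall fun a => ?_
  obtain ⟨K, κ, hκ, htail⟩ := exists_loop_tail hQ hD hn hG (learnedDist_bounds φ m a)
  exact ae_stops hκ htail

/-- The conditional output law given the learning draws is D for every estimate, so averaging over
the estimate changes nothing. -/
theorem measure_exec_output (lam : ℝ) (x : Fin n) :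
    tapeLaw Q D {ω | ∃ τ, Exec ω (exactSamplerWithLearning (learner c))
      (initState n (algorithmInput δ lam φ)) τ ∧ τ.nat vOut 0 = (x : ℕ) + 1} = D x := by
  have hD := pos_of_boundedRatios hG hB
  set m := learnDraws c n δ lam with hm
  have hS : ∀ p : Fin n → ℝ, MeasurableSet
      {ω : Tape n | ∃ k, cfgAt p (.run id) k (.run id, ω) = .done (some x)} := fun p => by
    have h : {ω : Tape n | ∃ k, cfgAt p (.run id) k (.run id, ω) = .done (some x)} =
        ⋃ k, {ω | cfgAt p (.run id) k (.run id, ω) ∈ ({.done (some x)} : Set (Cfg n))} := by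
      ext ω; simp
    rw [h]
    exact MeasurableSet.iUnion fun k => measurableSet_cfgAt p (.run id) k _
  have h := measure_adv_draws Q D m (learnedDist_congr φ m) hS
  simp only [measure_loop_output hQ hD hn hG (learnedDist_bounds φ m _) x, lintegral_const,
    measure_univ, mul_one] at h
  rw [← h]
  refine measure_congr ?_
  filter_upwards [ae_exists_exec_loop hQ hn hG hB (φ := φ) m] with ω ⟨hω, k, o, hk⟩
  refine propext ⟨?_, ?_⟩
  · rintro ⟨τ, h1, h2⟩
    obtain ⟨τ', y, h3, h4, h5, -⟩ := exec_exactSamplerWithLearning hω hn c hm hk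
    rw [h1.det h3, h5, Nat.add_right_cancel_iff] at h2
    exact ⟨k, by rw [hk, h4, Fin.ext h2]⟩
  · rintro ⟨k', hk'⟩
    obtain ⟨τ', y, h3, h4, h5, -⟩ := exec_exactSamplerWithLearning hω hn c hm hk'
    rw [Option.some.injEq] at h4
    exact ⟨τ', h3, by rw [h5, h4]⟩

omit [NeZero n] in
theorem measure_compl_estimate_le :
    tapeLaw Q D {ω | ∃ τ, Exec ω (learningPhase (learner c))
      (initState n (algorithmInput δ (fiedler hn Q) φ)) τ ∧
      RelErrorLE D (τ.estimate n) (1 / √n)}ᶜ ≤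
    (Measure.infinitePi fun _ : ℕ => (samp Q D).toMeasure) {a | ¬ RelErrorLE D
      (learnedDist φ (learnDraws c n δ (fiedler hn Q)) a) (1 / √n)} := by
  refine (measure_mono_ae ?_).trans (measure_tape_fst_le Q D _)
  filter_upwards [ae_validTape hQ (pos_of_boundedRatios hG hB)] with ω hω h hcon
  obtain ⟨τ, h1, -, h2⟩ := exec_learningPhase_estimate hω c
  exact h ⟨τ, h1, h2 ▸ hcon⟩

include hφ in
theorem measure_compl_draws_le (hc0 : 0 < c) (hc : Suffices φ c) (hδ : 0 < δ) (hδ1 : δ < 1)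
    {C : ℝ} (hC : 8 * c + 622080 * (φ * (1 + φ)) ≤ C) :
    tapeLaw Q D {ω | ∃ τ, Exec ω (exactSamplerWithLearning (learner c))
      (initState n (algorithmInput δ (fiedler hn Q) φ)) τ ∧
      (τ.draws : ℝ) ≤ C * ((n : ℝ) ^ 2 * Real.log n ^ 2 / fiedler hn Q * Real.log (2 / δ))}ᶜ ≤
    ENNReal.ofReal δ := by
  have hD := pos_of_boundedRatios hG hB
  have hlam := fiedler_pos hn hG
  have hlam2 := fiedler_le_two hn hQ hD hG
  have hn0 : (0 : ℝ) < n := by exact_mod_cast (by omega : 0 < n)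
  have hn2 : (2 : ℝ) ≤ n := by exact_mod_cast hn
  set m := learnDraws c n δ (fiedler hn Q) with hm
  set T := (n : ℝ) ^ 2 * Real.log n ^ 2 / fiedler hn Q * Real.log (2 / δ) with hT
  have hl := half_le_log hn
  have hA2 := le_log_two_div hδ hδ1
  have ht := Real.log_two_gt_d9
  have hT0 : 0 ≤ T := by
    have : 0 < Real.log (2 / δ) := by linarith
    positivity
  -- Rounding up at most doubles M because M ≥ 1. The second factor log n and the passage from
  -- log(4/δ) to log(2/δ) cost a factor 2 each.
  have hmT : (m : ℝ) ≤ 8 * c * T := by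
    have hA4 : Real.log (4 / δ) ≤ 2 * Real.log (2 / δ) := by
      rw [show 4 / δ = 2 * (2 / δ) by ring, Real.log_mul (by norm_num) (by positivity)]
      linarith
    have h1 := one_le_log_four_div hδ hδ1
    have hc1 : (1 : ℝ) ≤ c := by exact_mod_cast hc0
    set M := (c : ℝ) * ((n : ℝ) * n) * Real.log n * Real.log (4 / δ) / fiedler hn Q with hM
    have hM1 : 1 ≤ M := by
      rw [hM, le_div_iff₀ hlam]
      have e1 : 4 ≤ (n : ℝ) * n := by nlinarith
      have e2 : 4 ≤ c * ((n : ℝ) * n) := by nlinarith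
      have e3 : 2 ≤ c * ((n : ℝ) * n) * Real.log n := by nlinarith
      nlinarith
    have hm2 : (m : ℝ) < M + 1 := Nat.ceil_lt_add_one (by linarith)
    have hMT : M ≤ 4 * c * T := by
      have e1 : Real.log n * Real.log (4 / δ) ≤
          4 * (Real.log n ^ 2 * Real.log (2 / δ)) := by
        have : 0 ≤ Real.log n * Real.log (2 / δ) := by
          apply mul_nonneg <;> linarith
        nlinarith
      calc M = c * ((n : ℝ) * n) / fiedler hn Q * (Real.log n * Real.log (4 / δ)) := by
            rw [hM]; ring
        _ ≤ c * ((n : ℝ) * n) / fiedler hn Q * (4 * (Real.log n ^ 2 * Real.log (2 / δ))) := by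
            gcongr
        _ = 4 * c * T := by rw [hT]; ring
    linarith
  set P := Measure.infinitePi fun _ : ℕ => (samp Q D).toMeasure
  set B := 622080 * (φ * (1 + φ)) * T with hBdef
  -- Accuracy is part of the event, so its probability is at most δ/2 for every vector; inaccurate
  -- estimates are charged separately to the other δ/2.
  let S : (Fin n → ℝ) → Set (Tape n) := fun p =>
    {ω | RelErrorLE D p (1 / √n) ∧ Running p (.run id) ⌊B⌋₊ ω}
  have hS : ∀ p, MeasurableSet (S p) := fun p => by
    by_cases hp : RelErrorLE D p (1 / √n)
    · have h : S p = {ω | cfgAt p (.run id) ⌊B⌋₊ (.run id, ω) ∈ Set.range Cfg.run} := by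
        ext ω
        exact ⟨fun hω => hω.2.imp fun F hF => hF.symm, fun hω => ⟨hp, hω.imp fun F hF => hF.symm⟩⟩
      rw [h]
      exact measurableSet_cfgAt _ _ _ _
    · have h : S p = ∅ := Set.eq_empty_of_forall_notMem fun ω hω => hp hω.1
      rw [h]; exact MeasurableSet.empty
  have hbad : tapeLaw Q D {ω | ω.adv m 0 ∈ S (learnedDist φ m ω.1)} ≤ ENNReal.ofReal (δ / 2) := by
    rw [measure_adv_draws Q D m (learnedDist_congr φ m) hS]
    calc _ ≤ ∫⁻ _, ENNReal.ofReal (δ / 2) ∂P := lintegral_mono fun a => by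
          by_cases hp : RelErrorLE D (learnedDist φ m a) (1 / √n)
          · refine (measure_mono fun ω hω => hω.2).trans (measure_loop_running_le hQ hφ hn hG hB
              (learnedDist_bounds φ m a) hp hδ hδ1 le_rfl)
          · have h : S (learnedDist φ m a) = ∅ :=
              Set.eq_empty_of_forall_notMem fun ω hω => hp hω.1
            simp only [h, measure_empty, zero_le]
      _ = _ := by simp
  have hlearn : tapeLaw Q D {ω | ¬ RelErrorLE D (learnedDist φ m ω.1) (1 / √n)} ≤
      ENNReal.ofReal (δ / 2) :=
    (measure_tape_fst_le Q D _).trans (measure_not_relErrorLE hn hQ hφ hG hB hc0 hc hδ hδ1)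
  calc _ ≤ tapeLaw Q D ({ω | ¬ RelErrorLE D (learnedDist φ m ω.1) (1 / √n)} ∪
        {ω | ω.adv m 0 ∈ S (learnedDist φ m ω.1)}) := by
        refine measure_mono_ae ?_
        filter_upwards [ae_validTape hQ hD] with ω hω h
        by_cases hp : RelErrorLE D (learnedDist φ m ω.1) (1 / √n)
        · refine Or.inr ⟨hp, ?_⟩
          by_contra hrun
          rcases hk : cfgAt (learnedDist φ m ω.1) (.run id) ⌊B⌋₊ (.run id, ω.adv m 0) with F | o
          · exact hrun ⟨F, hk⟩
          · obtain ⟨τ, x, h1, -, -, h2, -⟩ := exec_exactSamplerWithLearning hω hn c hm hk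
            refine h ⟨τ, h1, ?_⟩
            have hB0 : 0 ≤ B := by positivity
            have h3 : (τ.draws : ℝ) ≤ m + ⌊B⌋₊ := by exact_mod_cast h2
            have h4 := Nat.floor_le hB0
            have h5 := mul_le_mul_of_nonneg_right hC hT0
            linarith
        · exact Or.inl hp
    _ ≤ _ := measure_union_le _ _
    _ ≤ ENNReal.ofReal (δ / 2) + ENNReal.ofReal (δ / 2) := add_le_add hlearn hbad
    _ = ENNReal.ofReal δ := by
        rw [← ENNReal.ofReal_add (by positivity) (by positivity), add_halves]

end FullAlgorithm

end PairwiseSampling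

open PairwiseSampling MeasureTheory in
theorem theorem2 (φ : ℝ) (hφ : 1 < φ) :
    ∃ (learn : Stmt) (C : ℝ) (k : ℕ),
      ∀ (n : ℕ) (hn : 2 ≤ n) (D : PMF (Fin n)) (Q : PMF (Sym2 (Fin n))),
        IsPairDistribution Q → (pairGraph Q).Connected → BoundedRatios D Q φ →
        -- A single execution of the parameterized sampler:
        -- it halts, in time polynomial in the number of draws,
        (∀ p : Fin n → ℝ, (∀ x, 0 < p x ∧ p x ≤ 1) →
          (∀ᵐ ω ∂(tapeLaw Q D), ∃ τ, Exec ω exactSampler (initState n (samplerInput p)) τ ∧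
            (τ.steps : ℝ) ≤ C * (τ.draws : ℝ) ^ k) ∧
          -- it outputs `x` with probability proportional to `D x` (and otherwise `⊥`),
          (∀ x : Fin n,
            tapeLaw Q D {ω | ∃ τ, Exec ω exactSampler (initState n (samplerInput p)) τ ∧
              τ.nat vOut 0 = (x : ℕ) + 1} =
            ENNReal.ofReal ((D x).toReal / ∑ y, (D y).toReal / p y)) ∧
          -- and it needs few draws if `p` is a good estimate of `D`.
          (RelErrorLE D p (1 / √(n : ℝ)) → ∀ δ : ℝ, 0 < δ → δ < 1 →
            ENNReal.ofReal (1 - δ) ≤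
              tapeLaw Q D {ω | ∃ τ, Exec ω exactSampler (initState n (samplerInput p)) τ ∧
                (τ.draws : ℝ) ≤ C * (n * Real.log n / fiedler hn Q * Real.log (2 / δ))})) ∧
        -- The whole algorithm:
        (∀ δ : ℝ, 0 < δ → δ < 1 →
          -- the learning phase always produces a distribution with full support,
          (∀ᵐ ω ∂(tapeLaw Q D), ∃ τ,
            Exec ω (learningPhase learn)
              (initState n (algorithmInput δ (fiedler hn Q) φ)) τ ∧
            τ.nat vN 0 = n ∧ (∀ x, 0 < τ.estimate n x) ∧ ∑ x, τ.estimate n x = 1) ∧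
          -- which is accurate with probability at least `1 - δ`;
          ENNReal.ofReal (1 - δ) ≤
            tapeLaw Q D {ω | ∃ τ,
              Exec ω (learningPhase learn)
                (initState n (algorithmInput δ (fiedler hn Q) φ)) τ ∧
              RelErrorLE D (τ.estimate n) (1 / √(n : ℝ))} ∧
          -- the algorithm halts, in time polynomial in the number of draws,
          (∀ᵐ ω ∂(tapeLaw Q D), ∃ τ,
            Exec ω (exactSamplerWithLearning learn)
              (initState n (algorithmInput δ (fiedler hn Q) φ)) τ ∧
            (τ.steps : ℝ) ≤ C * (τ.draws : ℝ) ^ k) ∧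
          -- its output is distributed exactly as `D`,
          (∀ x : Fin n,
            tapeLaw Q D {ω | ∃ τ,
              Exec ω (exactSamplerWithLearning learn)
                (initState n (algorithmInput δ (fiedler hn Q) φ)) τ ∧
              τ.nat vOut 0 = (x : ℕ) + 1} = D x) ∧
          -- and with probability at least `1 - δ` the number of draws is as claimed.
          ENNReal.ofReal (1 - δ) ≤
            tapeLaw Q D {ω | ∃ τ,
              Exec ω (exactSamplerWithLearning learn)
                (initState n (algorithmInput δ (fiedler hn Q) φ)) τ ∧
              (τ.draws : ℝ) ≤
                C * ((n : ℝ) ^ 2 * Real.log n ^ 2 / fiedler hn Q * Real.log (2 / δ))}) := by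
  obtain ⟨c, hc0, hc⟩ := exists_suffices hφ
  set ψ := φ * (1 + φ) with hψ
  have hψ1 : 1 ≤ ψ := by nlinarith
  have hc1 : (0 : ℝ) ≤ c := Nat.cast_nonneg c
  -- 8c pays for the learning draws and 622080ψ for the loop. The latter also exceeds the constant
  -- of a single run and, as ψ ≥ 1, the factors 58 and 165 of the quadratic step bounds.
  refine ⟨learner c, 8 * c + 622080 * ψ, 2, fun n hn D Q hQ hG hB => ?_⟩
  have : NeZero n := ⟨by omega⟩
  have hD := pos_of_boundedRatios hG hB
  have hlam := fiedler_pos hn hG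
  have hn0 : (0 : ℝ) < n := by exact_mod_cast (by omega : 0 < n)
  refine ⟨fun p hp => ⟨?_, measure_exec_sampler_output hQ hD hn hG hp, fun hrel δ hδ hδ1 => ?_⟩,
    fun δ hδ hδ1 => ⟨?_, ?_, ?_, measure_exec_output hQ hn hG hB c _, ?_⟩⟩
  · filter_upwards [ae_exists_exec_sampler hQ hD hn hG hp] with ω ⟨hω, k, o, hk⟩
    obtain ⟨τ, h1, -, -, h2⟩ := exec_exactSampler_initState hω hn hk
    refine ⟨τ, h1, ?_⟩
    have h3 : (τ.steps : ℝ) ≤ 58 * (τ.draws : ℝ) ^ 2 := by exact_mod_cast h2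
    exact h3.trans (mul_le_mul_of_nonneg_right (by linarith) (sq_nonneg _))
  · have hl := half_le_log hn
    have hA := le_log_two_div hδ hδ1
    have ht := Real.log_two_gt_d9
    have hA0 : 0 ≤ Real.log (2 / δ) := by linarith
    refine ofReal_one_sub_le hδ.le ((measure_compl_sampler_draws_le hQ hD hn (by positivity)).trans
      (measure_sampler_running_le hQ hφ hn hG hB hp hrel hδ hδ1 ?_))
    linarith
  · filter_upwards [ae_validTape hQ hD] with ω hω
    obtain ⟨τ, h1, h2, h3⟩ := exec_learningPhase_estimate hω c
    refine ⟨τ, h1, h2, ?_, ?_⟩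
    · rw [h3]; exact fun x => (learnedDist_bounds _ _ _ x).1
    · rw [h3]; exact sum_softmax (by omega) _
  · refine ofReal_one_sub_le hδ.le ((measure_compl_estimate_le hQ hn hG hB c).trans
      ((measure_not_relErrorLE hn hQ hφ hG hB hc0 hc hδ hδ1).trans
        (ENNReal.ofReal_le_ofReal (by linarith))))
  · filter_upwards [ae_exists_exec_loop hQ hn hG hB (learnDraws c n δ (fiedler hn Q))]
      with ω ⟨hω, k, o, hk⟩
    obtain ⟨τ, x, h1, -, -, -, h2⟩ := exec_exactSamplerWithLearning hω hn c rfl hk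
    refine ⟨τ, h1, ?_⟩
    have h3 : (τ.steps : ℝ) ≤ 165 * (τ.draws : ℝ) ^ 2 := by exact_mod_cast h2
    exact h3.trans (mul_le_mul_of_nonneg_right (by linarith) (sq_nonneg _))
  · exact ofReal_one_sub_le hδ.le (measure_compl_draws_le hQ hφ hn hG hB c hc0 hc hδ hδ1 le_rfl)
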